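/- Let $\Bbbk$ be an arbitrary field and let $H$ be a finite-dimensional Hopf algebra over $\Bbbk$ with comultiplication $\Delta(h)=h_{(1)}\otimes h_{(2)}$ and counit $\varepsilon$. Let $G(H)$ be the group of grouplike elements of $H$, and let $\mathcal{C}$ be the category of finite-dimensional left $H$-comodules. Fix a non-zero right cointegral $\lambda_H : H \to \Bbbk$, that is, a non-zero linear form with $\lambda_H(h_{(1)})\,h_{(2)}=\lambda_H(h)\,1$ for all $h\in H$, and a non-zero left integral $\Lambda\in H$, that is, a non-zero element with $h\Lambda=\varepsilon(h)\Lambda$ for all $h\in H$. Let $g_H\in G(H)$ be the unique grouplike element such that $h_{(1)}\,\lambda_H(h_{(2)})=\lambda_H(h)\,g_H$ for all $h\in H$, and let $\alpha_H:H\to\Bbbk$ be the unique linear form such that $\Lambda h=\alpha_H(h)\Lambda$ for all $h\in H$. Let $A$ be a left coideal subalgebra of $H$, that is, a subalgebra with $\Delta(A)\subseteq H\otimes A$; it is an algebra in $\mathcal{C}$ with coaction the restriction of $\Delta$. Let ${}_A\mathcal{C}_A$ be the category of $A$-bimodules in $\mathcal{C}$ (relative Hopf bimodules). We say that ${}_A\mathcal{C}_A$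 is unimodular if its Nakayama functor $$\mathbb{N}(M)=\int^{X\in {}_A\mathcal{C}_A}\operatorname{Hom}_{{}_A\mathcal{C}_A}(M,X)^*\otimes_{\Bbbk} X$$ satisfies $\mathbb{N}(A)\cong A$ in ${}_A\mathcal{C}_A$, where $A$ is the unit object for $\otimes_A$. Suppose that there are $g_A\in G(H)$ and a non-zero $g_A$-cointegral $\lambda_A$ on $A$, that is, a non-zero linear form $\lambda_A:A\to\Bbbk$ with $a_{(1)}\,\lambda_A(a_{(2)})=\lambda_A(a)\,g_A$ for all $a\in A$. Then $\lambda_A$ is a Frobenius trace on $A$ (the map $A\to A^*$, $a\mapsto\lambda_A(a\,\cdot\,)$, is bijective), so that its Nakayama automorphism $\nu_A:A\to A$, determined by $\lambda_A(ba)=\lambda_A(\nu_A(a)b)$ for all $a,b\in A$, is defined. Moreover, ${}_A\mathcal{C}_A$ is unimodular if and only if $$g_H^{-1}g_A^{2}\in A\qquad\text{and}\qquad \varepsilon\circ\nu_A^{2}=\alpha_H|_A .$$ -/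

import Mathlib

open CategoryTheory Opposite
open scoped TensorProduct

universe u

/-! ## Comodule algebras and left coideal subalgebras -/

section ComoduleAlgebras

variable (k H : Type u) [Field k] [Ring H] [HopfAlgebra k H]

/-- A structure of a left `H`-comodule algebra on the algebra `A`: a counital and coassociative
left coaction `A → H ⊗ A` that is a morphism of algebras. -/
structure LeftComoduleAlgebra (A : Type u) [Ring A] [Algebra k A] where
  coact : A →ₐ[k] H ⊗[k] A
  coassoc : ∀ a : A,
    TensorProduct.assoc k H H A ((Coalgebra.comul (R := k) (A := H)).rTensor A (coact a)) =
      coact.toLinearMap.lTensor H (coact a)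
  counit_coact : ∀ a : A,
    TensorProduct.lid k A ((Coalgebra.counit (R := k) (A := H)).rTensor A (coact a)) = a

variable {k H}

/-- A subalgebra `A` of `H` is a left coideal subalgebra if `Δ(A) ⊆ H ⊗ A`. -/
def IsLeftCoidealSubalgebra (A : Subalgebra k H) : Prop :=
  ∀ a ∈ A, Coalgebra.comul (R := k) a ∈ LinearMap.range (A.val.toLinearMap.lTensor H)

namespace IsLeftCoidealSubalgebra

/-- The algebra map `H ⊗ A → H ⊗ H` induced by the inclusion `A ⊆ H`. -/
noncomputable def incl (A : Subalgebra k H) : H ⊗[k] A →ₐ[k] H ⊗[k] H :=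
  Algebra.TensorProduct.map (AlgHom.id k H) A.val

theorem incl_eq (A : Subalgebra k H) (x : H ⊗[k] A) :
    incl A x = A.val.toLinearMap.lTensor H x := rfl

theorem incl_injective (A : Subalgebra k H) : Function.Injective (incl A) :=
  Module.Flat.lTensor_preserves_injective_linearMap A.val.toLinearMap Subtype.val_injective

/-- The restriction `A → H ⊗ A` of the comultiplication of `H` to a left coideal subalgebra. -/
noncomputable def coaction {A : Subalgebra k H} (hA : IsLeftCoidealSubalgebra A) :
    A →ₐ[k] H ⊗[k] A :=
  (AlgEquiv.ofInjective (incl A) (incl_injective A)).symm.toAlgHom.comp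
    (((Bialgebra.comulAlgHom k H).comp A.val).codRestrict (incl A).range
      (fun a => hA a a.2))

theorem incl_coaction {A : Subalgebra k H} (hA : IsLeftCoidealSubalgebra A) (a : A) :
    A.val.toLinearMap.lTensor H (hA.coaction a) = Coalgebra.comul (R := k) (a : H) := by
  have h := (AlgEquiv.ofInjective (incl A) (incl_injective A)).apply_symm_apply
    (((Bialgebra.comulAlgHom k H).comp A.val).codRestrict (incl A).range
      (fun a => hA a a.2) a)
  exact congrArg Subtype.val h

/-- A left coideal subalgebra is a left `H`-comodule algebra by the restriction of `Δ`. -/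
noncomputable def comoduleAlgebra {A : Subalgebra k H} (hA : IsLeftCoidealSubalgebra A) :
    LeftComoduleAlgebra k H A where
  coact := hA.coaction
  coassoc a := by
    have hinj : Function.Injective
        ((A.val.toLinearMap.lTensor H).lTensor H) :=
      Module.Flat.lTensor_preserves_injective_linearMap _
        (Module.Flat.lTensor_preserves_injective_linearMap A.val.toLinearMap
          Subtype.val_injective)
    apply hinj
    have h1 : ∀ x : H ⊗[k] A, (A.val.toLinearMap.lTensor H).lTensor H
        (TensorProduct.assoc k H H A ((Coalgebra.comul (R := k) (A := H)).rTensor A x)) =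
        TensorProduct.assoc k H H H ((Coalgebra.comul (R := k) (A := H)).rTensor H
          (A.val.toLinearMap.lTensor H x)) := by
      intro x
      induction x with
      | zero => simp
      | add x y hx hy => simp only [map_add, hx, hy]
      | tmul h b =>
        simp only [LinearMap.rTensor_tmul, LinearMap.lTensor_tmul]
        induction (Coalgebra.comul (R := k) h) with
        | zero => simp
        | add x y hx hy => simp only [map_add, TensorProduct.add_tmul, hx, hy]
        | tmul p q => simp
    have h2 : ∀ x : H ⊗[k] A, (A.val.toLinearMap.lTensor H).lTensor H
        (hA.coaction.toLinearMap.lTensor H x) =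
        (Coalgebra.comul (R := k) (A := H)).lTensor H (A.val.toLinearMap.lTensor H x) := by
      intro x
      induction x with
      | zero => simp
      | add x y hx hy => simp only [map_add, hx, hy]
      | tmul h b =>
        simp only [LinearMap.lTensor_tmul, AlgHom.toLinearMap_apply]
        rw [incl_coaction]
        rfl
    rw [h1, h2, incl_coaction, Coalgebra.coassoc_apply]
  counit_coact a := by
    have h1 : ∀ x : H ⊗[k] A, ((TensorProduct.lid k A
        ((Coalgebra.counit (R := k) (A := H)).rTensor A x) : A) : H) =
        TensorProduct.lid k H ((Coalgebra.counit (R := k) (A := H)).rTensor H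
          (A.val.toLinearMap.lTensor H x)) := by
      intro x
      induction x with
      | zero => simp
      | add x y hx hy => simp only [map_add, AddMemClass.coe_add, hx, hy]
      | tmul h b => simp
    apply Subtype.ext
    rw [h1, incl_coaction, Coalgebra.rTensor_counit_comul]
    simp

end IsLeftCoidealSubalgebra

end ComoduleAlgebras

/-! ## Relative Hopf bimodules -/

section RelativeHopfBimodules

variable {k H A : Type u} [Field k] [Ring H] [HopfAlgebra k H] [Ring A] [Algebra k A]

/-- An `A`-bimodule in the category of finite-dimensional left `H`-comodules: a
finite-dimensional left `H`-comodule `M` with commuting unital associative left and right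
actions of `A`, such that both action maps `A ⊗ M → M` and `M ⊗ A → M` are `H`-colinear. -/
structure RelHopfBimod (𝔸 : LeftComoduleAlgebra k H A) where
  carrier : Type u
  [addCommGroup : AddCommGroup carrier]
  [module : Module k carrier]
  [finite : Module.Finite k carrier]
  coact : carrier →ₗ[k] H ⊗[k] carrier
  coassoc : ∀ m : carrier,
    TensorProduct.assoc k H H carrier
        ((Coalgebra.comul (R := k) (A := H)).rTensor carrier (coact m)) =
      coact.lTensor H (coact m)
  counit_coact : ∀ m : carrier,
    TensorProduct.lid k carrier
      ((Coalgebra.counit (R := k) (A := H)).rTensor carrier (coact m)) = m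
  actL : A →ₗ[k] carrier →ₗ[k] carrier
  actR : carrier →ₗ[k] A →ₗ[k] carrier
  one_actL : ∀ m : carrier, actL 1 m = m
  mul_actL : ∀ (a b : A) (m : carrier), actL (a * b) m = actL a (actL b m)
  actR_one : ∀ m : carrier, actR m 1 = m
  actR_mul : ∀ (m : carrier) (a b : A), actR m (a * b) = actR (actR m a) b
  actL_actR : ∀ (a : A) (m : carrier) (b : A), actR (actL a m) b = actL a (actR m b)
  /-- `δ(a m) = a₍₋₁₎ m₍₋₁₎ ⊗ a₍₀₎ m₍₀₎` -/
  coact_actL : ∀ (a : A) (m : carrier),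
    coact (actL a m) =
      TensorProduct.map₂ (LinearMap.mul k H) actL (𝔸.coact a) (coact m)
  /-- `δ(m a) = m₍₋₁₎ a₍₋₁₎ ⊗ m₍₀₎ a₍₀₎` -/
  coact_actR : ∀ (m : carrier) (a : A),
    coact (actR m a) =
      TensorProduct.map₂ (LinearMap.mul k H) actR (coact m) (𝔸.coact a)

namespace RelHopfBimod

attribute [instance] RelHopfBimod.addCommGroup RelHopfBimod.module RelHopfBimod.finite

variable {𝔸 : LeftComoduleAlgebra k H A}

/-- The space of linear maps that are left and right `A`-linear and `H`-colinear. -/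
def homs (M N : RelHopfBimod 𝔸) : Submodule k (M.carrier →ₗ[k] N.carrier) where
  carrier := {f | (∀ m, N.coact (f m) = f.lTensor H (M.coact m)) ∧
    (∀ a m, f (M.actL a m) = N.actL a (f m)) ∧
    (∀ m a, f (M.actR m a) = N.actR (f m) a)}
  zero_mem' := by simp
  add_mem' := by
    rintro f g ⟨hf1, hf2, hf3⟩ ⟨hg1, hg2, hg3⟩
    exact ⟨fun m => by simp [hf1, hg1, LinearMap.lTensor_add],
      fun a m => by simp [hf2, hg2], fun m a => by simp [hf3, hg3]⟩
  smul_mem' := by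
    rintro c f ⟨hf1, hf2, hf3⟩
    exact ⟨fun m => by simp [hf1, LinearMap.lTensor_smul],
      fun a m => by simp [hf2], fun m a => by simp [hf3]⟩

instance : Category.{u} (RelHopfBimod 𝔸) where
  Hom M N := homs M N
  id M := ⟨LinearMap.id, by simp, by simp, by simp⟩
  comp f g := ⟨g.1 ∘ₗ f.1, fun m => by
      rw [LinearMap.lTensor_comp]; simp [g.2.1, f.2.1],
    fun a m => by simp [g.2.2.1, f.2.2.1],
    fun m a => by simp [g.2.2.2, f.2.2.2]⟩

/-- The linear map underlying a morphism of relative Hopf bimodules. -/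
def toLin {M N : RelHopfBimod 𝔸} (f : M ⟶ N) : M.carrier →ₗ[k] N.carrier := f.1

instance : Preadditive (RelHopfBimod 𝔸) where
  homGroup M N := inferInstanceAs (AddCommGroup (homs M N))
  add_comp _ _ _ f f' g := Subtype.ext (LinearMap.comp_add f.1 f'.1 g.1)
  comp_add _ _ _ f g g' := Subtype.ext (LinearMap.add_comp f.1 g'.1 g.1)

instance : Linear k (RelHopfBimod 𝔸) where
  homModule M N := inferInstanceAs (Module k (homs M N))
  smul_comp _ _ _ r f g := Subtype.ext (LinearMap.comp_smul g.1 r f.1)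
  comp_smul _ _ _ f r g := Subtype.ext (LinearMap.smul_comp r g.1 f.1)

instance (M N : RelHopfBimod 𝔸) : Module.Finite k (M ⟶ N) :=
  inferInstanceAs (Module.Finite k (homs M N))

/-- The object `A`, which is the unit object for the monoidal product `⊗_A`. -/
def unit (𝔸 : LeftComoduleAlgebra k H A) [Module.Finite k A] : RelHopfBimod 𝔸 where
  carrier := A
  coact := 𝔸.coact.toLinearMap
  coassoc := 𝔸.coassoc
  counit_coact := 𝔸.counit_coact
  actL := LinearMap.mul k A
  actR := LinearMap.mul k A
  one_actL := by simp
  mul_actL := by simp [mul_assoc]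
  actR_one := by simp
  actR_mul := by simp [mul_assoc]
  actL_actR := by simp [mul_assoc]
  coact_actL a m := by
    simp only [LinearMap.mul_apply', AlgHom.toLinearMap_apply, map_mul]
    induction 𝔸.coact a with
    | zero => simp
    | add x y hx hy => simp only [add_mul, map_add, LinearMap.add_apply, hx, hy]
    | tmul p q =>
      induction 𝔸.coact m with
      | zero => simp
      | add x y hx hy => simp only [mul_add, map_add, hx, hy]
      | tmul r s => simp
  coact_actR m a := by
    simp only [LinearMap.mul_apply', AlgHom.toLinearMap_apply, map_mul]
    induction 𝔸.coact m with
    | zero => simp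
    | add x y hx hy => simp only [add_mul, map_add, LinearMap.add_apply, hx, hy]
    | tmul p q =>
      induction 𝔸.coact a with
      | zero => simp
      | add x y hx hy => simp only [mul_add, map_add, hx, hy]
      | tmul r s => simp

/-- The copower `V ⊗ M` of a relative Hopf bimodule `M` by a finite-dimensional vector space `V`;
the coaction and the actions are those of the second factor. -/
noncomputable def copower (V : Type u) [AddCommGroup V] [Module k V] [Module.Finite k V]
    (M : RelHopfBimod 𝔸) : RelHopfBimod 𝔸 where
  carrier := V ⊗[k] M.carrier
  coact := (TensorProduct.leftComm k V H M.carrier).toLinearMap ∘ₗ M.coact.lTensor V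
  coassoc x := by
    induction x with
    | zero => simp
    | add x y hx hy => simp only [map_add, hx, hy]
    | tmul v m =>
      have h1 : ∀ t : H ⊗[k] M.carrier,
          TensorProduct.assoc k H H (V ⊗[k] M.carrier)
            ((Coalgebra.comul (R := k) (A := H)).rTensor (V ⊗[k] M.carrier)
              (TensorProduct.leftComm k V H M.carrier (v ⊗ₜ[k] t))) =
          ((TensorProduct.mk k V M.carrier v).lTensor H).lTensor H
            (TensorProduct.assoc k H H M.carrier
              ((Coalgebra.comul (R := k) (A := H)).rTensor M.carrier t)) := by
        intro t
        induction t with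
        | zero => simp
        | add x y hx hy => simp only [map_add, TensorProduct.tmul_add, hx, hy]
        | tmul h n =>
          simp only [TensorProduct.leftComm_tmul, LinearMap.rTensor_tmul]
          induction Coalgebra.comul (R := k) h with
          | zero => simp
          | add x y hx hy => simp only [map_add, TensorProduct.add_tmul, hx, hy]
          | tmul p q => simp
      have h2 : ∀ t : H ⊗[k] M.carrier,
          ((TensorProduct.leftComm k V H M.carrier).toLinearMap ∘ₗ M.coact.lTensor V).lTensor H
              (TensorProduct.leftComm k V H M.carrier (v ⊗ₜ[k] t)) =
          ((TensorProduct.mk k V M.carrier v).lTensor H).lTensor H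
            (M.coact.lTensor H t) := by
        intro t
        induction t with
        | zero => simp
        | add x y hx hy => simp only [map_add, TensorProduct.tmul_add, hx, hy]
        | tmul h n =>
          simp only [TensorProduct.leftComm_tmul, LinearMap.lTensor_tmul, LinearMap.comp_apply,
            LinearEquiv.coe_coe]
          congr 1
          induction M.coact n with
          | zero => simp
          | add x y hx hy => simp only [map_add, TensorProduct.tmul_add, hx, hy]
          | tmul p q => simp
      simp only [LinearMap.comp_apply, LinearMap.lTensor_tmul, LinearEquiv.coe_coe]
      rw [h1, h2, M.coassoc]
  counit_coact x := by
    induction x with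
    | zero => simp
    | add x y hx hy => simp only [map_add, hx, hy]
    | tmul v m =>
      have h1 : ∀ t : H ⊗[k] M.carrier,
          TensorProduct.lid k (V ⊗[k] M.carrier)
            ((Coalgebra.counit (R := k) (A := H)).rTensor (V ⊗[k] M.carrier)
              (TensorProduct.leftComm k V H M.carrier (v ⊗ₜ[k] t))) =
          v ⊗ₜ[k] TensorProduct.lid k M.carrier
            ((Coalgebra.counit (R := k) (A := H)).rTensor M.carrier t) := by
        intro t
        induction t with
        | zero => simp
        | add x y hx hy => simp only [map_add, TensorProduct.tmul_add, hx, hy]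
        | tmul h n => simp
      simp only [LinearMap.comp_apply, LinearMap.lTensor_tmul, LinearEquiv.coe_coe]
      rw [h1, M.counit_coact]
  actL := LinearMap.lTensorHom V ∘ₗ M.actL
  actR := (LinearMap.lTensorHom V ∘ₗ M.actR.flip).flip
  one_actL x := by
    induction x with
    | zero => simp
    | add x y hx hy => simp only [map_add, hx, hy]
    | tmul v m => simp [M.one_actL]
  mul_actL a b x := by
    induction x with
    | zero => simp
    | add x y hx hy => simp only [map_add, hx, hy]
    | tmul v m => simp [M.mul_actL]
  actR_one x := by
    induction x with
    | zero => simp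
    | add x y hx hy => simp only [map_add, LinearMap.add_apply, hx, hy]
    | tmul v m => simp [M.actR_one]
  actR_mul x a b := by
    induction x with
    | zero => simp
    | add x y hx hy => simp only [map_add, LinearMap.add_apply, hx, hy]
    | tmul v m => simp [M.actR_mul]
  actL_actR a x b := by
    induction x with
    | zero => simp
    | add x y hx hy => simp only [map_add, LinearMap.add_apply, hx, hy]
    | tmul v m => simp [M.actL_actR]
  coact_actL a x := by
    induction x with
    | zero => simp
    | add x y hx hy => simp only [map_add, hx, hy]
    | tmul v m =>
      simp only [LinearMap.comp_apply, LinearMap.coe_lTensorHom, LinearMap.lTensor_tmul,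
        LinearEquiv.coe_coe, M.coact_actL]
      induction 𝔸.coact a with
      | zero => simp
      | add x y hx hy =>
        simp only [map_add, LinearMap.add_apply, TensorProduct.tmul_add, hx, hy]
      | tmul p q =>
        induction M.coact m with
        | zero => simp
        | add x y hx hy => simp only [map_add, TensorProduct.tmul_add, hx, hy]
        | tmul r s => simp
  coact_actR x a := by
    induction x with
    | zero => simp
    | add x y hx hy => simp only [map_add, LinearMap.add_apply, hx, hy]
    | tmul v m =>
      simp only [LinearMap.comp_apply, LinearMap.flip_apply, LinearMap.coe_lTensorHom,
        LinearMap.lTensor_tmul, LinearEquiv.coe_coe, M.coact_actR]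
      induction M.coact m with
      | zero => simp
      | add x y hx hy =>
        simp only [map_add, LinearMap.add_apply, TensorProduct.tmul_add, hx, hy]
      | tmul p q =>
        induction 𝔸.coact a with
        | zero => simp
        | add x y hx hy => simp only [map_add, TensorProduct.tmul_add, hx, hy]
        | tmul r s => simp

/-- The functoriality of the copower `V ⊗ M` in both variables. -/
noncomputable def copowerMap {V W : Type u} [AddCommGroup V] [Module k V] [Module.Finite k V]
    [AddCommGroup W] [Module k W] [Module.Finite k W] (p : V →ₗ[k] W)
    {M N : RelHopfBimod 𝔸} (f : M ⟶ N) : copower V M ⟶ copower W N :=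
  ⟨TensorProduct.map p (toLin f), by
    refine ⟨fun (x : V ⊗[k] M.carrier) => ?_, fun a (x : V ⊗[k] M.carrier) => ?_,
      fun (x : V ⊗[k] M.carrier) a => ?_⟩
    · change (TensorProduct.leftComm k W H N.carrier) (N.coact.lTensor W
          (TensorProduct.map p (toLin f) x)) = (TensorProduct.map p (toLin f)).lTensor H
            ((TensorProduct.leftComm k V H M.carrier) (M.coact.lTensor V x))
      induction x with
      | zero => simp
      | add x y hx hy => simp only [map_add, hx, hy]
      | tmul v m =>
        simp only [TensorProduct.map_tmul, LinearMap.lTensor_tmul]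
        rw [show N.coact (toLin f m) = (toLin f).lTensor H (M.coact m) from f.2.1 m]
        induction M.coact m with
        | zero => simp
        | add x y hx hy => simp only [map_add, TensorProduct.tmul_add, hx, hy]
        | tmul r s => simp
    · change TensorProduct.map p (toLin f) ((M.actL a).lTensor V x) =
        (N.actL a).lTensor W (TensorProduct.map p (toLin f) x)
      induction x with
      | zero => simp
      | add x y hx hy => simp only [map_add, hx, hy]
      | tmul v m =>
        simp only [TensorProduct.map_tmul, LinearMap.lTensor_tmul]
        rw [show toLin f (M.actL a m) = N.actL a (toLin f m) from f.2.2.1 a m]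
    · change TensorProduct.map p (toLin f) ((M.actR.flip a).lTensor V x) =
        (N.actR.flip a).lTensor W (TensorProduct.map p (toLin f) x)
      induction x with
      | zero => simp
      | add x y hx hy => simp only [map_add, hx, hy]
      | tmul v m =>
        simp only [TensorProduct.map_tmul, LinearMap.lTensor_tmul, LinearMap.flip_apply]
        rw [show toLin f (M.actR m a) = N.actR (toLin f m) a from f.2.2.2 m a]⟩

/-- The functor `(X, Y) ↦ Hom(M, X)^* ⊗ Y`, contravariant in `X` and covariant in `Y`. -/
noncomputable def nakayamaIntegrand (M : RelHopfBimod 𝔸) :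
    (RelHopfBimod 𝔸)ᵒᵖ ⥤ RelHopfBimod 𝔸 ⥤ RelHopfBimod 𝔸 where
  obj X :=
    { obj := fun Y => copower (Module.Dual k (M ⟶ X.unop)) Y
      map := fun f => copowerMap LinearMap.id f
      map_id := fun _ => Subtype.ext TensorProduct.map_id
      map_comp := fun f g => Subtype.ext
        (TensorProduct.map_comp LinearMap.id (toLin g) LinearMap.id (toLin f)) }
  map {X X'} p :=
    { app := fun Y => copowerMap (Linear.rightComp k M p.unop).dualMap (𝟙 Y)
      naturality := fun Y Y' f => Subtype.ext (by
        refine TensorProduct.ext' fun v m => ?_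
        rfl) }
  map_id X := by
    ext Y
    apply Subtype.ext
    refine TensorProduct.ext' fun v m => ?_
    change (Linear.rightComp k M (𝟙 X.unop)).dualMap v ⊗ₜ[k] m = v ⊗ₜ[k] m
    congr 1
  map_comp {X X' X''} p q := by
    ext Y
    apply Subtype.ext
    refine TensorProduct.ext' fun v m => ?_
    change (Linear.rightComp k M (q.unop ≫ p.unop)).dualMap v ⊗ₜ[k] m =
      (Linear.rightComp k M q.unop).dualMap ((Linear.rightComp k M p.unop).dualMap v) ⊗ₜ[k] m
    congr 1

/-- `N` is the value at `M` of the Nakayama functor of the category of relative Hopf bimodules: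
`N` is a coend `∫^X Hom(M, X)^* ⊗ X`. -/
def IsNakayama (M N : RelHopfBimod 𝔸) : Prop :=
  ∃ c : Limits.Cowedge (nakayamaIntegrand M), Nonempty (Limits.IsColimit c) ∧
    Nonempty (c.pt ≅ N)

/-- The category of relative Hopf bimodules is unimodular if its Nakayama functor sends the unit
object `A` to an object isomorphic to `A`. -/
def Unimodular (𝔸 : LeftComoduleAlgebra k H A) [Module.Finite k A] : Prop :=
  IsNakayama (unit 𝔸) (unit 𝔸)

end RelHopfBimod

end RelativeHopfBimodules

/-! ## Cointegrals, integrals and Nakayama automorphisms -/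

section Cointegrals

variable {k H : Type u} [Field k] [Ring H] [HopfAlgebra k H]

/-- `μ` is a right cointegral on `H`: `μ(h₍₁₎) h₍₂₎ = μ(h) 1`. -/
def IsRightCointegral (μ : H →ₗ[k] k) : Prop :=
  ∀ h : H, TensorProduct.lid k H (μ.rTensor H (Coalgebra.comul (R := k) h)) = μ h • (1 : H)

variable (k) in
/-- `Λ` is a left integral in `H`: `h Λ = ε(h) Λ`. -/
def IsLeftIntegral (Λ : H) : Prop :=
  ∀ h : H, h * Λ = Coalgebra.counit (R := k) h • Λ

/-- The distinguished grouplike element of `H` (with respect to a non-zero right cointegral `μ`):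
the unique grouplike element `g` such that `h₍₁₎ μ(h₍₂₎) = μ(h) g`. -/
noncomputable def distinguishedGrouplike (μ : H →ₗ[k] k) : GroupLike k H :=
  haveI : Nonempty (GroupLike k H) := ⟨1⟩
  Classical.epsilon fun g => ∀ h : H,
    TensorProduct.rid k H (μ.lTensor H (Coalgebra.comul (R := k) h)) = μ h • (g : H)

variable (k) in
/-- The left modular function of `H` (with respect to a non-zero left integral `Λ`):
the unique linear form `α` such that `Λ h = α(h) Λ`. -/
noncomputable def leftModularFunction (Λ : H) : H →ₗ[k] k :=
  Classical.epsilon fun α => ∀ h : H, Λ * h = α h • Λ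

section

variable {A : Type u} [Ring A] [Algebra k A]

/-- `l` is a `g`-cointegral on the left `H`-comodule algebra `A`:
`a₍₋₁₎ l(a₍₀₎) = l(a) g`. -/
def IsGrouplikeCointegral (𝔸 : LeftComoduleAlgebra k H A) (g : GroupLike k H)
    (l : A →ₗ[k] k) : Prop :=
  ∀ a : A, TensorProduct.rid k H (l.lTensor H (𝔸.coact a)) = l a • (g : H)

/-- The linear map `A → A^*` given by `a ↦ l(a · -)`. -/
def traceMap (l : A →ₗ[k] k) : A →ₗ[k] Module.Dual k A :=
  (LinearMap.mul k A).compr₂ l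

/-- `l` is a Frobenius trace on `A`: the map `A → A^*`, `a ↦ l(a · -)`, is bijective. -/
def IsFrobeniusTrace (l : A →ₗ[k] k) : Prop :=
  Function.Bijective (traceMap l)

/-- The Nakayama automorphism of `A` with respect to a Frobenius trace `l`: the linear map `ν`
such that `l(b a) = l(ν(a) b)`. -/
noncomputable def IsFrobeniusTrace.nakayama {l : A →ₗ[k] k} (hl : IsFrobeniusTrace l) :
    A →ₗ[k] A :=
  (LinearEquiv.ofBijective (traceMap l) hl).symm.toLinearMap ∘ₗ (traceMap l).flip

theorem IsFrobeniusTrace.apply_nakayama_mul {l : A →ₗ[k] k} (hl : IsFrobeniusTrace l)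
    (a b : A) : l (b * a) = l (hl.nakayama a * b) := by
  have h := (LinearEquiv.ofBijective (traceMap l) hl).apply_symm_apply ((traceMap l).flip a)
  exact (LinearMap.congr_fun h b).symm

end

end Cointegrals

/-! Write `μ` for the right cointegral of `H`, `t` for the left integral with `μ(t) = 1`, `α` for
its modular character, `g_H` for the distinguished grouplike, `g` for the grouplike of the
cointegral `l` on `A`, `ν` for the Nakayama automorphism of `l`, and `τ(a) = α(a₍₋₁₎) a₍₀₎`. The
proof computes the Nakayama functor at the unit object explicitly and then decides when the result
is isomorphic to `A`.

Frobenius property. If `l(x b) = 0` for all `b`, the cointegral identity `b₍₋₁₎ l(a b₍₀₎) = S(a₍₋₁₎)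
g l(a₍₀₎ b)` gives `x₍₋₁₎ l(x₍₀₎ v) = 0` for all `v`, and then `l(f(y)) x = 0` for every left
`A`-linear `f : H → A` (`smul_eq_zero_of_sliceRight`). So it suffices that sums of copies of `H` map
onto `A`. In fact `A^n ≅ H^d` for suitable `n, d`: a simple module maximizing `dim Hom_A(H, S) / dim
S` supplies a surjection `A^n → H^d`, and counting equivariant maps into `H ⊗ S` shows that it is
injective.

Nakayama functor. The object `P = H ⊗ (A ⊗ A)`, with its right action twisted by `α ∘ S`, is free on
`t ⊗ 1 ⊗ 1`: it represents the forgetful functor to vector spaces. Hence the coend at `M` is `Hom(M,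
P)^*`, with structure transported through the endomorphisms of `P` (`IsFree.isNakayama_iff`). For `M
= A`, a morphism `A → P` is a twisted Casimir element of `A ⊗ A`, and composing with `ε ⊗ l ⊗ l`
gives `Hom(A, P) ≅ A^*`. Therefore the value at `A` is the space `A` with regular left action, right
action through `σ = ν⁻¹ τ ν⁻¹`, and coaction `a₍₋₁₎ x ⊗ a₍₀₎` where `x = g⁻² g_H`
(`isNakayama_unit_iff`).

Comparison with `A`. A left linear isomorphism to `A` is right multiplication by the image of `1`,
and colinearity forces that image to be a nonzero multiple of `x`. So unimodularity means `x ∈ A`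
and `σ(b) x = x b`. The second condition says `ν ∘ Ad(x) ∘ ν = τ`; applying `ε` yields `ε ∘ ν² = α`.
Conversely, `S²(ν(a)₍₋₁₎) ⊗ ν(a)₍₀₎ = g a₍₋₁₎ g⁻¹ ⊗ ν(a₍₀₎)` shows that `ν ∘ Ad(x) ∘ ν` is
determined by its composite with `ε`, and Radford's formula for `S⁴` identifies it with `τ`. -/

/-! ## Slice maps and antipode identities -/

section Slices

variable {k H : Type u} [Field k] [Ring H] [HopfAlgebra k H]

/-- The map `h ⊗ m ↦ φ(m) h`. -/
noncomputable def sliceRight {M : Type u} [AddCommGroup M] [Module k M] (φ : M →ₗ[k] k) :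
    H ⊗[k] M →ₗ[k] H :=
  (TensorProduct.rid k H).toLinearMap ∘ₗ φ.lTensor H

/-- The map `h ⊗ m ↦ φ(h) m`. -/
noncomputable def sliceLeft (M : Type u) [AddCommGroup M] [Module k M] (φ : H →ₗ[k] k) :
    H ⊗[k] M →ₗ[k] M :=
  (TensorProduct.lid k M).toLinearMap ∘ₗ φ.rTensor M

section

variable {M N : Type u} [AddCommGroup M] [Module k M] [AddCommGroup N] [Module k N]

@[simp]
theorem sliceRight_tmul (φ : M →ₗ[k] k) (h : H) (m : M) :
    sliceRight φ (h ⊗ₜ[k] m) = φ m • h := by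
  simp [sliceRight]

@[simp]
theorem sliceLeft_tmul (φ : H →ₗ[k] k) (h : H) (m : M) :
    sliceLeft M φ (h ⊗ₜ[k] m) = φ h • m := by
  simp [sliceLeft]

theorem sliceLeft_map (φ : H →ₗ[k] k) (p : H →ₗ[k] H) (f : M →ₗ[k] N) (z : H ⊗[k] M) :
    sliceLeft N φ (TensorProduct.map p f z) = f (sliceLeft M (φ ∘ₗ p) z) := by
  induction z with
  | zero => simp
  | add x y hx hy => simp only [map_add, hx, hy]
  | tmul h m => simp

theorem sliceRight_map (φ : N →ₗ[k] k) (p : H →ₗ[k] H) (f : M →ₗ[k] N) (z : H ⊗[k] M) :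
    sliceRight φ (TensorProduct.map p f z) = p (sliceRight (φ ∘ₗ f) z) := by
  induction z with
  | zero => simp
  | add x y hx hy => simp only [map_add, hx, hy]
  | tmul h m => simp

theorem apply_sliceRight (φ : M →ₗ[k] k) (ω : H →ₗ[k] k) (z : H ⊗[k] M) :
    ω (sliceRight φ z) = φ (sliceLeft M ω z) := by
  induction z with
  | zero => simp
  | add x y hx hy => simp only [map_add, hx, hy]
  | tmul h m => simp [mul_comm]

/-- The slices by the coordinate forms of a basis of `H` are the coordinates of the tensor. This
lets colinearity be tested one form on `H` at a time, that is, as linearity for the convolution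
algebra `H^*`. -/
theorem tensor_ext_sliceLeft {z w : H ⊗[k] M}
    (h : ∀ φ : H →ₗ[k] k, sliceLeft M φ z = sliceLeft M φ w) : z = w := by
  classical
  let b := Module.Basis.ofVectorSpace k H
  apply (TensorProduct.equivFinsuppOfBasisLeft b).injective
  ext i
  have key : ∀ z : H ⊗[k] M,
      TensorProduct.equivFinsuppOfBasisLeft b z i = sliceLeft M (b.coord i) z := by
    intro z
    induction z with
    | zero => simp
    | add x y hx hy => simp only [map_add, Finsupp.add_apply, hx, hy]
    | tmul h m => simp
  rw [key, key, h]

theorem tensor_ext_sliceRight {z w : H ⊗[k] M}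
    (h : ∀ φ : M →ₗ[k] k, sliceRight φ z = sliceRight φ w) : z = w := by
  refine tensor_ext_sliceLeft fun ω => ?_
  rw [← sub_eq_zero, ← Module.forall_dual_apply_eq_zero_iff k]
  intro φ
  rw [map_sub, ← apply_sliceRight, ← apply_sliceRight, h, sub_self]

theorem exists_sum_tmul (z : H ⊗[k] M) :
    ∃ (s : Finset (H × M)), z = ∑ i ∈ s, i.1 ⊗ₜ[k] i.2 :=
  TensorProduct.exists_finset z

end

/-- The `M`-valued pairing on `H ⊗ A` and `H ⊗ M` given by an action is associative. -/
theorem map₂_mul_map₂ {A M : Type u} [Ring A] [Algebra k A] [AddCommGroup M] [Module k M]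
    (act : A →ₗ[k] M →ₗ[k] M) (hact : ∀ a b m, act (a * b) m = act a (act b m))
    (z w : H ⊗[k] A) (y : H ⊗[k] M) :
    TensorProduct.map₂ (LinearMap.mul k H) act (z * w) y =
      TensorProduct.map₂ (LinearMap.mul k H) act z
        (TensorProduct.map₂ (LinearMap.mul k H) act w y) := by
  induction z with
  | zero => simp
  | add x y hx hy => simp only [map_add, add_mul, LinearMap.add_apply, hx, hy]
  | tmul h a =>
    induction w with
    | zero => simp
    | add x y hx hy => simp only [map_add, mul_add, LinearMap.add_apply, hx, hy]
    | tmul h' a' =>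
      induction y with
      | zero => simp
      | add x y hx hy => simp only [map_add, hx, hy]
      | tmul p m => simp [hact, mul_assoc]

end Slices

namespace LeftComoduleAlgebra

variable {k H A : Type u} [Field k] [Ring H] [HopfAlgebra k H] [Ring A] [Algebra k A]

variable (k H) in
/-- `H` as a left comodule algebra over itself. -/
noncomputable def regular : LeftComoduleAlgebra k H H where
  coact := Bialgebra.comulAlgHom k H
  coassoc a := Coalgebra.coassoc_apply a
  counit_coact a := by
    change TensorProduct.lid k H ((Coalgebra.counit (R := k) (A := H)).rTensor H
      (Coalgebra.comul (R := k) a)) = a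
    rw [Coalgebra.rTensor_counit_comul]
    simp

@[simp]
theorem regular_coact (h : H) : (regular k H).coact h = Coalgebra.comul (R := k) h := rfl

variable (𝔸 : LeftComoduleAlgebra k H A)

theorem sliceLeft_counit_coact (a : A) :
    sliceLeft A (Coalgebra.counit (R := k)) (𝔸.coact a) = a :=
  𝔸.counit_coact a

theorem sum_counit_smul {ι : Type u} {a : A} {s : Finset ι} {h : ι → H} {c : ι → A}
    (hr : 𝔸.coact a = ∑ i ∈ s, h i ⊗ₜ[k] c i) :
    ∑ i ∈ s, Coalgebra.counit (R := k) (h i) • c i = a := by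
  conv_rhs => rw [← 𝔸.sliceLeft_counit_coact a, hr]
  simp

/-- A linear map applied to the iterated coaction. -/
theorem sum_coact_eq {V : Type u} [AddCommGroup V] [Module k V]
    (L : H ⊗[k] (H ⊗[k] A) →ₗ[k] V) {ι : Type u} {a : A} {s : Finset ι} {h : ι → H} {c : ι → A}
    (hr : 𝔸.coact a = ∑ i ∈ s, h i ⊗ₜ[k] c i) :
    ∑ i ∈ s, L (h i ⊗ₜ[k] 𝔸.coact (c i)) =
      ∑ i ∈ s, L (TensorProduct.assoc k H H A (Coalgebra.comul (R := k) (h i) ⊗ₜ[k] c i)) := by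
  have h1 := congrArg L (𝔸.coassoc a)
  rw [hr] at h1
  simpa using h1.symm

/-- Coassociativity puts `S` next to the adjacent leg, so `S(a₍₋₂₎) a₍₋₁₎` collapses to a counit.
This is the device for stripping the coaction off an element. -/
theorem sum_antipode_mul_coact {ι : Type u} {a : A} {s : Finset ι} {h : ι → H} {c : ι → A}
    (hr : 𝔸.coact a = ∑ i ∈ s, h i ⊗ₜ[k] c i) :
    ∑ i ∈ s, (HopfAlgebra.antipode k (h i) ⊗ₜ[k] (1 : A)) * 𝔸.coact (c i) = 1 ⊗ₜ[k] a := by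
  have h1 := 𝔸.sum_coact_eq (LinearMap.mul' k (H ⊗[k] A) ∘ₗ TensorProduct.map
    ((TensorProduct.mk k H A).flip 1 ∘ₗ HopfAlgebra.antipode k) LinearMap.id) hr
  have h2 : ∀ (z : H ⊗[k] H) (x : A), (LinearMap.mul' k (H ⊗[k] A) ∘ₗ TensorProduct.map
      ((TensorProduct.mk k H A).flip 1 ∘ₗ HopfAlgebra.antipode k) LinearMap.id)
      (TensorProduct.assoc k H H A (z ⊗ₜ[k] x)) =
      LinearMap.mul' k H ((HopfAlgebra.antipode k).rTensor H z) ⊗ₜ[k] x := by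
    intro z x
    induction z with
    | zero => simp
    | add x y hx hy => simp only [map_add, TensorProduct.add_tmul, hx, hy]
    | tmul p q => simp
  simp only [h2, HopfAlgebra.mul_antipode_rTensor_comul_apply] at h1
  simp only [LinearMap.comp_apply, TensorProduct.map_tmul, LinearMap.flip_apply,
    TensorProduct.mk_apply, LinearMap.id_apply, LinearMap.mul'_apply] at h1
  rw [h1, ← 𝔸.sum_counit_smul hr, TensorProduct.tmul_sum]
  simp [Algebra.algebraMap_eq_smul_one, TensorProduct.smul_tmul]

theorem sum_mul_antipode_coact {ι : Type u} {a : A} {s : Finset ι} {h : ι → H} {c : ι → A}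
    (hr : 𝔸.coact a = ∑ i ∈ s, h i ⊗ₜ[k] c i) :
    ∑ i ∈ s, (h i ⊗ₜ[k] (1 : A)) * (HopfAlgebra.antipode k).rTensor A (𝔸.coact (c i)) =
      1 ⊗ₜ[k] a := by
  have h1 := 𝔸.sum_coact_eq (LinearMap.mul' k (H ⊗[k] A) ∘ₗ TensorProduct.map
    ((TensorProduct.mk k H A).flip 1) ((HopfAlgebra.antipode k).rTensor A)) hr
  have h2 : ∀ (z : H ⊗[k] H) (x : A), (LinearMap.mul' k (H ⊗[k] A) ∘ₗ TensorProduct.map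
      ((TensorProduct.mk k H A).flip 1) ((HopfAlgebra.antipode k).rTensor A))
      (TensorProduct.assoc k H H A (z ⊗ₜ[k] x)) =
      LinearMap.mul' k H ((HopfAlgebra.antipode k).lTensor H z) ⊗ₜ[k] x := by
    intro z x
    induction z with
    | zero => simp
    | add x y hx hy => simp only [map_add, TensorProduct.add_tmul, hx, hy]
    | tmul p q => simp
  simp only [h2, HopfAlgebra.mul_antipode_lTensor_comul_apply] at h1
  simp only [LinearMap.comp_apply, TensorProduct.map_tmul, LinearMap.flip_apply,
    TensorProduct.mk_apply, LinearMap.mul'_apply] at h1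
  rw [h1, ← 𝔸.sum_counit_smul hr, TensorProduct.tmul_sum]
  simp [Algebra.algebraMap_eq_smul_one, TensorProduct.smul_tmul]

theorem rTensor_antipode_mul_tmul_one (z : H ⊗[k] A) (h : H) :
    (HopfAlgebra.antipode k).rTensor A ((h ⊗ₜ[k] 1) * z) =
      (HopfAlgebra.antipode k).rTensor A z * (HopfAlgebra.antipode k h ⊗ₜ[k] 1) := by
  induction z with
  | zero => simp
  | add x y hx hy => simp only [map_add, mul_add, add_mul, hx, hy]
  | tmul p q => simp [HopfAlgebra.antipode_mul_antidistrib]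

/-- The antipode of the first leg of `sum_mul_antipode_coact`, reversed by antimultiplicativity. The
square of `S` appears here because it enters the Nakayama automorphism of a cointegral on `H`. -/
theorem sum_antipode_antipode_coact_mul {ι : Type u} {a : A} {s : Finset ι} {h : ι → H}
    {c : ι → A} (hr : 𝔸.coact a = ∑ i ∈ s, h i ⊗ₜ[k] c i) :
    ∑ i ∈ s, (HopfAlgebra.antipode k).rTensor A ((HopfAlgebra.antipode k).rTensor A
      (𝔸.coact (c i))) * (HopfAlgebra.antipode k (h i) ⊗ₜ[k] (1 : A)) = 1 ⊗ₜ[k] a := by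
  have h1 := congrArg ((HopfAlgebra.antipode k).rTensor A) (𝔸.sum_mul_antipode_coact hr)
  simpa [rTensor_antipode_mul_tmul_one] using h1

end LeftComoduleAlgebra

/-! ## Frobenius traces -/

section FrobeniusTraces

variable {k A : Type u} [Field k] [Ring A] [Algebra k A]

@[simp]
theorem traceMap_apply (l : A →ₗ[k] k) (a b : A) : traceMap l a b = l (a * b) := rfl

theorem isFrobeniusTrace_of_forall_eq_zero [Module.Finite k A] {l : A →ₗ[k] k}
    (h : ∀ a, (∀ b, l (a * b) = 0) → a = 0) : IsFrobeniusTrace l := by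
  have hinj : Function.Injective (traceMap l) := by
    rw [injective_iff_map_eq_zero]
    exact fun a ha => h a fun b => LinearMap.congr_fun ha b
  exact ⟨hinj, (LinearMap.injective_iff_surjective_of_finrank_eq_finrank
    (Subspace.dual_finrank_eq (K := k) (V := A)).symm).1 hinj⟩

namespace IsFrobeniusTrace

variable {l : A →ₗ[k] k}

theorem eq_of_mul_right (hl : IsFrobeniusTrace l) {a b : A} (h : ∀ c, l (a * c) = l (b * c)) :
    a = b :=
  hl.1 (LinearMap.ext h)

/-- The forms `l(c · -)` exhaust the dual space, so they separate points. -/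
theorem eq_of_mul_left (hl : IsFrobeniusTrace l) {a b : A} (h : ∀ c, l (c * a) = l (c * b)) :
    a = b := by
  rw [← sub_eq_zero, ← Module.forall_dual_apply_eq_zero_iff k]
  intro φ
  obtain ⟨c, rfl⟩ := hl.2 φ
  simp [mul_sub, h]

theorem bijective_flip [Module.Finite k A] (hl : IsFrobeniusTrace l) :
    Function.Bijective (traceMap l).flip := by
  have hinj : Function.Injective (traceMap l).flip := fun a b h =>
    hl.eq_of_mul_left fun c => LinearMap.congr_fun h c
  exact ⟨hinj, (LinearMap.injective_iff_surjective_of_finrank_eq_finrank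
    (Subspace.dual_finrank_eq (K := k) (V := A)).symm).1 hinj⟩

theorem nakayama_mul (hl : IsFrobeniusTrace l) (a b : A) :
    hl.nakayama (a * b) = hl.nakayama a * hl.nakayama b :=
  hl.eq_of_mul_right fun c => by
    rw [← hl.apply_nakayama_mul, ← mul_assoc, hl.apply_nakayama_mul, ← mul_assoc,
      hl.apply_nakayama_mul, mul_assoc]

theorem nakayama_one (hl : IsFrobeniusTrace l) : hl.nakayama 1 = 1 :=
  hl.eq_of_mul_right fun c => by rw [← hl.apply_nakayama_mul]; simp

theorem nakayama_injective (hl : IsFrobeniusTrace l) : Function.Injective hl.nakayama :=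
  fun a b h => hl.eq_of_mul_left fun c => by
    rw [hl.apply_nakayama_mul a, hl.apply_nakayama_mul b, h]

/-- The Nakayama automorphism as an isomorphism of algebras. -/
noncomputable def nakayamaEquiv [Module.Finite k A] (hl : IsFrobeniusTrace l) : A ≃ₐ[k] A :=
  AlgEquiv.ofBijective (AlgHom.ofLinearMap hl.nakayama hl.nakayama_one hl.nakayama_mul)
    ⟨hl.nakayama_injective, LinearMap.injective_iff_surjective.1 hl.nakayama_injective⟩

@[simp]
theorem nakayamaEquiv_apply [Module.Finite k A] (hl : IsFrobeniusTrace l) (a : A) :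
    hl.nakayamaEquiv a = hl.nakayama a := rfl

end IsFrobeniusTrace

end FrobeniusTraces

/-! ## Bases and slices -/

section Slices

variable {k H : Type u} [Field k] [Ring H] [HopfAlgebra k H]
variable {M : Type u} [AddCommGroup M] [Module k M]

theorem sum_sliceRight_tmul {ι : Type u} [Fintype ι] (b : Module.Basis ι k M) (z : H ⊗[k] M) :
    ∑ i, sliceRight (b.coord i) z ⊗ₜ[k] b i = z := by
  induction z with
  | zero => simp
  | add x y hx hy => simp only [map_add, TensorProduct.add_tmul, Finset.sum_add_distrib, hx, hy]
  | tmul h m =>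
    simp only [sliceRight_tmul, TensorProduct.smul_tmul, ← TensorProduct.tmul_sum]
    simp [b.sum_repr]

theorem sum_tmul_sliceLeft {ι : Type u} [Fintype ι] (b : Module.Basis ι k H) (z : H ⊗[k] M) :
    ∑ i, b i ⊗ₜ[k] sliceLeft M (b.coord i) z = z := by
  induction z with
  | zero => simp
  | add x y hx hy => simp only [map_add, TensorProduct.tmul_add, Finset.sum_add_distrib, hx, hy]
  | tmul h m =>
    simp only [sliceLeft_tmul, ← TensorProduct.smul_tmul, ← TensorProduct.sum_tmul]
    simp [b.sum_repr]

end Slices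

/-! ## Twisting by characters -/

namespace LeftComoduleAlgebra

variable {k H A : Type u} [Field k] [Ring H] [HopfAlgebra k H] [Ring A] [Algebra k A]
variable (𝔸 : LeftComoduleAlgebra k H A)

/-- The algebra endomorphism `a ↦ χ(a₍₋₁₎) a₍₀₎`. -/
noncomputable def twist (χ : H →ₐ[k] k) : A →ₐ[k] A :=
  ((Algebra.TensorProduct.lid k A).toAlgHom.comp
    (Algebra.TensorProduct.map χ (AlgHom.id k A))).comp 𝔸.coact

theorem twist_apply (χ : H →ₐ[k] k) (a : A) :
    𝔸.twist χ a = sliceLeft A χ.toLinearMap (𝔸.coact a) := rfl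

/-- Coassociativity carries the twist to the outer side of the `H`-leg, giving `χ(a₍₋₃₎) a₍₋₂₎ ⊗
a₍₋₁₎`-type sums with `χ` on the left. The next lemma is the mirror case, with `χ` on the inner
side; Radford's formula exchanges the two. -/
theorem coact_twist (χ : H →ₐ[k] k) (a : A) :
    𝔸.coact (𝔸.twist χ a) =
      ((regular k H).twist χ).toLinearMap.rTensor A (𝔸.coact a) := by
  obtain ⟨s, hs⟩ := exists_sum_tmul (𝔸.coact a)
  have h1 := 𝔸.sum_coact_eq (sliceLeft (H ⊗[k] A) χ.toLinearMap) hs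
  rw [twist_apply, hs]
  simp only [map_sum, sliceLeft_tmul, map_smul, LinearMap.rTensor_tmul] at h1 ⊢
  rw [h1]
  refine Finset.sum_congr rfl fun i _ => ?_
  rw [AlgHom.toLinearMap_apply, twist_apply, regular_coact]
  induction Coalgebra.comul (R := k) i.1 with
  | zero => simp
  | add x y hx hy => simp only [map_add, TensorProduct.add_tmul, hx, hy]
  | tmul p q => simp [TensorProduct.smul_tmul']

theorem lTensor_twist_coact (χ : H →ₐ[k] k) (a : A) :
    (𝔸.twist χ).toLinearMap.lTensor H (𝔸.coact a) =
      (sliceRight χ.toLinearMap ∘ₗ Coalgebra.comul).rTensor A (𝔸.coact a) := by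
  obtain ⟨s, hs⟩ := exists_sum_tmul (𝔸.coact a)
  have h1 := 𝔸.sum_coact_eq ((sliceLeft A χ.toLinearMap).lTensor H) hs
  rw [hs]
  simp only [map_sum, LinearMap.lTensor_tmul, LinearMap.rTensor_tmul, AlgHom.toLinearMap_apply,
    twist_apply] at h1 ⊢
  rw [h1]
  refine Finset.sum_congr rfl fun i _ => ?_
  rw [LinearMap.comp_apply]
  induction Coalgebra.comul (R := k) i.1 with
  | zero => simp
  | add x y hx hy => simp only [map_add, TensorProduct.add_tmul, hx, hy]
  | tmul p q => simp [TensorProduct.smul_tmul]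

theorem twist_twist_eq_self {χ χ' : H →ₐ[k] k}
    (h : ∀ x : H, χ ((regular k H).twist χ' x) = Coalgebra.counit (R := k) x) (a : A) :
    𝔸.twist χ (𝔸.twist χ' a) = a := by
  rw [twist_apply, coact_twist, LinearMap.rTensor, sliceLeft_map]
  conv_rhs => rw [← 𝔸.sliceLeft_counit_coact a]
  rw [LinearMap.id_apply]
  congr 2
  exact LinearMap.ext h

/-- The character `χ ∘ S`. -/
noncomputable def _root_.AlgHom.compAntipode (χ : H →ₐ[k] k) : H →ₐ[k] k :=
  AlgHom.ofLinearMap (χ.toLinearMap ∘ₗ HopfAlgebra.antipode k)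
    (by simp [HopfAlgebra.antipode_one])
    (fun x y => by simp [HopfAlgebra.antipode_mul_antidistrib, mul_comm])

@[simp]
theorem _root_.AlgHom.compAntipode_apply (χ : H →ₐ[k] k) (h : H) :
    χ.compAntipode h = χ (HopfAlgebra.antipode k h) := rfl

theorem twist_twist_compAntipode (χ : H →ₐ[k] k) (a : A) :
    𝔸.twist χ (𝔸.twist χ.compAntipode a) = a := by
  refine 𝔸.twist_twist_eq_self (fun x => ?_) a
  have h1 := congrArg χ (HopfAlgebra.mul_antipode_rTensor_comul_apply (R := k) x)
  rw [twist_apply, regular_coact]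
  simp only [AlgHom.commutes, Algebra.algebraMap_self, RingHom.id_apply] at h1
  rw [← h1]
  induction Coalgebra.comul (R := k) x with
  | zero => simp
  | add x y hx hy => simp only [map_add, hx, hy]
  | tmul p q => simp

theorem twist_compAntipode_twist (χ : H →ₐ[k] k) (a : A) :
    𝔸.twist χ.compAntipode (𝔸.twist χ a) = a := by
  refine 𝔸.twist_twist_eq_self (fun x => ?_) a
  have h1 := congrArg χ (HopfAlgebra.mul_antipode_lTensor_comul_apply (R := k) x)
  rw [twist_apply, regular_coact]
  simp only [AlgHom.commutes, Algebra.algebraMap_self, RingHom.id_apply] at h1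
  rw [← h1]
  induction Coalgebra.comul (R := k) x with
  | zero => simp
  | add x y hx hy => simp only [map_add, hx, hy]
  | tmul p q => simp

end LeftComoduleAlgebra

/-! ## Integrals and cointegrals of a finite-dimensional Hopf algebra -/

section Integrals

open HopfAlgebra LeftComoduleAlgebra

variable {k H : Type u} [Field k] [Ring H] [HopfAlgebra k H]

theorem sliceLeft_comp_mulRight {M : Type u} [Ring M] [Algebra k M] (φ : H →ₗ[k] k) (a : H)
    (z : H ⊗[k] M) :
    sliceLeft M (φ ∘ₗ (LinearMap.mul k H).flip a) z = sliceLeft M φ (z * (a ⊗ₜ[k] 1)) := by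
  induction z with
  | zero => simp
  | add x y hx hy => simp only [map_add, add_mul, hx, hy]
  | tmul p q => simp

theorem sliceLeft_mul_one_tmul {M : Type u} [Ring M] [Algebra k M] (φ : H →ₗ[k] k) (z : H ⊗[k] M)
    (y : M) : sliceLeft M φ (z * (1 ⊗ₜ[k] y)) = sliceLeft M φ z * y := by
  induction z with
  | zero => simp
  | add x y hx hy => simp only [map_add, add_mul, hx, hy]
  | tmul p q => simp

/-- This is `b₍₁₎ ⊗ b₍₂₎ S(b₍₃₎) = b ⊗ 1`. It allows a factor on one leg of `Δ(a)` to be absorbed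
into `Δ(a b₍₁₎)`, to which a cointegral applies. -/
theorem sum_comul_mul_antipode {b : H} {s : Finset (H × H)}
    (hs : Coalgebra.comul (R := k) b = ∑ i ∈ s, i.1 ⊗ₜ[k] i.2) :
    ∑ i ∈ s, Coalgebra.comul (R := k) i.1 * (1 ⊗ₜ[k] antipode k i.2) = b ⊗ₜ[k] 1 := by
  have h1 := (regular k H).sum_coact_eq
    ((LinearMap.mul' k H ∘ₗ (antipode k).lTensor H).lTensor H) hs
  have h2 : ∀ (z : H ⊗[k] H) (x : H),
      (LinearMap.mul' k H ∘ₗ (antipode k).lTensor H).lTensor H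
        (TensorProduct.assoc k H H H (z ⊗ₜ[k] x)) = z * (1 ⊗ₜ[k] antipode k x) := by
    intro z x
    induction z with
    | zero => simp
    | add x y hx hy => simp only [map_add, add_mul, TensorProduct.add_tmul, hx, hy]
    | tmul p q => simp
  simp only [h2, regular_coact, LinearMap.lTensor_tmul, LinearMap.comp_apply,
    mul_antipode_lTensor_comul_apply] at h1
  rw [← h1]
  have h3 := congrArg (TensorProduct.rid k H) (Coalgebra.lTensor_counit_comul (R := k) b)
  rw [hs] at h3
  simp only [map_sum, LinearMap.lTensor_tmul, TensorProduct.rid_tmul, one_smul] at h3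
  conv_rhs => rw [← h3, TensorProduct.sum_tmul]
  simp [Algebra.algebraMap_eq_smul_one, TensorProduct.smul_tmul]

/-! ### Nonzero right cointegrals are Frobenius traces -/

namespace IsRightCointegral

variable {μ : H →ₗ[k] k}

theorem sliceLeft_comul (hμ : IsRightCointegral μ) (h : H) :
    sliceLeft H μ (Coalgebra.comul (R := k) h) = μ h • (1 : H) := hμ h

/-- `μ(a₍₁₎ b) a₍₂₎ = μ(a b₍₁₎) S(b₍₂₎)` -/
theorem sliceLeft_flip_traceMap (hμ : IsRightCointegral μ) (a b : H) :
    sliceLeft H ((traceMap μ).flip b) (Coalgebra.comul (R := k) a) =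
      antipode k (sliceLeft H (traceMap μ a) (Coalgebra.comul (R := k) b)) := by
  obtain ⟨s, hs⟩ := exists_sum_tmul (Coalgebra.comul (R := k) b)
  change sliceLeft H (μ ∘ₗ (LinearMap.mul k H).flip b) _ = _
  -- Expand `b ⊗ 1` as `Δ(b₍₁₎)(1 ⊗ S(b₍₂₎))`; the cointegral property then evaluates `μ` on the
  -- first leg of `Δ(a b₍₁₎)`.
  rw [sliceLeft_comp_mulRight, ← sum_comul_mul_antipode hs, Finset.mul_sum, map_sum, hs]
  simp only [map_sum, ← mul_assoc, ← Bialgebra.comul_mul, sliceLeft_mul_one_tmul,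
    hμ.sliceLeft_comul]
  simp

/-- If `μ(a b) = 0` for all `b`, then `μ(a₍₁₎ b) a₍₂₎ = 0` by `sliceLeft_flip_traceMap`, so every
`φ(a₍₂₎) a₍₁₎` lies in the same kernel. Inserting this in `ε(a) μ(b) = μ(a₍₁₎ S(a₍₂₎) b)` shows that
the kernel is contained in `ker ε`. Applied to `φ(a₍₂₎) a₍₁₎` this gives `φ(a) = 0` for every `φ`.
-/
theorem isFrobeniusTrace [Module.Finite k H] (hμ : IsRightCointegral μ) (hμ0 : μ ≠ 0) :
    IsFrobeniusTrace μ := by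
  have hε : ∀ a : H, (∀ b, μ (a * b) = 0) → Coalgebra.counit (R := k) a = 0 ∧
      ∀ φ : H →ₗ[k] k, ∀ b, μ (sliceRight φ (Coalgebra.comul (R := k) a) * b) = 0 := by
    intro a ha
    have ha' : traceMap μ a = 0 := LinearMap.ext ha
    have h2 : ∀ φ : H →ₗ[k] k, ∀ b, μ (sliceRight φ (Coalgebra.comul (R := k) a) * b) = 0 := by
      intro φ b
      have h1 := congrArg φ (hμ.sliceLeft_flip_traceMap a b)
      rw [ha', ← apply_sliceRight] at h1
      simpa [sliceLeft] using h1
    refine ⟨?_, h2⟩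
    obtain ⟨b, hb⟩ : ∃ b, μ b ≠ 0 := by
      by_contra! h
      exact hμ0 (LinearMap.ext h)
    have h3 := mul_antipode_lTensor_comul_apply (R := k) a
    let e := Module.Free.chooseBasis k H
    rw [← sum_sliceRight_tmul (e.reindex (Fintype.equivFin _ |>.trans Equiv.ulift.{u}.symm))
      (Coalgebra.comul (R := k) a)] at h3
    have h4 := congrArg (fun x => μ (x * b)) h3
    simp only [map_sum, LinearMap.lTensor_tmul, LinearMap.mul'_apply, Finset.sum_mul, mul_assoc,
      h2, Finset.sum_const_zero, Algebra.algebraMap_eq_smul_one, smul_mul_assoc, one_mul,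
      map_smul, smul_eq_mul] at h4
    exact (mul_eq_zero.1 h4.symm).resolve_right hb
  refine isFrobeniusTrace_of_forall_eq_zero fun a ha => ?_
  rw [← Module.forall_dual_apply_eq_zero_iff k]
  intro φ
  have h1 := (hε _ ((hε a ha).2 φ)).1
  rw [apply_sliceRight] at h1
  rwa [← regular_coact, (regular k H).sliceLeft_counit_coact a] at h1

end IsRightCointegral

/-- A right cointegral `μ` together with an element `t` such that `μ(a t) = ε(a)`. -/
structure IsDualIntegral (μ : H →ₗ[k] k) (t : H) : Prop where
  isRightCointegral : IsRightCointegral μ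
  apply_mul : ∀ a : H, μ (a * t) = Coalgebra.counit (R := k) a

theorem IsRightCointegral.exists_isDualIntegral [Module.Finite k H] {μ : H →ₗ[k] k}
    (hμ : IsRightCointegral μ) (hμ0 : μ ≠ 0) : ∃ t, IsDualIntegral μ t := by
  obtain ⟨t, ht⟩ := (hμ.isFrobeniusTrace hμ0).bijective_flip.2 (Coalgebra.counit (R := k))
  exact ⟨t, hμ, fun a => LinearMap.congr_fun ht a⟩

/-! ### The integral, the antipode, the modular character and the distinguished grouplike -/

namespace IsDualIntegral

variable {μ : H →ₗ[k] k} {t : H} (h : IsDualIntegral μ t)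
include h

theorem apply_self : μ t = 1 := by
  have := h.apply_mul 1
  simpa using this

theorem flip_traceMap : (traceMap μ).flip t = Coalgebra.counit (R := k) :=
  LinearMap.ext h.apply_mul

/-- The case `b = t` of `sliceLeft_flip_traceMap`, where `μ(- t) = ε`. It exhibits an explicit
preimage under the antipode. -/
theorem antipode_sliceLeft_comul (a : H) :
    antipode k (sliceLeft H (traceMap μ a) (Coalgebra.comul (R := k) t)) = a := by
  rw [← h.isRightCointegral.sliceLeft_flip_traceMap, h.flip_traceMap]
  exact (regular k H).sliceLeft_counit_coact a

variable [Module.Finite k H]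

theorem isFrobeniusTrace : IsFrobeniusTrace μ :=
  h.isRightCointegral.isFrobeniusTrace fun h0 => by simpa [h0] using h.apply_self

theorem isLeftIntegral : IsLeftIntegral k t := fun a =>
  h.isFrobeniusTrace.eq_of_mul_left fun c => by
    rw [← mul_assoc, h.apply_mul, mul_smul_comm, map_smul, h.apply_mul]
    simp [mul_comm]

theorem eq_smul {Λ : H} (hΛ : IsLeftIntegral k Λ) : Λ = μ Λ • t :=
  h.isFrobeniusTrace.eq_of_mul_left fun c => by
    rw [hΛ c, mul_smul_comm, map_smul, map_smul, h.apply_mul]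
    simp [mul_comm]

theorem antipode_bijective : Function.Bijective (antipode k (A := H)) := by
  have hs : Function.Surjective (antipode k (A := H)) := fun a =>
    ⟨_, h.antipode_sliceLeft_comul a⟩
  exact ⟨LinearMap.injective_iff_surjective.2 hs, hs⟩

theorem sliceLeft_antipode_comul (a : H) :
    sliceLeft H (traceMap μ (antipode k a)) (Coalgebra.comul (R := k) t) = a :=
  h.antipode_bijective.1 (h.antipode_sliceLeft_comul _)

/-- Paired with `μ(c · -)`, the claim is `antipode_sliceLeft_comul` for `c` followed by the form
`μ(- a)`. -/
theorem sliceRight_antipode_comul (a : H) :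
    sliceRight ((traceMap μ).flip a ∘ₗ antipode k) (Coalgebra.comul (R := k) t) = a :=
  h.isFrobeniusTrace.eq_of_mul_left fun c => by
    have h1 := congrArg ((traceMap μ).flip a) (h.antipode_sliceLeft_comul c)
    change ((traceMap μ).flip a ∘ₗ antipode k) _ = _ at h1
    rw [← apply_sliceRight] at h1
    exact h1

/-- The character `α` with `t a = α(a) t`. -/
noncomputable def modular : H →ₐ[k] k :=
  -- `t a` is again a left integral, hence a multiple of `t`; since `μ(t) = 1`, the scalar is `μ(t
  -- a)`.
  have key : ∀ a, t * a = μ (t * a) • t := fun a => h.eq_smul fun b => by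
    rw [← mul_assoc, h.isLeftIntegral b, smul_mul_assoc]
  AlgHom.ofLinearMap (traceMap μ t) (by simpa using h.apply_self) fun x y => by
    rw [traceMap_apply, ← mul_assoc, key x, smul_mul_assoc, map_smul]
    rfl

theorem modular_apply (a : H) : h.modular a = μ (t * a) := rfl

theorem mul_eq_smul (a : H) : t * a = h.modular a • t :=
  h.eq_smul fun b => by rw [← mul_assoc, h.isLeftIntegral b, smul_mul_assoc]

/-- `Λ` is a multiple of `t`, so it transforms by the same character. Since `Λ ≠ 0`, at most one
form satisfies the defining property, so the choice made by `Classical.epsilon` is forced. -/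
theorem leftModularFunction_eq {Λ : H} (hΛ : IsLeftIntegral k Λ) (hΛ0 : Λ ≠ 0) :
    leftModularFunction k Λ = h.modular.toLinearMap := by
  have h1 : ∀ a, Λ * a = h.modular.toLinearMap a • Λ := by
    intro a
    rw [h.eq_smul hΛ, smul_mul_assoc, h.mul_eq_smul, smul_comm]
    rfl
  have h2 : ∀ a, Λ * a = leftModularFunction k Λ a • Λ :=
    Classical.epsilon_spec (p := fun α : H →ₗ[k] k => ∀ a : H, Λ * a = α a • Λ) ⟨_, h1⟩
  ext a
  exact smul_left_injective k hΛ0 ((h2 a).symm.trans (h1 a))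

/-- The difference `δ - δ(t) μ` is a right cointegral that vanishes on `H t`, because `δ(c t) = ε(c)
δ(t)`. If it were nonzero it would be a Frobenius trace, which would force `t = 0`. -/
theorem eq_smul_cointegral {δ : H →ₗ[k] k} (hδ : IsRightCointegral δ) : δ = δ t • μ := by
  by_contra hne
  have hc : IsRightCointegral (δ - δ t • μ) := by
    intro a
    have h1 := hδ a
    have h2 := h.isRightCointegral a
    simp only [LinearMap.rTensor_sub, LinearMap.rTensor_smul, LinearMap.sub_apply, map_sub,
      LinearMap.smul_apply, map_smul, h1, h2, sub_smul, smul_assoc]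
  have hF := hc.isFrobeniusTrace (sub_ne_zero.2 hne)
  have h0 : t = 0 := hF.eq_of_mul_left fun c => by
    rw [h.isLeftIntegral c, mul_zero, map_zero, map_smul]
    simp [h.apply_self]
  simpa [h0] using h.apply_self

/-- The grouplike element `g` with `a₍₁₎ μ(a₍₂₎) = μ(a) g`. -/
noncomputable def grouplikeVal (_ : IsDualIntegral μ t) : H := sliceRight μ (Coalgebra.comul (R := k) t)

/-- For each form `φ`, `a ↦ φ(a₍₁₎) μ(a₍₂₎)` is a right cointegral. By uniqueness it is a multiple
of `μ`, and its value at `t` is the scalar. -/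
theorem sliceRight_comul (a : H) :
    sliceRight μ (Coalgebra.comul (R := k) a) = μ a • h.grouplikeVal := by
  rw [← sub_eq_zero, ← Module.forall_dual_apply_eq_zero_iff k]
  intro φ
  have hδ : IsRightCointegral (φ ∘ₗ sliceRight μ ∘ₗ Coalgebra.comul) := by
    intro b
    change sliceLeft H _ _ = _
    obtain ⟨s, hs⟩ := exists_sum_tmul (Coalgebra.comul (R := k) b)
    have h1 := (regular k H).sum_coact_eq
      (sliceLeft H φ ∘ₗ (sliceLeft H μ).lTensor H) hs
    have h2 : ∀ (z : H ⊗[k] H) (x : H), (sliceLeft H φ ∘ₗ (sliceLeft H μ).lTensor H)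
        (TensorProduct.assoc k H H H (z ⊗ₜ[k] x)) = φ (sliceRight μ z) • x := by
      intro z x
      induction z with
      | zero => simp
      | add x y hx hy => simp only [map_add, add_smul, TensorProduct.add_tmul, hx, hy]
      | tmul p q => simp [smul_smul]
    simp only [h2, regular_coact, LinearMap.comp_apply, LinearMap.lTensor_tmul,
      h.isRightCointegral.sliceLeft_comul, sliceLeft_tmul] at h1
    rw [LinearMap.comp_apply, LinearMap.comp_apply, hs]
    simp only [map_sum, sliceLeft_tmul, LinearMap.comp_apply, ← h1, sliceRight_tmul,
      Finset.sum_smul, map_smul, smul_smul, smul_eq_mul, mul_comm]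
  have h3 := LinearMap.congr_fun (h.eq_smul_cointegral hδ) a
  simp only [LinearMap.comp_apply, LinearMap.smul_apply, smul_eq_mul] at h3
  rw [map_sub, h3, map_smul, grouplikeVal, smul_eq_mul, mul_comm, sub_self]

/-- With `g = t₍₁₎ μ(t₍₂₎)`, coassociativity gives `Δ(g) = t₍₁₎ ⊗ t₍₂₎ μ(t₍₃₎) = t₍₁₎ μ(t₍₂₎) ⊗ g`;
moreover `ε(g) = μ(t) = 1`. -/
theorem isGroupLikeElem_grouplikeVal : IsGroupLikeElem k h.grouplikeVal where
  counit_eq_one := by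
    rw [grouplikeVal, apply_sliceRight]
    exact (congrArg μ ((regular k H).sliceLeft_counit_coact t)).trans h.apply_self
  comul_eq_tmul_self := by
    obtain ⟨s, hs⟩ := exists_sum_tmul (Coalgebra.comul (R := k) t)
    have h1 := (regular k H).sum_coact_eq ((sliceRight μ).lTensor H) hs
    have h2 : ∀ (z : H ⊗[k] H) (x : H), (sliceRight μ).lTensor H
        (TensorProduct.assoc k H H H (z ⊗ₜ[k] x)) = μ x • z := by
      intro z x
      induction z with
      | zero => simp
      | add x y hx hy => simp only [map_add, smul_add, TensorProduct.add_tmul, hx, hy]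
      | tmul p q => simp
    simp only [h2, regular_coact, LinearMap.lTensor_tmul, h.sliceRight_comul] at h1
    have h3 : h.grouplikeVal = ∑ i ∈ s, μ i.2 • i.1 := by
      rw [grouplikeVal, hs]
      simp
    conv_lhs => rw [h3]
    simp only [map_sum, map_smul, ← h1, TensorProduct.tmul_smul, TensorProduct.smul_tmul']
    rw [← TensorProduct.sum_tmul, ← h3]

/-- The grouplike element `g` with `a₍₁₎ μ(a₍₂₎) = μ(a) g`. -/
noncomputable def grouplike : GroupLike k H := ⟨h.grouplikeVal, h.isGroupLikeElem_grouplikeVal⟩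

theorem isGrouplikeCointegral : IsGrouplikeCointegral (regular k H) h.grouplike μ :=
  h.sliceRight_comul

theorem distinguishedGrouplike_eq : distinguishedGrouplike μ = h.grouplike := by
  have h1 : ∀ a : H, TensorProduct.rid k H (μ.lTensor H (Coalgebra.comul (R := k) a)) =
      μ a • (distinguishedGrouplike μ : H) :=
    haveI : Nonempty (GroupLike k H) := ⟨1⟩
    Classical.epsilon_spec (p := fun g : GroupLike k H => ∀ a : H,
      TensorProduct.rid k H (μ.lTensor H (Coalgebra.comul (R := k) a)) = μ a • (g : H))
      ⟨_, h.isGrouplikeCointegral⟩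
  apply GroupLike.val_injective
  have h2 := (h1 t).symm.trans (h.isGrouplikeCointegral t)
  simpa [h.apply_self] using h2

/-- Write `b = t₍₁₎ μ(S(t₍₂₎) b)`. Then `μ(b a)` contains `μ(t₍₁₎ a) t₍₂₎`, which equals `S(μ(t
a₍₁₎) a₍₂₎) = S(α(a₍₁₎) a₍₂₎)`. This identifies the Nakayama automorphism of `μ`. -/
theorem apply_mul_comm (a b : H) :
    μ (b * a) =
      μ (antipode k (antipode k ((regular k H).twist h.modular a)) * b) := by
  have h1 : antipode k ((regular k H).twist h.modular a) =
      sliceLeft H ((traceMap μ).flip a) (Coalgebra.comul (R := k) t) :=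
    (h.isRightCointegral.sliceLeft_flip_traceMap t a).symm
  have h2 := congrArg (fun x => μ (x * a)) (h.sliceRight_antipode_comul b)
  change ((traceMap μ).flip a) _ = _ at h2
  rw [apply_sliceRight] at h2
  rw [h1, ← h2]
  rfl

theorem nakayama_eq (a : H) : h.isFrobeniusTrace.nakayama a =
    antipode k (antipode k ((regular k H).twist h.modular a)) :=
  h.isFrobeniusTrace.eq_of_mul_right fun c => by
    rw [← h.isFrobeniusTrace.apply_nakayama_mul, h.apply_mul_comm]

theorem counit_nakayama (a : H) :
    Coalgebra.counit (R := k) (h.isFrobeniusTrace.nakayama a) = h.modular a := by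
  rw [← h.apply_mul, ← h.isFrobeniusTrace.apply_nakayama_mul, h.modular_apply]

theorem apply_mul_twist (x c : H) :
    μ (x * (regular k H).twist h.modular.compAntipode c) =
      μ (antipode k (antipode k c) * x) := by
  rw [h.apply_mul_comm, twist_twist_compAntipode]

end IsDualIntegral

end Integrals

/-! ## Grouplike cointegrals on comodule algebras -/

section GrouplikeCointegrals

open HopfAlgebra LeftComoduleAlgebra

variable {k H : Type u} [Field k] [Ring H] [HopfAlgebra k H]

theorem sliceRight_tmul_one_mul {M : Type u} [Ring M] [Algebra k M] (φ : M →ₗ[k] k) (y : H)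
    (z : H ⊗[k] M) : sliceRight φ ((y ⊗ₜ[k] 1) * z) = y * sliceRight φ z := by
  induction z with
  | zero => simp
  | add x y hx hy => simp only [map_add, mul_add, hx, hy]
  | tmul p q => simp

theorem sliceRight_comp_mulLeft {M : Type u} [Ring M] [Algebra k M] (φ : M →ₗ[k] k) (a : M)
    (z : H ⊗[k] M) :
    sliceRight (φ ∘ₗ LinearMap.mul k M a) z = sliceRight φ ((1 ⊗ₜ[k] a) * z) := by
  induction z with
  | zero => simp
  | add x y hx hy => simp only [map_add, mul_add, hx, hy]
  | tmul p q => simp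

/-! ### Conjugation by grouplike elements -/

namespace GroupLike

/-- Conjugation by a grouplike element. -/
noncomputable def conj (g : GroupLike k H) : H →ₗ[k] H :=
  LinearMap.mulLeft k (g : H) ∘ₗ LinearMap.mulRight k ((g⁻¹ : GroupLike k H) : H)

@[simp]
theorem conj_apply (g : GroupLike k H) (h : H) :
    conj g h = g * h * ((g⁻¹ : GroupLike k H) : H) := by
  simp only [conj, LinearMap.comp_apply, LinearMap.mulRight_apply, LinearMap.mulLeft_apply,
    mul_assoc]

theorem val_mul_val_inv (g : GroupLike k H) : (g : H) * ((g⁻¹ : GroupLike k H) : H) = 1 := by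
  rw [← val_mul, mul_inv_cancel, val_one]

theorem val_inv_mul_val (g : GroupLike k H) : ((g⁻¹ : GroupLike k H) : H) * (g : H) = 1 := by
  rw [← val_mul, inv_mul_cancel, val_one]

theorem conj_mul (g g' : GroupLike k H) : conj (g * g') = conj g ∘ₗ conj g' := by
  ext h
  rw [LinearMap.comp_apply, conj_apply, conj_apply, conj_apply, mul_inv_rev, val_mul, val_mul]
  simp only [mul_assoc]

theorem conj_one : conj (1 : GroupLike k H) = LinearMap.id := by
  ext h
  simp

theorem antipode_antipode_conj (g : GroupLike k H) (h : H) :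
    antipode k (antipode k (conj g h)) = conj g (antipode k (antipode k h)) := by
  have h1 : ∀ y : GroupLike k H, antipode k (antipode k (y : H)) = y := fun y => by
    rw [← val_inv, ← val_inv, inv_inv]
  rw [conj_apply, conj_apply, antipode_mul_antidistrib, antipode_mul_antidistrib,
    antipode_mul_antidistrib, antipode_mul_antidistrib, h1, h1, mul_assoc]

end GroupLike

/-- The square of the antipode as a linear map. -/
noncomputable def antipodeSq (k H : Type u) [Field k] [Ring H] [HopfAlgebra k H] :
    H →ₗ[k] H :=
  antipode k ∘ₗ antipode k

@[simp]
theorem antipodeSq_apply (h : H) : antipodeSq k H h = antipode k (antipode k h) := rfl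

theorem antipodeSq_comp_conj (g : GroupLike k H) :
    antipodeSq k H ∘ₗ g.conj = g.conj ∘ₗ antipodeSq k H :=
  LinearMap.ext fun h => g.antipode_antipode_conj h

namespace IsGrouplikeCointegral

variable {A : Type u} [Ring A] [Algebra k A] {𝔸 : LeftComoduleAlgebra k H A} {g : GroupLike k H}
  {l : A →ₗ[k] k} (hl : IsGrouplikeCointegral 𝔸 g l)
include hl

theorem sliceRight_coact (a : A) : sliceRight l (𝔸.coact a) = l a • (g : H) := hl a

/-- `b₍₋₁₎ l(a b₍₀₎) = S(a₍₋₁₎) g l(a₍₀₎ b)` -/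
theorem sliceRight_traceMap (a b : A) :
    sliceRight (traceMap l a) (𝔸.coact b) =
      antipode k (sliceRight ((traceMap l).flip b) (𝔸.coact a)) * g := by
  obtain ⟨s, hs⟩ := exists_sum_tmul (𝔸.coact a)
  change sliceRight (l ∘ₗ LinearMap.mul k A a) _ = _
  -- Replace `1 ⊗ a` by `S(a₍₋₂₎) a₍₋₁₎ ⊗ a₍₀₎`, so that the cointegral property applies to the
  -- product `a₍₀₎ b`.
  rw [sliceRight_comp_mulLeft, ← 𝔸.sum_antipode_mul_coact hs, Finset.sum_mul, map_sum, hs]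
  simp only [map_sum, mul_assoc, ← map_mul 𝔸.coact, sliceRight_tmul_one_mul, hl.sliceRight_coact,
    Finset.sum_mul]
  simp

/-- `S²(ν(a)₍₋₁₎) ⊗ ν(a)₍₀₎ = g a₍₋₁₎ g⁻¹ ⊗ ν(a₍₀₎)` -/
theorem coact_nakayama (hF : IsFrobeniusTrace l) [Module.Finite k A] (a : A) :
    (antipodeSq k H).rTensor A (𝔸.coact (hF.nakayama a)) =
      TensorProduct.map g.conj hF.nakayama (𝔸.coact a) := by
  -- Every form on `A` is `l(- b)`. For such a form both sides come from `sliceRight_traceMap`, used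
  -- for the pair `(b, a)` and for the pair `(ν(a), b)`; the two uses account for `S²` and for the
  -- conjugation by `g`.
  refine tensor_ext_sliceRight fun φ => ?_
  obtain ⟨b, rfl⟩ := hF.bijective_flip.2 φ
  have h1 : (traceMap l).flip b ∘ₗ hF.nakayama = traceMap l b := LinearMap.ext fun c =>
    (hF.apply_nakayama_mul c b).symm
  have h2 : traceMap l (hF.nakayama a) = (traceMap l).flip a := LinearMap.ext fun c =>
    (hF.apply_nakayama_mul a c).symm
  rw [LinearMap.rTensor, sliceRight_map, sliceRight_map, LinearMap.comp_id, h1,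
    hl.sliceRight_traceMap b a]
  have h3 := hl.sliceRight_traceMap (hF.nakayama a) b
  rw [h2] at h3
  have h4 := congrArg (fun x => antipode k (x * ((g⁻¹ : GroupLike k H) : H))) h3
  simp only [mul_assoc, g.val_mul_val_inv, mul_one] at h4
  rw [antipodeSq_apply, ← h4, antipode_mul_antidistrib, GroupLike.conj_apply, mul_assoc,
    mul_assoc, g.val_mul_val_inv, mul_one, ← GroupLike.val_inv, inv_inv]

end IsGrouplikeCointegral

/-! ### Radford's formula and the automorphism `ν⁻¹ τ ν⁻¹` -/

namespace IsDualIntegral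

variable [Module.Finite k H] {μ : H →ₗ[k] k} {t : H} (h : IsDualIntegral μ t)
include h

/-- Radford's formula `S⁴(α(a₍₁₎) a₍₂₎) = g a₍₁₎ α(a₍₂₎) g⁻¹`. -/
theorem antipode_pow_four_twist :
    antipodeSq k H ∘ₗ antipodeSq k H ∘ₗ ((regular k H).twist h.modular).toLinearMap =
      h.grouplike.conj ∘ₗ sliceRight h.modular.toLinearMap ∘ₗ Coalgebra.comul := by
  ext a
  -- Take `A = H` and `l = μ` in `coact_nakayama` and apply `ε` to the second leg. The Nakayama
  -- automorphism of `μ` contributes another `S²`, and its composite with `ε` is `α`.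
  have h1 := congrArg (sliceRight (Coalgebra.counit (R := k)))
    (h.isGrouplikeCointegral.coact_nakayama h.isFrobeniusTrace a)
  have h2 : ∀ x : H, sliceRight (Coalgebra.counit (R := k)) ((regular k H).coact x) = x := by
    intro x
    have := Coalgebra.lTensor_counit_comul (R := k) x
    simp [sliceRight, this]
  have h3 : Coalgebra.counit (R := k) ∘ₗ h.isFrobeniusTrace.nakayama = h.modular.toLinearMap :=
    LinearMap.ext h.counit_nakayama
  rw [LinearMap.rTensor, sliceRight_map, sliceRight_map, LinearMap.comp_id, h2, h.nakayama_eq,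
    h3] at h1
  exact h1

theorem modular_ne_zero (y : GroupLike k H) : h.modular (y : H) ≠ 0 := by
  intro h0
  have := congrArg h.modular y.val_mul_val_inv
  rw [map_mul, h0, zero_mul, map_one] at this
  exact zero_ne_one this

/-- Radford's formula at a grouplike `y`: `S⁴` fixes `y`, and both twists multiply it by the same
nonzero scalar `α(y)`, so `y = g_H y g_H⁻¹`. -/
theorem grouplike_mul_comm (y : GroupLike k H) : h.grouplike * y = y * h.grouplike := by
  have h1 := LinearMap.congr_fun h.antipode_pow_four_twist (y : H)
  have h2 : (regular k H).twist h.modular (y : H) = h.modular (y : H) • (y : H) := by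
    rw [twist_apply, regular_coact, y.2.comul_eq_tmul_self]
    simp
  have h3 : sliceRight h.modular.toLinearMap (Coalgebra.comul (R := k) (y : H)) =
      h.modular (y : H) • (y : H) := by
    rw [y.2.comul_eq_tmul_self]
    simp
  have h4 : antipode k (antipode k (y : H)) = y := by
    rw [← GroupLike.val_inv, ← GroupLike.val_inv, inv_inv]
  simp only [LinearMap.comp_apply, AlgHom.toLinearMap_apply, antipodeSq_apply, h2, h3, map_smul,
    h4] at h1
  have h5 := smul_right_injective H (h.modular_ne_zero y) h1
  rw [GroupLike.conj_apply] at h5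
  apply GroupLike.val_injective
  rw [GroupLike.val_mul, GroupLike.val_mul]
  conv_rhs => rw [h5]
  rw [mul_assoc, h.grouplike.val_inv_mul_val, mul_one]

variable {A : Type u} [Ring A] [Algebra k A] [Module.Finite k A] {𝔸 : LeftComoduleAlgebra k H A}
  {g : GroupLike k H} {l : A →ₗ[k] k} (hl : IsGrouplikeCointegral 𝔸 g l)
  (hF : IsFrobeniusTrace l)

/-- The automorphism `ν⁻¹ τ ν⁻¹`, where `ν` is the Nakayama automorphism and
`τ(a) = α(a₍₋₁₎) a₍₀₎`. -/
noncomputable def twistedNakayama (𝔸 : LeftComoduleAlgebra k H A) : A →ₐ[k] A :=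
  (hF.nakayamaEquiv.symm.toAlgHom.comp (𝔸.twist h.modular)).comp hF.nakayamaEquiv.symm.toAlgHom

theorem twistedNakayama_nakayama (a : A) :
    h.twistedNakayama hF 𝔸 (hF.nakayama a) = hF.nakayamaEquiv.symm (𝔸.twist h.modular a) := by
  change hF.nakayamaEquiv.symm (𝔸.twist _ (hF.nakayamaEquiv.symm (hF.nakayamaEquiv a))) = _
  rw [AlgEquiv.symm_apply_apply]

theorem nakayama_twistedNakayama_nakayama (a : A) :
    hF.nakayama (h.twistedNakayama hF 𝔸 (hF.nakayama a)) = 𝔸.twist h.modular a := by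
  rw [twistedNakayama_nakayama, ← hF.nakayamaEquiv_apply, AlgEquiv.apply_symm_apply]

-- Each of the two factors `ν⁻¹` contributes a conjugation by `g⁻¹` and a power `S²`. The resulting
-- `S⁴` is what Radford's formula needs to turn the outer twist of `τ` into the inner one, at the
-- price of conjugation by `g_H`. The identity is checked after applying the injective map `S²` to
-- the `H`-leg.
include hl in
theorem coact_twistedNakayama (b : A) :
    𝔸.coact (h.twistedNakayama hF 𝔸 b) =
      TensorProduct.map (((g ^ 2)⁻¹ * h.grouplike).conj) (h.twistedNakayama hF 𝔸).toLinearMap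
        (𝔸.coact b) := by
  obtain ⟨c, rfl⟩ : ∃ c, hF.nakayama c = b := hF.nakayamaEquiv.surjective b
  have hinj : Function.Injective ((antipodeSq k H).rTensor A) :=
    Module.Flat.rTensor_preserves_injective_linearMap _
      (h.antipode_bijective.1.comp h.antipode_bijective.1)
  apply hinj
  have hcg : (g⁻¹).conj ∘ₗ g.conj = LinearMap.id := by
    rw [← GroupLike.conj_mul, inv_mul_cancel, GroupLike.conj_one]
  have hνν : hF.nakayamaEquiv.symm.toLinearMap ∘ₗ hF.nakayama = LinearMap.id :=
    LinearMap.ext fun x => hF.nakayamaEquiv.symm_apply_apply x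
  -- both sides are equal to `g⁻¹ gH c₍₋₁₎ gH⁻¹ g ⊗ ν⁻¹(τ(c₍₀₎))`
  have e1 : 𝔸.coact (h.twistedNakayama hF 𝔸 (hF.nakayama c)) =
      TensorProduct.map (g⁻¹).conj hF.nakayamaEquiv.symm.toLinearMap
        ((antipodeSq k H).rTensor A (𝔸.coact (𝔸.twist h.modular c))) := by
    rw [← h.nakayama_twistedNakayama_nakayama hF, hl.coact_nakayama hF, ← LinearMap.comp_apply,
      ← TensorProduct.map_comp, hcg, hνν, TensorProduct.map_id, LinearMap.id_apply]
  have e2 : (antipodeSq k H).rTensor A (𝔸.coact (h.twistedNakayama hF 𝔸 (hF.nakayama c))) =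
      TensorProduct.map ((g⁻¹).conj ∘ₗ h.grouplike.conj)
        (hF.nakayamaEquiv.symm.toLinearMap ∘ₗ (𝔸.twist h.modular).toLinearMap) (𝔸.coact c) := by
    rw [e1, coact_twist]
    have h1 := congrArg (TensorProduct.map ((g⁻¹).conj ∘ₗ h.grouplike.conj)
      hF.nakayamaEquiv.symm.toLinearMap) (𝔸.lTensor_twist_coact h.modular c)
    simp only [LinearMap.rTensor, LinearMap.lTensor, ← LinearMap.comp_apply,
      ← TensorProduct.map_comp, LinearMap.comp_id, LinearMap.id_comp] at h1 ⊢
    rw [h1, LinearMap.comp_assoc (sliceRight _ ∘ₗ _), ← h.antipode_pow_four_twist]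
    simp only [← LinearMap.comp_assoc]
    rw [← antipodeSq_comp_conj]
  have e3 : (antipodeSq k H).rTensor A (TensorProduct.map (((g ^ 2)⁻¹ * h.grouplike).conj)
      (h.twistedNakayama hF 𝔸).toLinearMap (𝔸.coact (hF.nakayama c))) =
      TensorProduct.map (((g ^ 2)⁻¹ * h.grouplike).conj) (h.twistedNakayama hF 𝔸).toLinearMap
        ((antipodeSq k H).rTensor A (𝔸.coact (hF.nakayama c))) := by
    simp only [LinearMap.rTensor, ← LinearMap.comp_apply, ← TensorProduct.map_comp,
      antipodeSq_comp_conj, LinearMap.comp_id, LinearMap.id_comp]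
  have e4 : (h.twistedNakayama hF 𝔸).toLinearMap ∘ₗ hF.nakayama =
      hF.nakayamaEquiv.symm.toLinearMap ∘ₗ (𝔸.twist h.modular).toLinearMap :=
    LinearMap.ext fun x => h.twistedNakayama_nakayama hF x
  have e5 : ((g ^ 2)⁻¹ * h.grouplike) * g = g⁻¹ * h.grouplike := by
    rw [mul_assoc, h.grouplike_mul_comm, ← mul_assoc, pow_two, mul_inv_rev, mul_assoc g⁻¹ g⁻¹ g,
      inv_mul_cancel, mul_one]
  rw [e2, e3, hl.coact_nakayama hF, ← LinearMap.comp_apply, ← TensorProduct.map_comp, e4,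
    ← GroupLike.conj_mul, ← GroupLike.conj_mul, e5]

end IsDualIntegral

end GrouplikeCointegrals

/-! ## Surjections from free modules over a finite-dimensional algebra -/

section FreeCovers

open Module

variable {k A : Type u} [Field k] [Ring A] [Algebra k A]

theorem finite_linearMap_of_isScalarTower (M N : Type u) [AddCommGroup M] [Module k M] [Module A M]
    [IsScalarTower k A M] [Module.Finite k M] [AddCommGroup N] [Module k N] [Module A N]
    [IsScalarTower k A N] [Module.Finite k N] : Module.Finite k (M →ₗ[A] N) :=
  Module.Finite.of_injective (LinearMap.restrictScalarsₗ k A M N k)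
    (LinearMap.restrictScalars_injective k)

theorem finite_submodule_of_isScalarTower {M : Type u} [AddCommGroup M] [Module k M] [Module A M]
    [IsScalarTower k A M] [Module.Finite k M] (p : Submodule A M) : Module.Finite k p :=
  Module.Finite.of_injective (p.subtype.restrictScalars k) Subtype.val_injective

theorem mkQ_restrictScalars_surjective {M : Type u} [AddCommGroup M] [Module k M] [Module A M]
    [IsScalarTower k A M] (p : Submodule A M) :
    Function.Surjective (p.mkQ.restrictScalars k) :=
  Submodule.mkQ_surjective p

theorem finite_quotient_of_isScalarTower {M : Type u} [AddCommGroup M] [Module k M] [Module A M]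
    [IsScalarTower k A M] [Module.Finite k M] (p : Submodule A M) : Module.Finite k (M ⧸ p) :=
  Module.Finite.of_surjective (p.mkQ.restrictScalars k) (mkQ_restrictScalars_surjective p)

theorem IsSemisimpleModule.nonempty_equiv_ker_prod {M N : Type u} [AddCommGroup M] [Module A M]
    [AddCommGroup N] [Module A N] [IsSemisimpleModule A M] (p : M →ₗ[A] N)
    (hp : Function.Surjective p) : Nonempty (M ≃ₗ[A] LinearMap.ker p × N) := by
  obtain ⟨C, hC⟩ := exists_isCompl (LinearMap.ker p)
  exact ⟨(Submodule.prodEquivOfIsCompl _ _ hC).symm.trans (LinearEquiv.prodCongr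
    (LinearEquiv.refl _ _) ((Submodule.quotientEquivOfIsCompl _ _ hC).symm.trans
      (p.quotKerEquivOfSurjective hp)))⟩

theorem finrank_linearMap_prod (M N T : Type u) [AddCommGroup M] [Module k M]
    [Module A M] [IsScalarTower k A M] [Module.Finite k M] [AddCommGroup N] [Module k N]
    [Module A N] [IsScalarTower k A N] [Module.Finite k N] [AddCommGroup T] [Module k T]
    [Module A T] [IsScalarTower k A T] [Module.Finite k T] :
    finrank k (M × N →ₗ[A] T) = finrank k (M →ₗ[A] T) + finrank k (N →ₗ[A] T) := by
  have := finite_linearMap_of_isScalarTower (k := k) (A := A) M T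
  have := finite_linearMap_of_isScalarTower (k := k) (A := A) N T
  rw [← (LinearMap.coprodEquiv (R := A) (M := M) (M₂ := N) (M₃ := T) k).finrank_eq, finrank_prod]

theorem finrank_linearMap_congr {M N : Type u} (T : Type u) [AddCommGroup M] [Module A M]
    [AddCommGroup N] [Module A N] [AddCommGroup T] [Module k T]
    [Module A T] [IsScalarTower k A T] (e : M ≃ₗ[A] N) :
    finrank k (M →ₗ[A] T) = finrank k (N →ₗ[A] T) :=
  (LinearEquiv.congrLeft T k e).finrank_eq

/-- A comparison of multiplicities, by induction on a bound for `dim N`. Split a simple summand `m`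
off `N`; since `Hom(N, m) ≠ 0`, the hypothesis gives a surjection `M → m`, which also splits.
Removing `m` from both sides lowers both dimensions of `Hom` into `T` by `dim Hom(m, T)`, so the
inequality persists. -/
theorem exists_surjective_of_finrank_linearMap_le (n : ℕ) : ∀ (M N : Type u)
    [AddCommGroup M] [Module k M] [Module A M] [IsScalarTower k A M] [Module.Finite k M]
    [IsSemisimpleModule A M] [AddCommGroup N] [Module k N] [Module A N] [IsScalarTower k A N]
    [Module.Finite k N] [IsSemisimpleModule A N], finrank k N ≤ n →
    (∀ (T : Type u) [AddCommGroup T] [Module k T] [Module A T] [IsScalarTower k A T]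
      [Module.Finite k T] [IsSimpleModule A T],
      finrank k (N →ₗ[A] T) ≤ finrank k (M →ₗ[A] T)) →
    ∃ f : M →ₗ[A] N, Function.Surjective f := by
  induction n with
  | zero =>
    intro M N _ _ _ _ _ _ _ _ _ _ _ _ hn _
    have : Subsingleton N := finrank_zero_iff.1 (Nat.le_zero.1 hn)
    exact ⟨0, fun y => ⟨0, Subsingleton.elim _ _⟩⟩
  | succ n ih =>
    intro M N _ _ _ _ _ _ _ _ _ _ _ _ hn hT
    rcases subsingleton_or_nontrivial N with h0 | h0
    · exact ⟨0, fun y => ⟨0, Subsingleton.elim _ _⟩⟩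
    obtain ⟨m, hm⟩ := IsSemisimpleModule.exists_simple_submodule A N
    have := finite_submodule_of_isScalarTower (k := k) m
    have := finite_linearMap_of_isScalarTower (k := k) (A := A) M m
    have := finite_linearMap_of_isScalarTower (k := k) (A := A) N m
    obtain ⟨C, hC⟩ := exists_isCompl m
    let q : N →ₗ[A] m := Submodule.projectionOnto m C hC
    have hq : Function.Surjective q := Submodule.projectionOnto_surjective hC
    have : Nontrivial m := IsSimpleModule.nontrivial A m
    have hq0 : q ≠ 0 := by
      intro h
      obtain ⟨x, hx⟩ := exists_ne (0 : m)
      obtain ⟨y, rfl⟩ := hq x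
      exact hx (by rw [h]; rfl)
    have hpos : 0 < finrank k (M →ₗ[A] m) :=
      lt_of_lt_of_le (finrank_pos_iff_exists_ne_zero.2 ⟨q, hq0⟩) (hT m)
    obtain ⟨p, hp0⟩ := finrank_pos_iff_exists_ne_zero.1 hpos
    have hp : Function.Surjective p := LinearMap.surjective_of_ne_zero hp0
    obtain ⟨e⟩ := IsSemisimpleModule.nonempty_equiv_ker_prod p hp
    obtain ⟨e'⟩ := IsSemisimpleModule.nonempty_equiv_ker_prod q hq
    have := finite_submodule_of_isScalarTower (k := k) (LinearMap.ker p)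
    have := finite_submodule_of_isScalarTower (k := k) (LinearMap.ker q)
    have hdim : finrank k N = finrank k (LinearMap.ker q) + finrank k m := by
      rw [(e'.restrictScalars k).finrank_eq, finrank_prod]
    have hmpos : 0 < finrank k m := finrank_pos_iff_exists_ne_zero.2 (exists_ne 0)
    obtain ⟨f, hf⟩ := ih (LinearMap.ker p) (LinearMap.ker q) (by omega) (by
      intro T _ _ _ _ _ _
      have h1 := hT T
      rw [finrank_linearMap_congr T e, finrank_linearMap_congr T e', finrank_linearMap_prod,
        finrank_linearMap_prod] at h1
      omega)
    refine ⟨e'.symm.toLinearMap ∘ₗ (f.prodMap LinearMap.id) ∘ₗ e.toLinearMap, ?_⟩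
    exact e'.symm.surjective.comp ((hf.prodMap Function.surjective_id).comp e.surjective)

/-- A map to a simple module is zero or has a maximal submodule as kernel, so it kills the radical.
-/
theorem finrank_linearMap_quotient_jacobson (M T : Type u) [AddCommGroup M] [Module k M]
    [Module A M] [IsScalarTower k A M] [AddCommGroup T] [Module k T] [Module A T]
    [IsScalarTower k A T] [IsSimpleModule A T] :
    finrank k (M ⧸ Module.jacobson A M →ₗ[A] T) = finrank k (M →ₗ[A] T) := by
  have hle : ∀ f : M →ₗ[A] T, Module.jacobson A M ≤ LinearMap.ker f := by
    intro f
    rcases LinearMap.surjective_or_eq_zero f with hf | rfl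
    · exact sInf_le (LinearMap.isCoatom_ker_of_surjective hf)
    · simp
  refine LinearEquiv.finrank_eq (LinearEquiv.ofBijective
    (LinearMap.lcomp k T (Module.jacobson A M).mkQ) ⟨fun f g h => ?_, fun f => ?_⟩)
  · exact Submodule.linearMap_qext _ h
  · exact ⟨Submodule.liftQ _ f (hle f), Submodule.liftQ_mkQ _ f (hle f)⟩

/-- Modulo the radicals both modules are semisimple and have the same maps to simples, so there is a
surjection between the tops; projectivity lifts it. -/
theorem exists_surjective_of_projective [Module.Finite k A] (P N : Type u)
    [AddCommGroup P] [Module k P] [Module A P] [IsScalarTower k A P] [Module.Finite k P]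
    [Module.Projective A P] [AddCommGroup N] [Module k N] [Module A N] [IsScalarTower k A N]
    [Module.Finite k N]
    (hT : ∀ (T : Type u) [AddCommGroup T] [Module k T] [Module A T] [IsScalarTower k A T]
      [Module.Finite k T] [IsSimpleModule A T],
      finrank k (N →ₗ[A] T) ≤ finrank k (P →ₗ[A] T)) :
    ∃ f : P →ₗ[A] N, Function.Surjective f := by
  have : IsArtinian A P := isArtinian_of_tower k inferInstance
  have : IsArtinian A N := isArtinian_of_tower k inferInstance
  have : Module.Finite A N := Module.Finite.of_restrictScalars_finite k A N
  have : IsSemisimpleModule A (P ⧸ Module.jacobson A P) :=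
    (IsArtinian.isSemisimpleModule_iff_jacobson A _).2 (Module.jacobson_quotient_jacobson A P)
  have : IsSemisimpleModule A (N ⧸ Module.jacobson A N) :=
    (IsArtinian.isSemisimpleModule_iff_jacobson A _).2 (Module.jacobson_quotient_jacobson A N)
  have : Module.Finite k (P ⧸ Module.jacobson A P) := finite_quotient_of_isScalarTower _
  have : Module.Finite k (N ⧸ Module.jacobson A N) := finite_quotient_of_isScalarTower _
  obtain ⟨s, hs⟩ := exists_surjective_of_finrank_linearMap_le (k := k) (A := A) _
    (P ⧸ Module.jacobson A P) (N ⧸ Module.jacobson A N) le_rfl (fun T _ _ _ _ _ _ => by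
      rw [finrank_linearMap_quotient_jacobson, finrank_linearMap_quotient_jacobson]
      exact hT T)
  obtain ⟨f, hf⟩ := Module.projective_lifting_property (Module.jacobson A N).mkQ
    (s ∘ₗ (Module.jacobson A P).mkQ) (Submodule.mkQ_surjective _)
  refine ⟨f, ?_⟩
  -- Nakayama's lemma: a proper image lies in a maximal submodule, which also contains the radical,
  -- while image and radical together span `N`.
  by_contra hne
  obtain ⟨C, hC, hle⟩ := (eq_top_or_exists_le_coatom (LinearMap.range f)).resolve_left
    (fun h => hne (LinearMap.range_eq_top.1 h))
  refine hC.1 (eq_top_iff.2 fun y _ => ?_)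
  obtain ⟨z, hz⟩ := hs ((Module.jacobson A N).mkQ y)
  obtain ⟨x, rfl⟩ := Submodule.mkQ_surjective _ z
  have h1 : (Module.jacobson A N).mkQ (f x) = (Module.jacobson A N).mkQ y := by
    rw [← hz]
    exact LinearMap.congr_fun hf x
  have h2 : y - f x ∈ Module.jacobson A N := by
    rw [Submodule.mkQ_apply, Submodule.mkQ_apply] at h1
    exact (Submodule.Quotient.eq _).1 h1.symm
  have h3 : y - f x ∈ C := (sInf_le hC : Module.jacobson A N ≤ C) h2
  simpa using C.add_mem h3 (hle ⟨x, rfl⟩)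

/-- For a nonzero module `N` there are a cyclic module `S` of dimension `d` and a surjection
`A^n → N^d`, where `n > 0` is the dimension of `Hom(N, S)`. -/
theorem exists_surjective_pi_pi [Module.Finite k A] (N : Type u)
    [AddCommGroup N] [Module k N] [Module A N] [IsScalarTower k A N]
    [Module.Finite k N] [Nontrivial N] :
    ∃ (m : Submodule A A) (n d : ℕ), n = finrank k (N →ₗ[A] A ⧸ m) ∧ d = finrank k (A ⧸ m) ∧
      0 < n ∧ ∃ f : (Fin n → A) →ₗ[A] (Fin d → N), Function.Surjective f := by
  let n : Submodule A A → ℕ := fun m => finrank k (N →ₗ[A] A ⧸ m)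
  let d : Submodule A A → ℕ := fun m => finrank k (A ⧸ m)
  have hfq : ∀ m : Submodule A A, Module.Finite k (A ⧸ m) := fun m =>
    finite_quotient_of_isScalarTower m
  have hfh : ∀ m : Submodule A A, Module.Finite k (N →ₗ[A] A ⧸ m) := fun m =>
    finite_linearMap_of_isScalarTower _ _
  have hd : ∀ m, d m ≤ finrank k A := fun m =>
    LinearMap.finrank_le_finrank_of_surjective (mkQ_restrictScalars_surjective (k := k) m)
  have hn : ∀ m, n m ≤ finrank k N * finrank k A := fun m => by
    refine (LinearMap.finrank_le_finrank_of_injective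
      (f := LinearMap.restrictScalarsₗ k A N (A ⧸ m) k)
      (LinearMap.restrictScalars_injective k)).trans ?_
    rw [finrank_linearMap]
    exact Nat.mul_le_mul_left _ (hd m)
  have : IsArtinian A N := isArtinian_of_tower k inferInstance
  have : Module.Finite A N := Module.Finite.of_restrictScalars_finite k A N
  -- a simple quotient of `N`
  obtain ⟨C, hC, -⟩ := (eq_top_or_exists_le_coatom (⊥ : Submodule A N)).resolve_left
    bot_ne_top
  have hCs : IsSimpleModule A (N ⧸ C) := isSimpleModule_iff_isCoatom.2 hC
  obtain ⟨m₀, hm₀, ⟨e₀⟩⟩ := isSimpleModule_iff_quot_maximal.1 hCs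
  have hm₀s : IsSimpleModule A (A ⧸ m₀) := (LinearEquiv.isSimpleModule_iff e₀).1 hCs
  have hn₀ : 0 < n m₀ := by
    refine finrank_pos_iff_exists_ne_zero.2 ⟨e₀.toLinearMap ∘ₗ C.mkQ, fun h => ?_⟩
    have : Nontrivial (A ⧸ m₀) := IsSimpleModule.nontrivial A _
    obtain ⟨x, hx⟩ := exists_ne (0 : A ⧸ m₀)
    obtain ⟨y, rfl⟩ := (e₀.surjective.comp (Submodule.mkQ_surjective C)) x
    exact hx (LinearMap.congr_fun h y)
  have hdpos : ∀ m : Submodule A A, IsSimpleModule A (A ⧸ m) → 0 < d m := fun m hm => by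
    have : Nontrivial (A ⧸ m) := IsSimpleModule.nontrivial A _
    exact finrank_pos_iff_exists_ne_zero.2 (exists_ne 0)
  let V : Set (Submodule A A) := {m | IsSimpleModule A (A ⧸ m)}
  -- Numerators and denominators are bounded, so the ratios `dim Hom(N, S) / dim S` over simple `S`
  -- take finitely many values. A maximum exists without classifying the simple modules.
  have hfin : ((fun m => (n m : ℚ) / d m) '' V).Finite := by
    refine ((Set.finite_Iic (finrank k N * finrank k A)).image2 (fun a b : ℕ => (a : ℚ) / b)
      (Set.finite_Iic (finrank k A))).subset ?_
    rintro _ ⟨m, -, rfl⟩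
    exact ⟨n m, hn m, d m, hd m, rfl⟩
  obtain ⟨_, ⟨m, hm, rfl⟩, hmax⟩ := Set.exists_max_image _ id hfin ⟨_, m₀, hm₀s, rfl⟩
  have hmax' : ∀ m', IsSimpleModule A (A ⧸ m') → d m * n m' ≤ n m * d m' := by
    intro m' hm'
    have h1 := hmax _ ⟨m', hm', rfl⟩
    simp only [id] at h1
    rw [div_le_div_iff₀ (by exact_mod_cast hdpos m' hm') (by exact_mod_cast hdpos m hm)] at h1
    have h2 : n m' * d m ≤ n m * d m' := by exact_mod_cast h1
    rwa [mul_comm (d m)]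
  have hmpos : 0 < n m := by
    have h1 := hmax' m₀ hm₀s
    have h2 := Nat.mul_pos (hdpos m hm) hn₀
    by_contra h3
    simp only [not_lt, Nat.le_zero] at h3
    rw [h3, zero_mul] at h1
    omega
  refine ⟨m, n m, d m, rfl, rfl, hmpos, ?_⟩
  -- For simple `T`, `dim Hom(N^d, T) = d dim Hom(N, T)` and `dim Hom(A^n, T) = n dim T`; the
  -- required inequality is maximality of the ratio `n / d`.
  refine exists_surjective_of_projective (k := k) (A := A) _ _ fun T _ _ _ _ _ hT => ?_
  obtain ⟨m', -, ⟨e⟩⟩ := isSimpleModule_iff_quot_maximal.1 hT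
  have h1 : finrank k (N →ₗ[A] T) = n m' :=
    LinearEquiv.finrank_eq
      { toFun := fun f => e.toLinearMap ∘ₗ f
        invFun := fun f => e.symm.toLinearMap ∘ₗ f
        map_add' := fun f g => LinearMap.comp_add f g e.toLinearMap
        map_smul' := fun c f => LinearMap.ext fun x =>
          LinearMap.map_smul_of_tower e.toLinearMap c (f x)
        left_inv := fun f => LinearMap.ext fun x => e.symm_apply_apply (f x)
        right_inv := fun f => LinearMap.ext fun x => e.apply_symm_apply (f x) }
  have h2 : finrank k T = d m' := (e.restrictScalars k).finrank_eq
  have := finite_linearMap_of_isScalarTower (k := k) (A := A) N T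
  have := finite_linearMap_of_isScalarTower (k := k) (A := A) A T
  rw [← (LinearMap.lsum A (fun _ : Fin (d m) => N) k (M := T)).finrank_eq,
    ← (LinearMap.lsum A (fun _ : Fin (n m) => A) k (M := T)).finrank_eq, finrank_pi_fintype,
    finrank_pi_fintype]
  simp only [Finset.sum_const, Finset.card_univ, Fintype.card_fin, smul_eq_mul]
  rw [(LinearMap.ringLmapEquivSelf A k T).finrank_eq, h1, h2]
  exact hmax' m' ((LinearEquiv.isSimpleModule_iff e).1 hT)

end FreeCovers

/-! ## Left coideal subalgebras with a grouplike cointegral are Frobenius -/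

section CoidealFrobenius

open Module HopfAlgebra LeftComoduleAlgebra

variable {k H : Type u} [Field k] [Ring H] [HopfAlgebra k H] {A : Subalgebra k H}
  (hA : IsLeftCoidealSubalgebra A)

namespace IsLeftCoidealSubalgebra

include hA in
theorem comul_eq_sum {a : A} {ι : Type u} {s : Finset ι} {h : ι → H} {c : ι → A}
    (hr : hA.comoduleAlgebra.coact a = ∑ i ∈ s, h i ⊗ₜ[k] c i) :
    Coalgebra.comul (R := k) (a : H) = ∑ i ∈ s, h i ⊗ₜ[k] (c i : H) := by
  rw [← hA.incl_coaction a]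
  change A.val.toLinearMap.lTensor H (hA.comoduleAlgebra.coact a) = _
  rw [hr]
  simp

/-- If `ℓ(a₍₀₎ v) a₍₋₁₎ = 0` for all `v`, then `ℓ(f(y)) a = 0` for every `A`-linear map `f` on `H`:
expand `ℓ(f(y)) a = a₍₋₂₎ ℓ(a₍₀₎ f(S⁻¹(a₍₋₁₎) y))`. -/
theorem smul_eq_zero_of_sliceRight [Module.Finite k H]
    (hS : Function.Bijective (antipode k (A := H)))
    {V : Type u} [AddCommGroup V] [Module k V] [Module A V] [IsScalarTower k A V]
    (f : H →ₗ[A] V) (ℓ : V →ₗ[k] k) (x : A)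
    (hx : ∀ v : V, sliceRight (ℓ ∘ₗ (LinearMap.toSpanSingleton A V v).restrictScalars k)
      (hA.comoduleAlgebra.coact x) = 0) (y : H) : ℓ (f y) • (x : H) = 0 := by
  let T : H →ₗ[k] H := (LinearEquiv.ofBijective (antipode k) hS).symm.toLinearMap
  have hT : ∀ h, antipode k (T h) = h := fun h =>
    (LinearEquiv.ofBijective (antipode k) hS).apply_symm_apply h
  let b₀ := Module.Free.chooseBasis k H
  let b := b₀.reindex ((Fintype.equivFin _).trans Equiv.ulift.{u}.symm)
  have hr := (sum_tmul_sliceLeft b (hA.comoduleAlgebra.coact x)).symm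
  let c := fun i => sliceLeft A (b.coord i) (hA.comoduleAlgebra.coact x)
  -- The `H`-legs in `hr` are basis vectors, so the hypothesis can be read coefficient by
  -- coefficient.
  have hc : ∀ i (v : V), ℓ (c i • v) = 0 := by
    intro i v
    have h1 := congrArg (b.coord i) (hx v)
    rw [apply_sliceRight, map_zero] at h1
    exact h1
  -- `T` is the inverse antipode and `G(h ⊗ a) = a S⁻¹(h)`, so `G` sends the coaction of `a` to
  -- `ε(a) 1`.
  let G : H ⊗[k] A →ₗ[k] H :=
    TensorProduct.lift ((LinearMap.mul k H).flip.compl₁₂ T A.val.toLinearMap)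
  have hG : ∀ (h : H) (a : A), G (h ⊗ₜ[k] a) = a * T h := fun h a => rfl
  have hGc : ∀ a : A, G (hA.comoduleAlgebra.coact a) =
      Coalgebra.counit (R := k) (a : H) • (1 : H) := by
    intro a
    apply hS.1
    obtain ⟨s, hs⟩ := exists_sum_tmul (hA.comoduleAlgebra.coact a)
    have h1 := mul_antipode_lTensor_comul_apply (R := k) (a : H)
    rw [hA.comul_eq_sum hs] at h1
    rw [hs]
    simp only [map_sum, hG, antipode_mul_antidistrib, hT, map_smul, antipode_one]
    simpa [Algebra.algebraMap_eq_smul_one] using h1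
  let ψ : H →ₗ[k] k := ℓ ∘ₗ f.restrictScalars k ∘ₗ LinearMap.mulRight k y
  have hψ : ∀ (h : H) (a : A), ψ (G (h ⊗ₜ[k] a)) = ℓ (a • f (T h * y)) := by
    intro h a
    change ℓ (f ((a * T h) * y)) = _
    rw [← map_smul, Subalgebra.smul_def, smul_eq_mul, mul_assoc]
  -- Two groupings of the iterated coaction of `x`. One collapses through `G` to `ℓ(f(y)) x`; in the
  -- other each term contains some `ℓ(cᵢ • v)` and vanishes.
  have h1 := hA.comoduleAlgebra.sum_coact_eq (sliceRight (ψ ∘ₗ G)) hr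
  have h2 : ∀ (i) (z : H ⊗[k] H), sliceRight (ψ ∘ₗ G)
      (TensorProduct.assoc k H H A (z ⊗ₜ[k] c i)) = 0 := by
    intro i z
    induction z with
    | zero => simp
    | add x y hx hy => simp only [map_add, TensorProduct.add_tmul, hx, hy, add_zero]
    | tmul p q =>
      rw [TensorProduct.assoc_tmul, sliceRight_tmul, LinearMap.comp_apply, hψ, hc, zero_smul]
  simp only [c] at h2
  simp only [h2, Finset.sum_const_zero, sliceRight_tmul, LinearMap.comp_apply, hGc, map_smul,
    smul_eq_mul] at h1
  have h3 : ψ 1 = ℓ (f y) := by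
    change ℓ (f (1 * y)) = _
    rw [one_mul]
  have h4 := congrArg (TensorProduct.rid k H) (Coalgebra.lTensor_counit_comul (R := k) (x : H))
  rw [hA.comul_eq_sum hr] at h4
  simp only [map_sum, LinearMap.lTensor_tmul, TensorProduct.rid_tmul, one_smul] at h4
  rw [← h3, ← h4, Finset.smul_sum, ← h1]
  refine Finset.sum_congr rfl fun i _ => ?_
  rw [smul_smul, mul_comm]

/-- The action of `H ⊗ A` on `H ⊗ V`. -/
noncomputable def diagonalAct (A : Subalgebra k H) (V : Type u) [AddCommGroup V] [Module k V]
    [Module A V] [IsScalarTower k A V] :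
    H ⊗[k] A →ₗ[k] H ⊗[k] V →ₗ[k] H ⊗[k] V :=
  TensorProduct.map₂ (LinearMap.mul k H) (Algebra.lsmul k k V : A →ₐ[k] End k V).toLinearMap

/-- The space of linear maps `H → U` that commute with given actions of `A`. -/
def equivariantHom {U : Type u} [AddCommGroup U] [Module k U] (act : A →ₗ[k] U →ₗ[k] U) :
    Submodule k (H →ₗ[k] U) where
  carrier := {Φ | ∀ (a : A) (y : H), Φ (a * y) = act a (Φ y)}
  zero_mem' := by simp
  add_mem' := by
    intro f g hf hg a y
    simp [hf a y, hg a y]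
  smul_mem' := by
    intro c f hf a y
    simp [hf a y]

/-- The space of linear maps `H → H ⊗ V` that are `A`-linear for the diagonal action. -/
noncomputable abbrev diagonalHom (V : Type u) [AddCommGroup V] [Module k V]
    [Module A V] [IsScalarTower k A V] :=
  equivariantHom (U := H ⊗[k] V) (diagonalAct A V ∘ₗ hA.comoduleAlgebra.coact.toLinearMap)

theorem diagonalAct_map (V : Type u) [AddCommGroup V] [Module k V] [Module A V]
    [IsScalarTower k A V] (h : H) (f : H →ₗ[A] V) (w : H ⊗[k] A) (z : H ⊗[k] H) :
    diagonalAct A V w (TensorProduct.map (LinearMap.mulRight k h) (f.restrictScalars k) z) =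
      TensorProduct.map (LinearMap.mulRight k h) (f.restrictScalars k)
        (A.val.toLinearMap.lTensor H w * z) := by
  induction w with
  | zero => simp
  | add x y hx hy => simp only [map_add, add_mul, LinearMap.add_apply, hx, hy]
  | tmul p a =>
    induction z with
    | zero => simp
    | add x y hx hy => simp only [map_add, mul_add, hx, hy]
    | tmul q b =>
      have h1 : f (a * b) = a • f b := map_smul f a b
      simp [diagonalAct, mul_assoc, h1]

/-- The maps `y ↦ y₍₁₎ h ⊗ f(y₍₂₎)` are equivariant and depend injectively on `h ⊗ f`, since
`S(y₍₁₎) y₍₂₎ h ⊗ f(y₍₃₎) = h ⊗ f(y)` recovers that tensor. -/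
theorem finrank_diagonalHom_ge [Module.Finite k H] (V : Type u) [AddCommGroup V] [Module k V]
    [Module A V] [IsScalarTower k A V] [Module.Finite k V] :
    finrank k H * finrank k (H →ₗ[A] V) ≤ finrank k (diagonalHom hA V) := by
  have := finite_linearMap_of_isScalarTower (k := k) (A := A) H V
  let E : H ⊗[k] (H →ₗ[A] V) →ₗ[k] (H →ₗ[k] H ⊗[k] V) := TensorProduct.lift
    (LinearMap.mk₂ k (fun h f => TensorProduct.map (LinearMap.mulRight k h)
      (f.restrictScalars k) ∘ₗ Coalgebra.comul)
      (fun h h' f => by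
        ext y
        simp only [LinearMap.comp_apply, LinearMap.add_apply]
        induction Coalgebra.comul (R := k) y with
        | zero => simp
        | add x y hx hy => simp only [map_add, hx, hy]; abel
        | tmul p q => simp [mul_add, TensorProduct.add_tmul])
      (fun c h f => by
        ext y
        simp only [LinearMap.comp_apply, LinearMap.smul_apply]
        induction Coalgebra.comul (R := k) y with
        | zero => simp
        | add x y hx hy => simp only [map_add, hx, hy, smul_add]
        | tmul p q => simp [TensorProduct.smul_tmul'])
      (fun h f f' => by
        ext y
        simp only [LinearMap.comp_apply, LinearMap.add_apply]
        induction Coalgebra.comul (R := k) y with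
        | zero => simp
        | add x y hx hy => simp only [map_add, hx, hy]; abel
        | tmul p q => simp [TensorProduct.tmul_add])
      (fun c h f => by
        ext y
        simp only [LinearMap.comp_apply, LinearMap.smul_apply]
        induction Coalgebra.comul (R := k) y with
        | zero => simp
        | add x y hx hy => simp only [map_add, hx, hy, smul_add]
        | tmul p q => simp [TensorProduct.smul_tmul']))
  have hE : ∀ h f y, E (h ⊗ₜ[k] f) y = TensorProduct.map (LinearMap.mulRight k h)
      (f.restrictScalars k) (Coalgebra.comul (R := k) y) := fun h f y => rfl
  have hmem : ∀ z, E z ∈ diagonalHom hA V := by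
    intro z
    induction z with
    | zero => simp
    | add x y hx hy => rw [map_add]; exact Submodule.add_mem _ hx hy
    | tmul h f =>
      intro a y
      have h2 := hA.incl_coaction a
      change E (h ⊗ₜ[k] f) (a * y) =
        diagonalAct A V (hA.comoduleAlgebra.coact a) (E (h ⊗ₜ[k] f) y)
      rw [hE, hE, diagonalAct_map, Bialgebra.comul_mul, ← h2]
      rfl
  -- recover `h ⊗ f(y)` from `y₍₁₎ h ⊗ f(y₍₂₎)`
  have hrec : ∀ (z : H ⊗[k] (H →ₗ[A] V)) (y : H) (s : Finset (H × H)),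
      Coalgebra.comul (R := k) y = ∑ i ∈ s, i.1 ⊗ₜ[k] i.2 →
      ∑ i ∈ s, (LinearMap.mulLeft k (antipode k i.1)).rTensor V (E z i.2) =
        ((LinearMap.applyₗ y ∘ₗ LinearMap.restrictScalarsₗ k A H V k :
          (H →ₗ[A] V) →ₗ[k] V)).lTensor H z := by
    intro z y s hs
    induction z with
    | zero => simp
    | add x y hx hy => simp only [map_add, LinearMap.add_apply, Finset.sum_add_distrib, hx, hy]
    | tmul h f =>
      have h1 := (regular k H).sum_antipode_mul_coact (a := y) hs
      have h2 := congrArg (TensorProduct.map (LinearMap.mulRight k h) (f.restrictScalars k)) h1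
      rw [map_sum] at h2
      simp only [hE]
      have h3 : ∀ (p : H) (w : H ⊗[k] H), (LinearMap.mulLeft k p).rTensor V
          (TensorProduct.map (LinearMap.mulRight k h) (f.restrictScalars k) w) =
          TensorProduct.map (LinearMap.mulRight k h) (f.restrictScalars k)
            ((p ⊗ₜ[k] 1) * w) := by
        intro p w
        induction w with
        | zero => simp
        | add x y hx hy => simp only [map_add, mul_add, hx, hy]
        | tmul p q => simp [mul_assoc]
      simp only [h3]
      refine h2.trans ?_
      simp
  have hinj : Function.Injective (E.codRestrict (diagonalHom hA V) hmem) := by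
    rw [injective_iff_map_eq_zero]
    intro z hz
    have hz' : E z = 0 := congrArg Subtype.val hz
    refine tensor_ext_sliceLeft fun φ => ?_
    rw [map_zero]
    ext y
    obtain ⟨s, hs⟩ := exists_sum_tmul (Coalgebra.comul (R := k) y)
    have h1 := congrArg (sliceLeft V φ) (hrec z y s hs)
    rw [hz', LinearMap.lTensor, sliceLeft_map] at h1
    simpa using h1.symm
  have := LinearMap.finrank_le_finrank_of_injective hinj
  rwa [finrank_tensorProduct] at this

/-- Restriction along `π` from families of equivariant maps on `H^d` to `U^n`, the values on the
standard generators of `A^n`, is injective because `π` is surjective. The dimension hypothesis makes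
it bijective, so every map `x ↦ ∑ xⱼ uⱼ` factors through `π`. -/
theorem exists_equivariantHom_sum_eq [Module.Finite k H] {U : Type u} [AddCommGroup U] [Module k U]
    [Module.Finite k U] (act : A →ₗ[k] U →ₗ[k] U) {n d : ℕ}
    (hnd : n * finrank k U ≤ d * finrank k (equivariantHom (H := H) act))
    (π : (Fin n → A) →ₗ[A] (Fin d → H)) (hπ : Function.Surjective π) (u : Fin n → U) :
    ∃ Φ : Fin d → equivariantHom (H := H) act,
      ∀ x, ∑ i, (Φ i).1 (π x i) = ∑ j, act (x j) (u j) := by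
  let R : (Fin d → equivariantHom (H := H) act) →ₗ[k] (Fin n → U) := LinearMap.pi fun j =>
    ∑ i, LinearMap.applyₗ (π (Pi.single j 1) i) ∘ₗ (equivariantHom (H := H) act).subtype ∘ₗ LinearMap.proj i
  have hR : ∀ Φ j, R Φ j = ∑ i, (Φ i).1 (π (Pi.single j 1) i) := by
    intro Φ j
    simp [R]
  have hRx : ∀ Φ (x : Fin n → A), ∑ i, (Φ i).1 (π x i) =
      ∑ j, act (x j) (R Φ j) := by
    intro Φ x
    have h1 : x = ∑ j, x j • (Pi.single j 1 : Fin n → A) := by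
      ext j
      simp [Finset.sum_apply, Pi.single_apply]
    conv_lhs => rw [h1]
    simp only [map_sum, map_smul, Finset.sum_apply, Pi.smul_apply, hR]
    rw [Finset.sum_comm]
    refine Finset.sum_congr rfl fun j _ => Finset.sum_congr rfl fun i _ => ?_
    exact (Φ i).2 (x j) _
  have hRinj : Function.Injective R := by
    rw [injective_iff_map_eq_zero]
    intro Φ hΦ
    have h1 : ∀ y : Fin d → H, ∑ i, (Φ i).1 (y i) = 0 := by
      intro y
      obtain ⟨x, rfl⟩ := hπ y
      rw [hRx, hΦ]
      simp
    ext i y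
    have h2 := h1 (Pi.single i y)
    rw [Finset.sum_eq_single i (fun j _ hj => by simp [Pi.single_eq_of_ne hj]) (by simp)] at h2
    rw [Pi.single_eq_same] at h2
    exact h2
  have hRsurj : Function.Surjective R := by
    refine (LinearMap.injective_iff_surjective_of_finrank_eq_finrank
      (le_antisymm (LinearMap.finrank_le_finrank_of_injective hRinj) ?_)).1 hRinj
    rw [finrank_pi_fintype, finrank_pi_fintype]
    simp only [Finset.sum_const, Finset.card_univ, Fintype.card_fin, smul_eq_mul]
    exact hnd
  obtain ⟨Φ, rfl⟩ := hRsurj u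
  exact ⟨Φ, hRx Φ⟩

-- By `finrank_diagonalHom_ge`, the previous lemma applies to `U = H ⊗ V`: both sides of the
-- dimension inequality are compared with `n d dim H`. Hence `x ∈ ker π` is killed by the map
-- sending the `j`-th generator to `1 ⊗ v`, so `xⱼ₍₋₁₎ ⊗ xⱼ₍₀₎ v = 0` for every `v`. A nonzero map
-- `H → V` and `smul_eq_zero_of_sliceRight` then give `xⱼ = 0`.
include hA in
theorem injective_of_surjective_pi [Module.Finite k H]
    (hS : Function.Bijective (antipode k (A := H))) (V : Type u) [AddCommGroup V] [Module k V]
    [Module A V] [IsScalarTower k A V] [Module.Finite k V] {n d : ℕ}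
    (hn_def : n = finrank k (H →ₗ[A] V)) (hd_def : d = finrank k V) (hn : 0 < n)
    (π : (Fin n → A) →ₗ[A] (Fin d → H)) (hπ : Function.Surjective π) : Function.Injective π := by
  have := finite_linearMap_of_isScalarTower (k := k) (A := A) H V
  have hnd : n * finrank k (H ⊗[k] V) ≤ d * finrank k (diagonalHom hA V) := by
    rw [finrank_tensorProduct]
    calc n * (finrank k H * finrank k V) = d * (finrank k H * n) := by
          rw [← hd_def]; ring
      _ = d * (finrank k H * finrank k (H →ₗ[A] V)) := by rw [hn_def]
      _ ≤ d * finrank k (diagonalHom hA V) :=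
          Nat.mul_le_mul_left _ (finrank_diagonalHom_ge hA V)
  obtain ⟨f₀, hf₀⟩ := finrank_pos_iff_exists_ne_zero.1 (hn_def ▸ hn)
  obtain ⟨y₀, hy₀⟩ : ∃ y, f₀ y ≠ 0 := by
    by_contra! h
    exact hf₀ (LinearMap.ext h)
  rw [injective_iff_map_eq_zero]
  intro x hx
  ext j
  obtain ⟨ℓ, hℓ⟩ : ∃ ℓ : V →ₗ[k] k, ℓ (f₀ y₀) ≠ 0 := by
    by_contra! h
    exact hy₀ ((Module.forall_dual_apply_eq_zero_iff k _).1 h)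
  refine (smul_eq_zero.1 (hA.smul_eq_zero_of_sliceRight hS f₀ ℓ (x j) (fun v => ?_)
    y₀)).resolve_left hℓ
  obtain ⟨Φ, hΦ⟩ := exists_equivariantHom_sum_eq _ hnd π hπ (Pi.single j (1 ⊗ₜ[k] v))
  have h1 := hΦ x
  rw [hx, Finset.sum_eq_single j (fun i _ hi => by simp [Pi.single_eq_of_ne hi])
    (by simp)] at h1
  simp only [Pi.zero_apply, map_zero, Finset.sum_const_zero, Pi.single_eq_same] at h1
  have h2 : ∀ w : H ⊗[k] A, sliceRight ℓ (diagonalAct A V w (1 ⊗ₜ[k] v)) =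
      sliceRight (ℓ ∘ₗ (LinearMap.toSpanSingleton A V v).restrictScalars k) w := by
    intro w
    induction w with
    | zero => simp
    | add x y hx hy => simp only [map_add, LinearMap.add_apply, hx, hy]
    | tmul p a => simp [diagonalAct]
  rw [← h2]
  exact (congrArg (sliceRight ℓ) h1.symm).trans (map_zero _)

include hA in
/-- There is a surjective map of left `A`-modules `H^d → A`. -/
theorem exists_surjective_pi [Module.Finite k H]
    (hS : Function.Bijective (antipode k (A := H))) [Nontrivial H] :
    ∃ (d : ℕ) (f : (Fin d → H) →ₗ[A] A), Function.Surjective f := by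
  obtain ⟨m, n, d, hn_def, hd_def, hn, π, hπ⟩ := exists_surjective_pi_pi (k := k) (A := A) H
  have := finite_quotient_of_isScalarTower (k := k) m
  -- So `A^n ≅ H^d`; as `n > 0`, projecting to one coordinate of `A^n` gives the surjection.
  let e := LinearEquiv.ofBijective π
    ⟨hA.injective_of_surjective_pi hS (A ⧸ m) hn_def hd_def hn π hπ, hπ⟩
  let p : (Fin n → A) →ₗ[A] A := LinearMap.proj ⟨0, hn⟩
  exact ⟨d, p ∘ₗ e.symm.toLinearMap,
    (Function.surjective_eval (⟨0, hn⟩ : Fin n)).comp e.symm.surjective⟩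

end IsLeftCoidealSubalgebra

/-- A nonzero grouplike cointegral on a left coideal subalgebra is a Frobenius trace. -/
theorem IsGrouplikeCointegral.isFrobeniusTrace [Module.Finite k H] [Nontrivial H]
    (hS : Function.Bijective (antipode k (A := H))) {g : GroupLike k H} {l : A →ₗ[k] k}
    (hl : IsGrouplikeCointegral hA.comoduleAlgebra g l) (hl0 : l ≠ 0) : IsFrobeniusTrace l := by
  refine isFrobeniusTrace_of_forall_eq_zero fun x hx => ?_
  obtain ⟨d, f, hf⟩ := hA.exists_surjective_pi hS
  obtain ⟨c, hc⟩ : ∃ c, l c ≠ 0 := by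
    by_contra! h
    exact hl0 (LinearMap.ext h)
  obtain ⟨y, rfl⟩ := hf c
  obtain ⟨i, hi⟩ : ∃ i, l (f (Pi.single i (y i))) ≠ 0 := by
    by_contra! h
    apply hc
    rw [← Finset.univ_sum_single y, map_sum, map_sum]
    exact Finset.sum_eq_zero fun i _ => h i
  have h1 := hA.smul_eq_zero_of_sliceRight hS (f ∘ₗ LinearMap.single A (fun _ => H) i) l x
    (fun v => ?_) (y i)
  · exact Subtype.ext ((smul_eq_zero.1 h1).resolve_left hi)
  -- The hypothesis `l(x -) = 0` kills the left side of the cointegral identity. Cancelling `g` and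
  -- the bijective antipode leaves `x₍₋₁₎ l(x₍₀₎ v) = 0`.
  · have h2 := hl.sliceRight_traceMap x v
    have h3 : traceMap l x = 0 := LinearMap.ext hx
    have h4 : sliceRight ((traceMap l).flip v) (hA.comoduleAlgebra.coact x) = 0 := by
      apply hS.1
      have h5 := congrArg (fun z => z * ((g⁻¹ : GroupLike k H) : H)) h2
      simp only [mul_assoc, g.val_mul_val_inv, mul_one] at h5
      rw [← h5, h3]
      simp [sliceRight]
    exact h4

end CoidealFrobenius

/-! ## Relative Hopf bimodules from algebra morphisms -/

section RelHopfBimodOfAlgHoms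

open HopfAlgebra LeftComoduleAlgebra

variable {k H A : Type u} [Field k] [Ring H] [HopfAlgebra k H] [Ring A] [Algebra k A]

namespace LeftComoduleAlgebra

/-- The cofree left comodule algebra `H ⊗ C`. -/
noncomputable def cofree (k H C : Type u) [Field k] [Ring H] [HopfAlgebra k H] [Ring C]
    [Algebra k C] : LeftComoduleAlgebra k H (H ⊗[k] C) where
  coact := (Algebra.TensorProduct.assoc k k k H H C).toAlgHom.comp
    (Algebra.TensorProduct.map (Bialgebra.comulAlgHom k H) (AlgHom.id k C))
  coassoc z := by
    have h1 : ∀ z : H ⊗[k] C, ((Algebra.TensorProduct.assoc k k k H H C).toAlgHom.comp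
        (Algebra.TensorProduct.map (Bialgebra.comulAlgHom k H) (AlgHom.id k C))) z =
        TensorProduct.assoc k H H C ((Coalgebra.comul (R := k)).rTensor C z) := fun _ => rfl
    induction z with
    | zero => simp only [map_zero]
    | add x y hx hy => simp only [map_add, hx, hy]
    | tmul h c =>
      have h2 : ∀ z : H ⊗[k] H, TensorProduct.assoc k H H (H ⊗[k] C)
          ((Coalgebra.comul (R := k)).rTensor (H ⊗[k] C) (TensorProduct.assoc k H H C
            (z ⊗ₜ[k] c))) = (((TensorProduct.mk k H C).flip c).lTensor H).lTensor H
          (TensorProduct.assoc k H H H ((Coalgebra.comul (R := k)).rTensor H z)) := by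
        intro z
        induction z with
        | zero => simp
        | add x y hx hy => simp only [map_add, TensorProduct.add_tmul, hx, hy]
        | tmul p q =>
          simp only [TensorProduct.assoc_tmul, LinearMap.rTensor_tmul]
          induction Coalgebra.comul (R := k) p with
          | zero => simp
          | add x y hx hy => simp only [map_add, TensorProduct.add_tmul, hx, hy]
          | tmul r s => simp
      have h3 : ∀ z : H ⊗[k] H, ((Algebra.TensorProduct.assoc k k k H H C).toAlgHom.comp
          (Algebra.TensorProduct.map (Bialgebra.comulAlgHom k H)
            (AlgHom.id k C))).toLinearMap.lTensor H (TensorProduct.assoc k H H C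
            (z ⊗ₜ[k] c)) = (((TensorProduct.mk k H C).flip c).lTensor H).lTensor H
          ((Coalgebra.comul (R := k)).lTensor H z) := by
        intro z
        induction z with
        | zero => simp only [map_zero, TensorProduct.zero_tmul]
        | add x y hx hy => simp only [map_add, TensorProduct.add_tmul, hx, hy]
        | tmul p q =>
          simp only [TensorProduct.assoc_tmul, LinearMap.lTensor_tmul, AlgHom.toLinearMap_apply,
            h1, LinearMap.rTensor_tmul]
          induction Coalgebra.comul (R := k) q with
          | zero => simp
          | add x y hx hy => simp only [map_add, TensorProduct.tmul_add, TensorProduct.add_tmul,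
              hx, hy]
          | tmul r s => simp
      rw [h1, LinearMap.rTensor_tmul, h2, h3, Coalgebra.coassoc_apply]
  counit_coact z := by
    induction z with
    | zero => simp only [map_zero]
    | add x y hx hy => simp only [map_add, hx, hy]
    | tmul h c =>
      have h1 : ∀ z : H ⊗[k] H, TensorProduct.lid k (H ⊗[k] C)
          ((Coalgebra.counit (R := k)).rTensor (H ⊗[k] C) (TensorProduct.assoc k H H C
            (z ⊗ₜ[k] c))) = (TensorProduct.lid k H ((Coalgebra.counit (R := k)).rTensor H z))
            ⊗ₜ[k] c := by
        intro z
        induction z with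
        | zero => simp
        | add x y hx hy => simp only [map_add, TensorProduct.add_tmul, hx, hy]
        | tmul p q => simp [TensorProduct.smul_tmul']
      refine (h1 _).trans ?_
      congr 1
      exact (regular k H).counit_coact h

variable {C : Type u} [Ring C] [Algebra k C]

theorem cofree_coact (z : H ⊗[k] C) : (cofree k H C).coact z =
    TensorProduct.assoc k H H C ((Coalgebra.comul (R := k)).rTensor C z) := rfl

variable (𝔸 : LeftComoduleAlgebra k H A)

/-- The morphism of comodule algebras `a ↦ a₍₋₁₎ ⊗ f(a₍₀₎)`. -/
noncomputable def toCofree (f : A →ₐ[k] C) : A →ₐ[k] H ⊗[k] C :=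
  (Algebra.TensorProduct.map (AlgHom.id k H) f).comp 𝔸.coact

theorem toCofree_apply (f : A →ₐ[k] C) (a : A) :
    𝔸.toCofree f a = f.toLinearMap.lTensor H (𝔸.coact a) := rfl

theorem cofree_coact_toCofree (f : A →ₐ[k] C) (a : A) :
    (cofree k H C).coact (𝔸.toCofree f a) =
      (𝔸.toCofree f).toLinearMap.lTensor H (𝔸.coact a) := by
  have h1 := congrArg ((f.toLinearMap.lTensor H).lTensor H) (𝔸.coassoc a)
  rw [← LinearMap.comp_apply (LinearMap.lTensor H _) (LinearMap.lTensor H _),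
    ← LinearMap.lTensor_comp] at h1
  rw [cofree_coact, toCofree_apply]
  refine Eq.trans ?_ h1
  induction 𝔸.coact a with
  | zero => simp
  | add x y hx hy => simp only [map_add, hx, hy]
  | tmul h c =>
    simp only [LinearMap.lTensor_tmul, LinearMap.rTensor_tmul]
    induction Coalgebra.comul (R := k) h with
    | zero => simp
    | add x y hx hy => simp only [map_add, TensorProduct.add_tmul, hx, hy]
    | tmul p q => simp

end LeftComoduleAlgebra

namespace RelHopfBimod

variable {𝔸 : LeftComoduleAlgebra k H A} {B : Type u} [Ring B] [Algebra k B]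

theorem map₂_mul_comp_left {M N P : Type u} [AddCommGroup M] [Module k M] [AddCommGroup N]
    [Module k N] [AddCommGroup P] [Module k P] (f : M →ₗ[k] N →ₗ[k] P) {M' : Type u}
    [AddCommGroup M'] [Module k M'] (p : M' →ₗ[k] M) (z : H ⊗[k] M') (w : H ⊗[k] N) :
    TensorProduct.map₂ (LinearMap.mul k H) (f ∘ₗ p) z w =
      TensorProduct.map₂ (LinearMap.mul k H) f (p.lTensor H z) w := by
  induction z with
  | zero => simp
  | add x y hx hy => simp only [map_add, LinearMap.add_apply, hx, hy]
  | tmul h m =>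
    induction w with
    | zero => simp
    | add x y hx hy => simp only [map_add, hx, hy]
    | tmul q n => simp

theorem map₂_mul_mul (z w : H ⊗[k] B) :
    TensorProduct.map₂ (LinearMap.mul k H) (LinearMap.mul k B) z w = z * w := by
  induction z with
  | zero => simp
  | add x y hx hy => simp only [map_add, LinearMap.add_apply, add_mul, hx, hy]
  | tmul h m =>
    induction w with
    | zero => simp
    | add x y hx hy => simp only [map_add, mul_add, hx, hy]
    | tmul q n => simp

variable [Module.Finite k B]

/-- Let `B` be a comodule algebra with algebra morphisms `jL, jR : A → B`, and let `x` be
grouplike. Suppose that `jL` is colinear and that `jR` is colinear up to conjugation by `x`.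
Then `B`, with the coaction twisted by right multiplication with `x` and the actions via
`jL` and `jR`, is a relative Hopf bimodule. -/
noncomputable def ofAlgHoms (𝔸 : LeftComoduleAlgebra k H A) (𝔹 : LeftComoduleAlgebra k H B)
    (x : GroupLike k H) (jL jR : A →ₐ[k] B)
    (hL : ∀ a, 𝔹.coact (jL a) = jL.toLinearMap.lTensor H (𝔸.coact a))
    (hR : ∀ a, 𝔹.coact (jR a) = TensorProduct.map x.conj jR.toLinearMap (𝔸.coact a)) :
    RelHopfBimod 𝔸 where
  carrier := B
  coact := LinearMap.mulRight k ((x : H) ⊗ₜ[k] (1 : B)) ∘ₗ 𝔹.coact.toLinearMap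
  coassoc m := by
    have h1 : ∀ z : H ⊗[k] B, TensorProduct.assoc k H H B
        ((Coalgebra.comul (R := k)).rTensor B (z * ((x : H) ⊗ₜ[k] (1 : B)))) =
        TensorProduct.assoc k H H B ((Coalgebra.comul (R := k)).rTensor B z) *
          ((x : H) ⊗ₜ[k] ((x : H) ⊗ₜ[k] (1 : B))) := by
      intro z
      induction z with
      | zero => simp
      | add x y hx hy => simp only [map_add, add_mul, hx, hy]
      | tmul h b =>
        simp only [Algebra.TensorProduct.tmul_mul_tmul, LinearMap.rTensor_tmul, mul_one,
          Bialgebra.comul_mul, x.2.comul_eq_tmul_self]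
        induction Coalgebra.comul (R := k) h with
        | zero => simp
        | add x y hx hy => simp only [map_add, add_mul, TensorProduct.add_tmul, hx, hy]
        | tmul p q => simp
    have h2 : ∀ z : H ⊗[k] B, (LinearMap.mulRight k ((x : H) ⊗ₜ[k] (1 : B)) ∘ₗ
        𝔹.coact.toLinearMap).lTensor H (z * ((x : H) ⊗ₜ[k] (1 : B))) =
        𝔹.coact.toLinearMap.lTensor H z * ((x : H) ⊗ₜ[k] ((x : H) ⊗ₜ[k] (1 : B))) := by
      intro z
      induction z with
      | zero => simp
      | add x y hx hy => simp only [map_add, add_mul, hx, hy]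
      | tmul h b => simp
    simp only [LinearMap.comp_apply, LinearMap.mulRight_apply, AlgHom.toLinearMap_apply] at h2 ⊢
    rw [h1, h2, 𝔹.coassoc]
  counit_coact m := by
    have h1 : ∀ z : H ⊗[k] B, TensorProduct.lid k B
        ((Coalgebra.counit (R := k)).rTensor B (z * ((x : H) ⊗ₜ[k] (1 : B)))) =
        TensorProduct.lid k B ((Coalgebra.counit (R := k)).rTensor B z) := by
      intro z
      induction z with
      | zero => simp
      | add x y hx hy => simp only [map_add, add_mul, hx, hy]
      | tmul h b => simp [x.2.counit_eq_one]
    simp only [LinearMap.comp_apply, LinearMap.mulRight_apply, AlgHom.toLinearMap_apply]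
    rw [h1, 𝔹.counit_coact]
  actL := LinearMap.mul k B ∘ₗ jL.toLinearMap
  actR := (LinearMap.mul k B).compl₂ jR.toLinearMap
  one_actL := by simp
  mul_actL := by simp [mul_assoc]
  actR_one := by simp
  actR_mul := by simp [mul_assoc]
  actL_actR := by simp [mul_assoc]
  coact_actL a m := by
    rw [map₂_mul_comp_left, map₂_mul_mul]
    simp only [LinearMap.comp_apply, LinearMap.mulRight_apply, AlgHom.toLinearMap_apply,
      LinearMap.mul_apply', map_mul, hL, mul_assoc]
  coact_actR m a := by
    -- The factor `x` in the coaction absorbs the conjugation: `m₍₋₁₎ (x a₍₋₁₎ x⁻¹) x = (m₍₋₁₎ x)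
    -- a₍₋₁₎`.
    have h1 : ∀ (z : H ⊗[k] B) (v : H ⊗[k] A),
        z * (TensorProduct.map x.conj jR.toLinearMap v * ((x : H) ⊗ₜ[k] (1 : B))) =
        TensorProduct.map₂ (LinearMap.mul k H) ((LinearMap.mul k B).compl₂ jR.toLinearMap)
          (z * ((x : H) ⊗ₜ[k] (1 : B))) v := by
      intro z v
      induction z with
      | zero => simp
      | add x y hx hy => simp only [map_add, add_mul, LinearMap.add_apply, hx, hy]
      | tmul h b =>
        induction v with
        | zero => simp
        | add x y hx hy => simp only [map_add, mul_add, add_mul, hx, hy]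
        | tmul q a =>
          simp [mul_assoc]
    simp only [LinearMap.comp_apply, LinearMap.mulRight_apply, AlgHom.toLinearMap_apply,
      LinearMap.mul_apply', map_mul, LinearMap.compl₂_apply, mul_assoc, hR]
    exact h1 _ _

end RelHopfBimod

end RelHopfBimodOfAlgHoms

/-! ## The free relative Hopf bimodule on one generator -/

section FreeBimod

open HopfAlgebra LeftComoduleAlgebra

variable {k H A : Type u} [Field k] [Ring H] [HopfAlgebra k H] [Ring A] [Algebra k A]

theorem sliceLeft_lTensor {M N : Type u} [AddCommGroup M] [Module k M] [AddCommGroup N]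
    [Module k N] (φ : H →ₗ[k] k) (f : M →ₗ[k] N) (z : H ⊗[k] M) :
    sliceLeft N φ (f.lTensor H z) = f (sliceLeft M φ z) := by
  rw [LinearMap.lTensor, sliceLeft_map, LinearMap.comp_id]

theorem sliceRight_lTensor {M N : Type u} [AddCommGroup M] [Module k M] [AddCommGroup N]
    [Module k N] (φ : N →ₗ[k] k) (f : M →ₗ[k] N) (z : H ⊗[k] M) :
    sliceRight φ (f.lTensor H z) = sliceRight (φ ∘ₗ f) z := by
  rw [LinearMap.lTensor, sliceRight_map, LinearMap.id_apply]

namespace LeftComoduleAlgebra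

theorem sliceLeft_cofree_coact {C : Type u} [Ring C] [Algebra k C] (φ : H →ₗ[k] k) (h : H)
    (c : C) : sliceLeft (H ⊗[k] C) φ ((cofree k H C).coact (h ⊗ₜ[k] c)) =
      sliceLeft H φ (Coalgebra.comul (R := k) h) ⊗ₜ[k] c := by
  rw [cofree_coact, LinearMap.rTensor_tmul]
  induction Coalgebra.comul (R := k) h with
  | zero => simp
  | add x y hx hy => simp only [map_add, TensorProduct.add_tmul, hx, hy]
  | tmul p q => simp [TensorProduct.smul_tmul']

end LeftComoduleAlgebra

namespace IsDualIntegral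

variable [Module.Finite k H] {μ : H →ₗ[k] k} {t : H} (h : IsDualIntegral μ t)
include h

/-- Since `S(t) S(d) = S(d t) = ε(d) S(t)`, the form `μ(S(t) -)` is `μ(S(t)) ε`. The identity
`μ(S(t) t₍₁₎) t₍₂₎ = t` forces `μ(S(t)) = 1`. -/
theorem apply_antipode_mul (c : H) : μ (antipode k t * c) = Coalgebra.counit (R := k) c := by
  have h1 : ∀ c, μ (antipode k t * c) = Coalgebra.counit (R := k) c * μ (antipode k t) := by
    intro c
    obtain ⟨d, rfl⟩ := h.antipode_bijective.2 c
    rw [← antipode_mul_antidistrib, h.isLeftIntegral, map_smul, map_smul, counit_antipode,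
      smul_eq_mul]
  have h2 : traceMap μ (antipode k t) = μ (antipode k t) • Coalgebra.counit (R := k) :=
    LinearMap.ext fun c => by simp [h1, mul_comm]
  have h3 := h.sliceLeft_antipode_comul t
  have h4 : ∀ z : H ⊗[k] H, sliceLeft H (μ (antipode k t) • Coalgebra.counit (R := k)) z =
      μ (antipode k t) • sliceLeft H (Coalgebra.counit (R := k)) z := by
    intro z
    simp [sliceLeft, LinearMap.rTensor_smul]
  rw [h2, h4, ← regular_coact, (regular k H).sliceLeft_counit_coact] at h3
  have h5 := congrArg μ h3
  rw [map_smul, h.apply_self, smul_eq_mul, mul_one] at h5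
  rw [h1, h5, mul_one]

/-- Every form on `H` is `μ(S(y) -)`, and `y` is recovered by evaluating the form on `t₍₁₎` in `t₍₁₎
⊗ t₍₂₎`. Coassociativity of `Δ` at `t` computes `y` here. Thus `x ↦ μ(S(x) -)` turns the regular
comodule `H` into a free module of rank one over the convolution algebra, which makes
`cointegralPairing` colinear in `H`. -/
theorem comp_sliceLeft_traceMap_comul (ω : H →ₗ[k] k) (x : H) :
    ω ∘ₗ sliceLeft H (traceMap μ (antipode k x)) ∘ₗ Coalgebra.comul =
      traceMap μ (antipode k (sliceLeft H ω (Coalgebra.comul (R := k) x))) := by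
  obtain ⟨a, ha⟩ := h.isFrobeniusTrace.2
    (ω ∘ₗ sliceLeft H (traceMap μ (antipode k x)) ∘ₗ Coalgebra.comul)
  obtain ⟨y, rfl⟩ := h.antipode_bijective.2 a
  rw [← ha]
  congr 2
  rw [← h.sliceLeft_antipode_comul y, ha]
  obtain ⟨s, hs⟩ := exists_sum_tmul (Coalgebra.comul (R := k) t)
  have h1 := (regular k H).sum_coact_eq
    (sliceLeft H ω ∘ₗ sliceLeft (H ⊗[k] H) (traceMap μ (antipode k x))) hs
  have h2 : ∀ (z : H ⊗[k] H) (c : H),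
      (sliceLeft H ω ∘ₗ sliceLeft (H ⊗[k] H) (traceMap μ (antipode k x)))
        (TensorProduct.assoc k H H H (z ⊗ₜ[k] c)) =
      ω (sliceLeft H (traceMap μ (antipode k x)) z) • c := by
    intro z c
    induction z with
    | zero => simp
    | add x y hx hy => simp only [map_add, add_smul, TensorProduct.add_tmul, hx, hy]
    | tmul p q => simp [smul_smul]
  simp only [h2, regular_coact, LinearMap.comp_apply, sliceLeft_tmul] at h1
  conv_rhs => rw [← h.sliceLeft_antipode_comul x]
  rw [hs]
  simp only [map_sum, sliceLeft_tmul, LinearMap.comp_apply, map_smul] at h1 ⊢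
  exact h1.symm

end IsDualIntegral

namespace RelHopfBimod

variable {𝔸 : LeftComoduleAlgebra k H A} (X : RelHopfBimod 𝔸)

theorem sliceLeft_counit_coact (y : X.carrier) :
    sliceLeft X.carrier (Coalgebra.counit (R := k)) (X.coact y) = y :=
  X.counit_coact y

theorem sliceLeft_coact_sliceLeft_coact (ω φ : H →ₗ[k] k) (y : X.carrier) :
    sliceLeft X.carrier ω (X.coact (sliceLeft X.carrier φ (X.coact y))) =
      sliceLeft X.carrier (ω ∘ₗ sliceLeft H φ ∘ₗ Coalgebra.comul) (X.coact y) := by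
  have h1 := congrArg (sliceLeft X.carrier ω ∘ₗ sliceLeft (H ⊗[k] X.carrier) φ) (X.coassoc y)
  rw [LinearMap.comp_apply, LinearMap.comp_apply, sliceLeft_lTensor] at h1
  rw [← h1]
  induction X.coact y with
  | zero => simp
  | add x y hx hy => simp only [map_add, hx, hy]
  | tmul h m =>
    simp only [LinearMap.rTensor_tmul, sliceLeft_tmul, LinearMap.comp_apply]
    induction Coalgebra.comul (R := k) h with
    | zero => simp
    | add x y hx hy => simp only [map_add, TensorProduct.add_tmul, add_smul, hx, hy]
    | tmul p q => simp [smul_smul]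

/-- The pairing `h ⊗ y ↦ μ(S(h) y₍₋₁₎) y₍₀₎`. -/
noncomputable def cointegralPairing (μ : H →ₗ[k] k) : H →ₗ[k] X.carrier →ₗ[k] X.carrier :=
  LinearMap.mk₂ k (fun h y => sliceLeft X.carrier (traceMap μ (antipode k h)) (X.coact y))
    (fun _ _ _ => by simp [sliceLeft, LinearMap.rTensor_add])
    (fun _ _ _ => by simp [sliceLeft, LinearMap.rTensor_smul])
    (fun _ _ _ => by simp)
    (fun _ _ _ => by simp)

theorem cointegralPairing_apply (μ : H →ₗ[k] k) (x : H) (y : X.carrier) :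
    X.cointegralPairing μ x y = sliceLeft X.carrier (traceMap μ (antipode k x)) (X.coact y) :=
  rfl

/-- `S(a₍₋₂₎ x) a₍₋₁₎ = S(x) S(a₍₋₂₎) a₍₋₁₎` collapses. This is left linearity of the pairing for
the diagonal action on the free object. -/
theorem sum_cointegralPairing_mul_actL (μ : H →ₗ[k] k) {ι : Type u} {a : A} {s : Finset ι}
    {p : ι → H} {c : ι → A} (hr : 𝔸.coact a = ∑ i ∈ s, p i ⊗ₜ[k] c i) (x : H) (y : X.carrier) :
    ∑ i ∈ s, X.cointegralPairing μ (p i * x) (X.actL (c i) y) =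
      X.actL a (X.cointegralPairing μ x y) := by
  have h1 : ∀ (p : H) (z : H ⊗[k] X.carrier),
      sliceLeft X.carrier (traceMap μ (antipode k (p * x))) z =
        sliceLeft X.carrier (traceMap μ (antipode k x))
          (TensorProduct.map₂ (LinearMap.mul k H) X.actL (antipode k p ⊗ₜ[k] 1) z) := by
    intro p z
    induction z with
    | zero => simp
    | add x y hx hy => simp only [map_add, hx, hy]
    | tmul q m => simp [antipode_mul_antidistrib, mul_assoc, X.one_actL]
  have h2 : ∀ z : H ⊗[k] X.carrier, sliceLeft X.carrier (traceMap μ (antipode k x))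
      (TensorProduct.map₂ (LinearMap.mul k H) X.actL (1 ⊗ₜ[k] a) z) =
      X.actL a (sliceLeft X.carrier (traceMap μ (antipode k x)) z) := by
    intro z
    induction z with
    | zero => simp
    | add x y hx hy => simp only [map_add, hx, hy]
    | tmul q m => simp
  simp only [cointegralPairing_apply, h1, X.coact_actL, ← map₂_mul_map₂ X.actL X.mul_actL]
  rw [← h2, ← 𝔸.sum_antipode_mul_coact hr, map_sum, LinearMap.sum_apply, map_sum]

end RelHopfBimod

namespace IsDualIntegral

variable [Module.Finite k H] {μ : H →ₗ[k] k} {t : H} (h : IsDualIntegral μ t)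
variable {𝔸 : LeftComoduleAlgebra k H A} (X : RelHopfBimod 𝔸)
include h

theorem cointegralPairing_self (y : X.carrier) : X.cointegralPairing μ t y = y := by
  rw [X.cointegralPairing_apply,
    show traceMap μ (antipode k t) = Coalgebra.counit (R := k) from
      LinearMap.ext h.apply_antipode_mul, X.sliceLeft_counit_coact]

theorem sliceLeft_coact_cointegralPairing (ω : H →ₗ[k] k) (x : H) (y : X.carrier) :
    sliceLeft X.carrier ω (X.coact (X.cointegralPairing μ x y)) =
      X.cointegralPairing μ (sliceLeft H ω (Coalgebra.comul (R := k) x)) y := by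
  rw [X.cointegralPairing_apply, X.sliceLeft_coact_sliceLeft_coact,
    h.comp_sliceLeft_traceMap_comul, X.cointegralPairing_apply]

/-- Here the new factor appears at the right end inside `μ`. Moving it to the left costs `S²` and a
twist by `α`; acting through `α ∘ S` cancels the twist, and `S²(a₍₋₁₎) S(a₍₋₂₎)` collapses. This is
why the right action of the free object carries `α ∘ S`. -/
theorem sum_cointegralPairing_mul_actR {ι : Type u} {a : A} {s : Finset ι}
    {p : ι → H} {c : ι → A} (hr : 𝔸.coact a = ∑ i ∈ s, p i ⊗ₜ[k] c i) (x : H) (y : X.carrier) :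
    ∑ i ∈ s, X.cointegralPairing μ (x * p i)
        (X.actR y (𝔸.twist h.modular.compAntipode (c i))) =
      X.actR (X.cointegralPairing μ x y) a := by
  let G : H ⊗[k] A →ₗ[k] X.carrier := TensorProduct.lift (LinearMap.mk₂ k
    (fun q b => X.actR (sliceLeft X.carrier (traceMap μ (q * antipode k x)) (X.coact y)) b)
    (fun _ _ _ => by simp [sliceLeft, LinearMap.rTensor_add, add_mul])
    (fun _ _ _ => by simp [sliceLeft, LinearMap.rTensor_smul])
    (fun _ _ _ => by simp)
    (fun _ _ _ => by simp))
  have hG : ∀ q b, G (q ⊗ₜ[k] b) =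
      X.actR (sliceLeft X.carrier (traceMap μ (q * antipode k x)) (X.coact y)) b :=
    fun _ _ => rfl
  have h1 : ∀ (q : H) (v : H ⊗[k] A),
      sliceLeft X.carrier (traceMap μ (antipode k (x * q)))
        (TensorProduct.map₂ (LinearMap.mul k H) X.actR (X.coact y)
          (((regular k H).twist h.modular.compAntipode).toLinearMap.rTensor A v)) =
      G ((antipode k).rTensor A ((antipode k).rTensor A v) * (antipode k q ⊗ₜ[k] (1 : A))) := by
    intro q v
    induction v with
    | zero => simp
    | add x y hx hy => simp only [map_add, add_mul, hx, hy]
    | tmul d b =>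
      simp only [LinearMap.rTensor_tmul, Algebra.TensorProduct.tmul_mul_tmul, mul_one, hG]
      induction X.coact y with
      | zero => simp
      | add x y hx hy => simp only [map_add, LinearMap.add_apply, hx, hy]
      | tmul r m =>
        simp only [TensorProduct.map₂_apply_tmul, TensorProduct.map_tmul, LinearMap.mul_apply',
          sliceLeft_tmul, traceMap_apply, AlgHom.toLinearMap_apply, map_smul, LinearMap.smul_apply]
        rw [← mul_assoc, h.apply_mul_twist, antipode_mul_antidistrib]
        simp only [mul_assoc]
  simp only [X.cointegralPairing_apply, X.coact_actR, coact_twist, h1]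
  rw [← map_sum, 𝔸.sum_antipode_antipode_coact_mul hr, hG, one_mul]

end IsDualIntegral

namespace RelHopfBimod

variable [Module.Finite k H] [Module.Finite k A]

/-- The relative Hopf bimodule `H ⊗ (A ⊗ A)` with the coaction of `H`, the left action
`a (h ⊗ u ⊗ v) = a₍₋₁₎ h ⊗ a₍₀₎ u ⊗ v` and the right action
`(h ⊗ u ⊗ v) b = h b₍₋₁₎ ⊗ u ⊗ v χ(b₍₀₎)`, where `χ` is a character of `H`. -/
noncomputable def free (𝔸 : LeftComoduleAlgebra k H A) (χ : H →ₐ[k] k) : RelHopfBimod 𝔸 :=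
  ofAlgHoms 𝔸 (cofree k H (A ⊗[k] A)) 1 (𝔸.toCofree Algebra.TensorProduct.includeLeft)
    (𝔸.toCofree (Algebra.TensorProduct.includeRight.comp (𝔸.twist χ)))
    (𝔸.cofree_coact_toCofree _)
    (fun a => by rw [cofree_coact_toCofree, GroupLike.conj_one]; rfl)

variable (𝔸 : LeftComoduleAlgebra k H A) (χ : H →ₐ[k] k)

theorem free_coact (p : H ⊗[k] (A ⊗[k] A)) :
    (free 𝔸 χ).coact p = (cofree k H (A ⊗[k] A)).coact p := by
  change (cofree k H (A ⊗[k] A)).coact p * (((1 : GroupLike k H) : H) ⊗ₜ[k] 1) = _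
  rw [GroupLike.val_one, ← Algebra.TensorProduct.one_def, mul_one]

omit [Module.Finite k H] [Module.Finite k A]

variable {𝔸} (X : RelHopfBimod 𝔸)

/-- The linear map `h ⊗ u ⊗ v ↦ μ(S(h) (u x v)₍₋₁₎) (u x v)₍₀₎`. -/
noncomputable def freeLift (μ : H →ₗ[k] k) (x : X.carrier) :
    H ⊗[k] (A ⊗[k] A) →ₗ[k] X.carrier :=
  TensorProduct.lift (X.cointegralPairing μ) ∘ₗ
    (TensorProduct.lift (X.actR ∘ₗ X.actL.flip x)).lTensor H

@[simp]
theorem freeLift_tmul (μ : H →ₗ[k] k) (x : X.carrier) (q : H) (u v : A) :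
    X.freeLift μ x (q ⊗ₜ[k] (u ⊗ₜ[k] v)) =
      X.cointegralPairing μ q (X.actR (X.actL u x) v) := by
  simp [freeLift]

theorem freeLift_toCofree_mul (μ : H →ₗ[k] k) (x : X.carrier) (a : A)
    (p : H ⊗[k] (A ⊗[k] A)) :
    X.freeLift μ x (𝔸.toCofree Algebra.TensorProduct.includeLeft a * p) =
      X.actL a (X.freeLift μ x p) := by
  rw [toCofree_apply]
  obtain ⟨s, hs⟩ := exists_sum_tmul (𝔸.coact a)
  induction p with
  | zero => simp
  | add x y hx hy => simp only [map_add, mul_add, hx, hy]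
  | tmul q w =>
    induction w with
    | zero => simp
    | add x y hx hy => simp only [map_add, mul_add, TensorProduct.tmul_add, hx, hy]
    | tmul u v =>
      rw [X.freeLift_tmul, ← X.sum_cointegralPairing_mul_actL μ hs, hs]
      simp [Finset.sum_mul, X.mul_actL, X.actL_actR]

theorem toLin_comp_freeLift (μ : H →ₗ[k] k) {X Y : RelHopfBimod 𝔸} (f : X ⟶ Y) (x : X.carrier) :
    toLin f ∘ₗ X.freeLift μ x = Y.freeLift μ (toLin f x) := by
  refine TensorProduct.ext' fun q w => ?_
  induction w with
  | zero => simp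
  | add x y hx hy => simp only [map_add, TensorProduct.tmul_add, hx, hy]
  | tmul u v =>
    have h1 : Y.actR (Y.actL u (toLin f x)) v =
        toLin f (X.actR (X.actL u x) v) :=
      ((f.2.2.2 _ _).trans (congrArg (fun z => Y.actR z v) (f.2.2.1 u x))).symm
    have h2 := f.2.1 (X.actR (X.actL u x) v)
    rw [LinearMap.comp_apply, X.freeLift_tmul, Y.freeLift_tmul, h1, X.cointegralPairing_apply,
      Y.cointegralPairing_apply]
    refine Eq.trans ?_ (congrArg _ h2.symm)
    exact (sliceLeft_lTensor _ _ _).symm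

end RelHopfBimod

namespace IsDualIntegral

variable [Module.Finite k H] {μ : H →ₗ[k] k} {t : H}
  (h : IsDualIntegral μ t) {𝔸 : LeftComoduleAlgebra k H A}

include h in
theorem sliceLeft_coact_freeLift (X : RelHopfBimod 𝔸) (x : X.carrier) (ω : H →ₗ[k] k)
    (p : H ⊗[k] (A ⊗[k] A)) :
    sliceLeft X.carrier ω (X.coact (X.freeLift μ x p)) =
      X.freeLift μ x (sliceLeft (H ⊗[k] (A ⊗[k] A)) ω ((cofree k H (A ⊗[k] A)).coact p)) := by
  induction p with
  | zero => simp
  | add x y hx hy => simp only [map_add, hx, hy]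
  | tmul q w =>
    rw [sliceLeft_cofree_coact]
    induction w with
    | zero => simp
    | add x y hx hy => simp only [map_add, TensorProduct.tmul_add, hx, hy]
    | tmul u v =>
      rw [X.freeLift_tmul, X.freeLift_tmul, h.sliceLeft_coact_cointegralPairing]

include h in
theorem freeLift_mul_toCofree (X : RelHopfBimod 𝔸) (x : X.carrier) (p : H ⊗[k] (A ⊗[k] A))
    (a : A) :
    X.freeLift μ x (p * 𝔸.toCofree (Algebra.TensorProduct.includeRight.comp
      (𝔸.twist h.modular.compAntipode)) a) = X.actR (X.freeLift μ x p) a := by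
  rw [toCofree_apply]
  obtain ⟨s, hs⟩ := exists_sum_tmul (𝔸.coact a)
  induction p with
  | zero => simp
  | add x y hx hy => simp only [map_add, add_mul, LinearMap.add_apply, hx, hy]
  | tmul q w =>
    induction w with
    | zero => simp
    | add x y hx hy =>
      simp only [map_add, add_mul, TensorProduct.tmul_add, LinearMap.add_apply, hx, hy]
    | tmul u v =>
      rw [X.freeLift_tmul, ← h.sum_cointegralPairing_mul_actR X hs, hs]
      simp [Finset.mul_sum, X.actR_mul]

/-- The generator `t ⊗ 1 ⊗ 1`. -/
noncomputable def gen (_ : IsDualIntegral μ t) (A : Type u) [Ring A] [Algebra k A] :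
    H ⊗[k] (A ⊗[k] A) :=
  t ⊗ₜ[k] (1 ⊗ₜ[k] 1)

include h in
theorem freeLift_gen (X : RelHopfBimod 𝔸) (x : X.carrier) : X.freeLift μ x (h.gen A) = x := by
  rw [gen, X.freeLift_tmul, X.one_actL, X.actR_one, h.cointegralPairing_self]

variable [Module.Finite k A]

/-- The morphism from the free relative Hopf bimodule to `X` sending `t ⊗ 1 ⊗ 1` to `x`. -/
noncomputable def freeHom (X : RelHopfBimod 𝔸) (x : X.carrier) :
    RelHopfBimod.free 𝔸 h.modular.compAntipode ⟶ X :=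
  ⟨X.freeLift μ x, fun (p : H ⊗[k] (A ⊗[k] A)) => tensor_ext_sliceLeft fun ω =>
      (h.sliceLeft_coact_freeLift X x ω p).trans <| by
        rw [RelHopfBimod.free_coact]
        exact (sliceLeft_lTensor (M := H ⊗[k] (A ⊗[k] A)) ω _ _).symm,
    fun a p => X.freeLift_toCofree_mul μ x a p, fun p a => h.freeLift_mul_toCofree X x p a⟩

end IsDualIntegral

end FreeBimod

/-! ## Linear forms on the free relative Hopf bimodule -/

section FreeForms

open HopfAlgebra LeftComoduleAlgebra

variable {k H A : Type u} [Field k] [Ring H] [HopfAlgebra k H] [Ring A] [Algebra k A]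

/-- The linear form `l ⊗ l` on `A ⊗ A`. -/
noncomputable def tensorSquareForm (l : A →ₗ[k] k) : A ⊗[k] A →ₗ[k] k :=
  LinearMap.mul' k k ∘ₗ TensorProduct.map l l

@[simp]
theorem tensorSquareForm_tmul (l : A →ₗ[k] k) (u v : A) :
    tensorSquareForm l (u ⊗ₜ[k] v) = l u * l v := by
  simp [tensorSquareForm]

variable (k H) in
/-- The linear form `ε ⊗ l ⊗ l` on `H ⊗ (A ⊗ A)`. -/
noncomputable def counitSquareForm (l : A →ₗ[k] k) : H ⊗[k] (A ⊗[k] A) →ₗ[k] k :=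
  tensorSquareForm l ∘ₗ sliceLeft (A ⊗[k] A) (Coalgebra.counit (R := k))

theorem sliceLeft_counit_mul {C : Type u} [Ring C] [Algebra k C] (z w : H ⊗[k] C) :
    sliceLeft C (Coalgebra.counit (R := k)) (z * w) =
      sliceLeft C (Coalgebra.counit (R := k)) z * sliceLeft C (Coalgebra.counit (R := k)) w := by
  induction z with
  | zero => simp
  | add x y hx hy => simp only [map_add, add_mul, hx, hy]
  | tmul p c =>
    induction w with
    | zero => simp
    | add x y hx hy => simp only [map_add, mul_add, hx, hy]
    | tmul q d => simp [smul_smul, mul_comm]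

theorem counit_sliceLeft_comul (φ : H →ₗ[k] k) (x : H) :
    Coalgebra.counit (R := k) (sliceLeft H φ (Coalgebra.comul (R := k) x)) = φ x := by
  rw [← apply_sliceRight]
  congr 1
  have := Coalgebra.lTensor_counit_comul (R := k) x
  simp [sliceRight, this]

namespace LeftComoduleAlgebra

variable (𝔸 : LeftComoduleAlgebra k H A) {C : Type u} [Ring C] [Algebra k C]

theorem sliceLeft_counit_toCofree (f : A →ₐ[k] C) (a : A) :
    sliceLeft C (Coalgebra.counit (R := k)) (𝔸.toCofree f a) = f a := by
  rw [toCofree_apply, sliceLeft_lTensor, 𝔸.sliceLeft_counit_coact]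
  rfl

theorem sliceLeft_counit_sliceLeft_cofree_coact (φ : H →ₗ[k] k) (z : H ⊗[k] C) :
    sliceLeft C (Coalgebra.counit (R := k))
      (sliceLeft (H ⊗[k] C) φ ((cofree k H C).coact z)) = sliceLeft C φ z := by
  induction z with
  | zero => simp
  | add x y hx hy => simp only [map_add, hx, hy]
  | tmul q c => rw [sliceLeft_cofree_coact, sliceLeft_tmul, sliceLeft_tmul,
      counit_sliceLeft_comul]

theorem sliceLeft_toCofree_mul_mul (f f' : A →ₐ[k] C) (φ : H →ₗ[k] k) (ℓ : C →ₗ[k] k)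
    (ℓ₁ ℓ₂ : A →ₗ[k] k) (hℓ : ∀ a b, ℓ (f a * f' b) = ℓ₁ a * ℓ₂ b) (y : H) (a b : A) :
    ℓ (sliceLeft C φ (𝔸.toCofree f a * (y ⊗ₜ[k] 1) * 𝔸.toCofree f' b)) =
      φ (sliceRight ℓ₁ (𝔸.coact a) * y * sliceRight ℓ₂ (𝔸.coact b)) := by
  rw [toCofree_apply, toCofree_apply]
  induction 𝔸.coact a with
  | zero => simp
  | add x y hx hy => simp only [map_add, add_mul, hx, hy]
  | tmul p c =>
    induction 𝔸.coact b with
    | zero => simp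
    | add x y hx hy => simp only [map_add, mul_add, hx, hy]
    | tmul q d => simp [hℓ, mul_comm, mul_left_comm]

end LeftComoduleAlgebra

theorem IsGrouplikeCointegral.sliceRight_twist {𝔸 : LeftComoduleAlgebra k H A} {g : GroupLike k H}
    {l : A →ₗ[k] k} (hl : IsGrouplikeCointegral 𝔸 g l) (χ : H →ₐ[k] k) (a : A) :
    sliceRight (l ∘ₗ (𝔸.twist χ).toLinearMap) (𝔸.coact a) = (l a * χ (g : H)) • (g : H) := by
  rw [← sliceRight_lTensor, lTensor_twist_coact, LinearMap.rTensor, sliceRight_map,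
    LinearMap.comp_id, hl.sliceRight_coact, LinearMap.comp_apply, map_smul,
    g.2.comul_eq_tmul_self, map_smul, sliceRight_tmul, mul_smul]
  rfl

namespace IsDualIntegral

variable [Module.Finite k H] {μ : H →ₗ[k] k} {t : H} (h : IsDualIntegral μ t)
include h

/-- The cointegral identity for `μ` with second argument `t`, where `μ(- t) = ε`. -/
theorem sliceRight_traceMap_comul (a : H) :
    sliceRight (traceMap μ a) (Coalgebra.comul (R := k) t) = antipode k a * h.grouplike := by
  have h1 := h.isGrouplikeCointegral.sliceRight_traceMap a t
  rw [h.flip_traceMap] at h1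
  refine h1.trans ?_
  congr 2
  have := Coalgebra.lTensor_counit_comul (R := k) a
  simp [sliceRight, this]

/-- `S²` fixes a grouplike, so the Nakayama automorphism of `μ` only rescales it by `α(g)`. -/
theorem apply_mul_grouplike (g : GroupLike k H) (x : H) :
    μ (x * g) = h.modular (g : H) * μ (g * x) := by
  have h1 : (regular k H).twist h.modular (g : H) = h.modular (g : H) • (g : H) := by
    rw [twist_apply, regular_coact, g.2.comul_eq_tmul_self]
    simp
  rw [h.apply_mul_comm, h1, map_smul, map_smul, smul_mul_assoc, map_smul, smul_eq_mul,
    ← GroupLike.val_inv, ← GroupLike.val_inv, inv_inv]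

variable {C : Type u} [Ring C] [Algebra k C] (𝔸 : LeftComoduleAlgebra k H A)

theorem toCofree_mul_tmul (f : A →ₐ[k] C) (a : A) (c : C) :
    𝔸.toCofree f a * (t ⊗ₜ[k] c) = t ⊗ₜ[k] (f a * c) := by
  have h1 : ∀ z : H ⊗[k] A, f.toLinearMap.lTensor H z * (t ⊗ₜ[k] c) =
      t ⊗ₜ[k] (f (sliceLeft A (Coalgebra.counit (R := k)) z) * c) := by
    intro z
    induction z with
    | zero => simp
    | add x y hx hy => simp only [map_add, add_mul, TensorProduct.tmul_add, hx, hy]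
    | tmul p b => simp [h.isLeftIntegral p, TensorProduct.smul_tmul]
  rw [toCofree_apply, h1, 𝔸.sliceLeft_counit_coact]

theorem tmul_mul_toCofree (f : A →ₐ[k] C) (a : A) (c : C) :
    (t ⊗ₜ[k] c) * 𝔸.toCofree f a = t ⊗ₜ[k] (c * f (𝔸.twist h.modular a)) := by
  have h1 : ∀ z : H ⊗[k] A, (t ⊗ₜ[k] c) * f.toLinearMap.lTensor H z =
      t ⊗ₜ[k] (c * f (sliceLeft A h.modular.toLinearMap z)) := by
    intro z
    induction z with
    | zero => simp
    | add x y hx hy => simp only [map_add, mul_add, TensorProduct.tmul_add, hx, hy]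
    | tmul p b => simp [h.mul_eq_smul p, TensorProduct.smul_tmul]
  rw [toCofree_apply, h1, twist_apply]

omit h in
theorem free_freeLift_tmul [Module.Finite k A] (χ : H →ₐ[k] k) (p : H ⊗[k] (A ⊗[k] A)) (q : H) (u v : A) :
    (RelHopfBimod.free 𝔸 χ).freeLift μ p (q ⊗ₜ[k] (u ⊗ₜ[k] v)) =
      sliceLeft (H ⊗[k] (A ⊗[k] A)) (traceMap μ (antipode k q)) ((cofree k H _).coact
        (𝔸.toCofree Algebra.TensorProduct.includeLeft u * p *
          𝔸.toCofree (Algebra.TensorProduct.includeRight.comp (𝔸.twist χ)) v)) :=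
  (RelHopfBimod.freeLift_tmul _ _ _ _ _ _).trans
    (congrArg (sliceLeft (H ⊗[k] (A ⊗[k] A)) (traceMap μ (antipode k q)))
      (RelHopfBimod.free_coact 𝔸 χ _))

/-- Next to the integral `t`, a left coaction leg becomes `ε` and a right one becomes `α`; the
latter cancels the `α ∘ S` in the right action. On elements `t ⊗ w` the two actions are therefore
those of the outer bimodule structure on `A ⊗ A`. -/
theorem toCofree_mul_tmul_mul_toCofree (u v : A) (w : A ⊗[k] A) :
    𝔸.toCofree Algebra.TensorProduct.includeLeft u * (t ⊗ₜ[k] w) *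
      𝔸.toCofree (Algebra.TensorProduct.includeRight.comp
        (𝔸.twist h.modular.compAntipode)) v = t ⊗ₜ[k] ((u ⊗ₜ[k] 1) * w * (1 ⊗ₜ[k] v)) := by
  rw [h.toCofree_mul_tmul, h.tmul_mul_toCofree]
  simp only [AlgHom.comp_apply, twist_compAntipode_twist, Algebra.TensorProduct.includeLeft_apply,
    Algebra.TensorProduct.includeRight_apply]

variable [Module.Finite k A]

/-- Acting on the generator produces all `t ⊗ u ⊗ v`, and slicing `Δ(t)` by `μ(S(q) -)` turns `t`
into any `q`. So the generator generates, which gives uniqueness of morphisms out of the free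
object. -/
theorem freeLift_gen_gen (p : H ⊗[k] (A ⊗[k] A)) :
    (RelHopfBimod.free 𝔸 h.modular.compAntipode).freeLift μ (h.gen A) p = p := by
  induction p with
  | zero => exact map_zero _
  | add x y hx hy => exact (map_add _ _ _).trans (congrArg₂ _ hx hy)
  | tmul q w =>
    induction w with
    | zero => rw [TensorProduct.tmul_zero]; exact map_zero _
    | add x y hx hy =>
      rw [TensorProduct.tmul_add]
      exact (map_add _ _ _).trans (congrArg₂ _ hx hy)
    | tmul u v =>
      rw [free_freeLift_tmul, gen, h.toCofree_mul_tmul_mul_toCofree,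
        ← Algebra.TensorProduct.one_def, sliceLeft_cofree_coact,
        h.sliceLeft_antipode_comul, mul_one, Algebra.TensorProduct.tmul_mul_tmul, mul_one,
        one_mul]

/-- The form `ε ⊗ l ⊗ l` composed with the endomorphism of the free module sending the generator
to `t ⊗ w`. -/
theorem counitSquareForm_freeLift_tmul (l : A →ₗ[k] k) (w : A ⊗[k] A) (q : H) (u v : A) :
    counitSquareForm k H l ((RelHopfBimod.free 𝔸 h.modular.compAntipode).freeLift μ (t ⊗ₜ[k] w)
      (q ⊗ₜ[k] (u ⊗ₜ[k] v))) =
      Coalgebra.counit (R := k) q * tensorSquareForm l ((u ⊗ₜ[k] 1) * w * (1 ⊗ₜ[k] v)) := by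
  rw [free_freeLift_tmul, h.toCofree_mul_tmul_mul_toCofree, counitSquareForm,
    LinearMap.comp_apply, sliceLeft_counit_sliceLeft_cofree_coact, sliceLeft_tmul,
    traceMap_apply, h.apply_mul, counit_antipode, map_smul, smul_eq_mul]

/-- Only the first tensor factor of `A ⊗ A` matters, where `l(u a) = l(ν(a) u)`. This moves an
endomorphism of the free object to a left multiplication. -/
theorem counitSquareForm_freeLift_left {l : A →ₗ[k] k} (hF : IsFrobeniusTrace l) (a : A)
    (p : H ⊗[k] (A ⊗[k] A)) :
    counitSquareForm k H l ((RelHopfBimod.free 𝔸 h.modular.compAntipode).freeLift μ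
      (t ⊗ₜ[k] (a ⊗ₜ[k] 1)) p) =
      counitSquareForm k H l
        (𝔸.toCofree Algebra.TensorProduct.includeLeft (hF.nakayama a) * p) := by
  refine LinearMap.congr_fun (f := counitSquareForm k H l ∘ₗ
    (RelHopfBimod.free 𝔸 h.modular.compAntipode).freeLift μ (t ⊗ₜ[k] (a ⊗ₜ[k] 1)))
    (g := counitSquareForm k H l ∘ₗ LinearMap.mulLeft k
    (𝔸.toCofree Algebra.TensorProduct.includeLeft (hF.nakayama a))) ?_ p
  refine TensorProduct.ext' fun q w => ?_
  induction w with
  | zero => simp only [TensorProduct.tmul_zero, map_zero]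
  | add x y hx hy => simp only [map_add, TensorProduct.tmul_add, hx, hy]
  | tmul u v =>
    refine (h.counitSquareForm_freeLift_tmul 𝔸 l _ q u v).trans ?_
    rw [LinearMap.comp_apply, LinearMap.mulLeft_apply, counitSquareForm, LinearMap.comp_apply,
      sliceLeft_counit_mul, sliceLeft_counit_toCofree]
    simp [hF.apply_nakayama_mul a u]

/-- In the second tensor factor `l(b v) = l(v ν⁻¹(b))`. The extra `τ` compensates for the twist in
the right action; it is the source of `τ` in `ν⁻¹ τ ν⁻¹`. -/
theorem counitSquareForm_freeLift_right {l : A →ₗ[k] k} (hF : IsFrobeniusTrace l) (b : A)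
    (p : H ⊗[k] (A ⊗[k] A)) :
    counitSquareForm k H l ((RelHopfBimod.free 𝔸 h.modular.compAntipode).freeLift μ
      (t ⊗ₜ[k] (1 ⊗ₜ[k] b)) p) =
      counitSquareForm k H l (p * 𝔸.toCofree (Algebra.TensorProduct.includeRight.comp
        (𝔸.twist h.modular.compAntipode))
        (𝔸.twist h.modular (hF.nakayamaEquiv.symm b))) := by
  refine LinearMap.congr_fun (f := counitSquareForm k H l ∘ₗ
    (RelHopfBimod.free 𝔸 h.modular.compAntipode).freeLift μ (t ⊗ₜ[k] (1 ⊗ₜ[k] b)))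
    (g := counitSquareForm k H l ∘ₗ LinearMap.mulRight k
    (𝔸.toCofree (Algebra.TensorProduct.includeRight.comp
        (𝔸.twist h.modular.compAntipode))
        (𝔸.twist h.modular (hF.nakayamaEquiv.symm b)))) ?_ p
  refine TensorProduct.ext' fun q w => ?_
  induction w with
  | zero => simp only [TensorProduct.tmul_zero, map_zero]
  | add x y hx hy => simp only [map_add, TensorProduct.tmul_add, hx, hy]
  | tmul u v =>
    refine (h.counitSquareForm_freeLift_tmul 𝔸 l _ q u v).trans ?_
    rw [LinearMap.comp_apply, LinearMap.mulRight_apply, counitSquareForm, LinearMap.comp_apply,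
      sliceLeft_counit_mul, sliceLeft_counit_toCofree, AlgHom.comp_apply,
      twist_compAntipode_twist]
    have h1 := hF.apply_nakayama_mul (hF.nakayamaEquiv.symm b) v
    rw [← hF.nakayamaEquiv_apply, AlgEquiv.apply_symm_apply] at h1
    simp [h1]

/-- Source of `g⁻² g_H`. On `q ⊗ u ⊗ v` each copy of `l` replaces a coaction leg by `g`, leaving
`μ(S(q) g y g)` with `y = ω(t₍₁₎) t₍₂₎`, up to scalars. Moving the last `g` to the front costs
`α(g)`, which cancels `α(S(g))`, and `t₍₁₎ μ(c t₍₂₎) = S(c) g_H` gives `g⁻¹ S²(q) g⁻¹ g_H`. -/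
theorem counitSquareForm_freeLift_slice {𝔸 : LeftComoduleAlgebra k H A} {l : A →ₗ[k] k}
    {g : GroupLike k H} (hl : IsGrouplikeCointegral 𝔸 g l) (ω : H →ₗ[k] k)
    (p : H ⊗[k] (A ⊗[k] A)) :
    counitSquareForm k H l ((RelHopfBimod.free 𝔸 h.modular.compAntipode).freeLift μ
      (sliceLeft H ω (Coalgebra.comul (R := k) t) ⊗ₜ[k] (1 ⊗ₜ[k] 1)) p) =
      ω (((g⁻¹ : GroupLike k H) : H) * antipodeSq k H (sliceRight (tensorSquareForm l) p) *
        ((g⁻¹ * h.grouplike : GroupLike k H) : H)) := by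
  refine LinearMap.congr_fun (f := counitSquareForm k H l ∘ₗ
    (RelHopfBimod.free 𝔸 h.modular.compAntipode).freeLift μ
      (sliceLeft H ω (Coalgebra.comul (R := k) t) ⊗ₜ[k] (1 ⊗ₜ[k] 1)))
    (g := ω ∘ₗ LinearMap.mulRight k ((g⁻¹ * h.grouplike : GroupLike k H) : H) ∘ₗ
      LinearMap.mulLeft k ((g⁻¹ : GroupLike k H) : H) ∘ₗ antipodeSq k H ∘ₗ
      sliceRight (tensorSquareForm l)) ?_ p
  refine TensorProduct.ext' fun q w => ?_
  induction w with
  | zero => simp only [TensorProduct.tmul_zero, map_zero]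
  | add x y hx hy => simp only [map_add, TensorProduct.tmul_add, hx, hy]
  | tmul u v =>
    have h1 := 𝔸.sliceLeft_toCofree_mul_mul Algebra.TensorProduct.includeLeft
      (Algebra.TensorProduct.includeRight.comp (𝔸.twist h.modular.compAntipode))
      (traceMap μ (antipode k q)) (tensorSquareForm l) l
      (l ∘ₗ (𝔸.twist h.modular.compAntipode).toLinearMap) (fun a b => by simp)
      (sliceLeft H ω (Coalgebra.comul (R := k) t)) u v
    refine (congrArg (counitSquareForm k H l) (free_freeLift_tmul 𝔸 _ _ q u v)).trans ?_
    rw [counitSquareForm, LinearMap.comp_apply, sliceLeft_counit_sliceLeft_cofree_coact]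
    refine h1.trans ?_
    have h2 : h.modular (g : H) * h.modular.compAntipode (g : H) = 1 := by
      rw [AlgHom.compAntipode_apply, ← GroupLike.val_inv, ← map_mul, g.val_mul_val_inv, map_one]
    have h3 := congrArg ω
      (h.sliceRight_traceMap_comul ((g : H) * (antipode k q * (g : H))))
    rw [apply_sliceRight, traceMap_apply, antipode_mul_antidistrib, antipode_mul_antidistrib,
      ← GroupLike.val_inv] at h3
    have h4 := h.apply_mul_grouplike g
      (antipode k q * (g * sliceLeft H ω (Coalgebra.comul (R := k) t)))
    rw [hl.sliceRight_coact, hl.sliceRight_twist, traceMap_apply]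
    simp only [smul_mul_assoc, mul_smul_comm, LinearMap.comp_apply, sliceRight_tmul, map_smul, tensorSquareForm_tmul,
      LinearMap.mulLeft_apply, LinearMap.mulRight_apply, antipodeSq_apply, GroupLike.val_mul,
      smul_eq_mul]
    simp only [mul_assoc] at h3 h4 ⊢
    rw [h4, h3]
    linear_combination (l u * l v * ω (((g⁻¹ : GroupLike k H) : H) * (antipode k (antipode k q) *
      (((g⁻¹ : GroupLike k H) : H) * (h.grouplike : H))))) * h2

end IsDualIntegral

end FreeForms

/-! ## The Nakayama functor in terms of a free generator -/

section NakayamaOfGenerator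

variable {k H A : Type u} [Field k] [Ring H] [HopfAlgebra k H] [Ring A] [Algebra k A]

namespace RelHopfBimod

variable {𝔸 : LeftComoduleAlgebra k H A}

theorem toLin_actL {X Y : RelHopfBimod 𝔸} (f : X ⟶ Y) (a : A) (x : X.carrier) :
    toLin f (X.actL a x) = Y.actL a (toLin f x) := f.2.2.1 a x

theorem toLin_actR {X Y : RelHopfBimod 𝔸} (f : X ⟶ Y) (x : X.carrier) (a : A) :
    toLin f (X.actR x a) = Y.actR (toLin f x) a := f.2.2.2 x a

theorem coact_toLin {X Y : RelHopfBimod 𝔸} (f : X ⟶ Y) (x : X.carrier) :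
    Y.coact (toLin f x) = (toLin f).lTensor H (X.coact x) := f.2.1 x

theorem toLin_sliceLeft_coact {X Y : RelHopfBimod 𝔸} (f : X ⟶ Y) (ω : H →ₗ[k] k)
    (x : X.carrier) : toLin f (sliceLeft X.carrier ω (X.coact x)) =
      sliceLeft Y.carrier ω (Y.coact (toLin f x)) := by
  rw [coact_toLin, sliceLeft_lTensor]

theorem toLin_comp_apply {X Y Z : RelHopfBimod 𝔸} (f : X ⟶ Y) (g : Y ⟶ Z) (x : X.carrier) :
    toLin (f ≫ g) x = toLin g (toLin f x) := rfl

/-- A morphism of relative Hopf bimodules from a linear map. -/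
def homMk {X Y : RelHopfBimod 𝔸} (f : X.carrier →ₗ[k] Y.carrier)
    (hL : ∀ a x, f (X.actL a x) = Y.actL a (f x)) (hR : ∀ x a, f (X.actR x a) = Y.actR (f x) a)
    (hC : ∀ ω x, f (sliceLeft X.carrier ω (X.coact x)) = sliceLeft Y.carrier ω (Y.coact (f x))) :
    X ⟶ Y :=
  ⟨f, fun x => tensor_ext_sliceLeft fun ω => by rw [sliceLeft_lTensor, hC], hL, hR⟩

/-- `r` exhibits `P` as a free relative Hopf bimodule on the generator `e`. -/
structure IsFree (P : RelHopfBimod 𝔸) (e : P.carrier)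
    (r : ∀ X : RelHopfBimod 𝔸, X.carrier →ₗ[k] (P ⟶ X)) : Prop where
  apply_gen : ∀ X x, toLin (r X x) e = x
  hom_ext : ∀ {X} {f f' : P ⟶ X}, toLin f e = toLin f' e → f = f'

/-- The map `Hom(M, X)^* → Hom(M, Y)^*` induced by `f : Y ⟶ X`. -/
noncomputable def dualComp (M : RelHopfBimod 𝔸) {Y X : RelHopfBimod 𝔸} (f : Y ⟶ X) :
    Module.Dual k (M ⟶ X) →ₗ[k] Module.Dual k (M ⟶ Y) :=
  (Linear.rightComp k M f).dualMap

theorem dualComp_apply (M : RelHopfBimod 𝔸) {Y X : RelHopfBimod 𝔸} (f : Y ⟶ X)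
    (φ : Module.Dual k (M ⟶ X)) (u : M ⟶ Y) : dualComp M f φ u = φ (u ≫ f) := rfl

section Copower

variable {V : Type u} [AddCommGroup V] [Module k V] [Module.Finite k V] {X N : RelHopfBimod 𝔸}

/-- Morphisms out of a copower from bilinear maps. -/
noncomputable def copowerLift (b : V →ₗ[k] X.carrier →ₗ[k] N.carrier)
    (hL : ∀ v a x, b v (X.actL a x) = N.actL a (b v x))
    (hR : ∀ v x a, b v (X.actR x a) = N.actR (b v x) a)
    (hC : ∀ v ω x, b v (sliceLeft X.carrier ω (X.coact x)) =
      sliceLeft N.carrier ω (N.coact (b v x))) : copower V X ⟶ N :=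
  homMk (TensorProduct.lift b)
    (fun a => LinearMap.congr_fun (f := TensorProduct.lift b ∘ₗ (X.actL a).lTensor V)
      (g := N.actL a ∘ₗ TensorProduct.lift b) (TensorProduct.ext' fun v x => by simp [hL]))
    (fun z a => LinearMap.congr_fun (f := TensorProduct.lift b ∘ₗ (X.actR.flip a).lTensor V)
      (g := N.actR.flip a ∘ₗ TensorProduct.lift b) (TensorProduct.ext' fun v x => by simp [hR]) z)
    (fun ω => LinearMap.congr_fun (f := TensorProduct.lift b ∘ₗ sliceLeft (V ⊗[k] X.carrier) ω ∘ₗ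
        (TensorProduct.leftComm k V H X.carrier).toLinearMap ∘ₗ X.coact.lTensor V)
      (g := sliceLeft N.carrier ω ∘ₗ N.coact ∘ₗ TensorProduct.lift b)
      (TensorProduct.ext' fun v x => by
        simp only [LinearMap.comp_apply, LinearMap.lTensor_tmul, LinearEquiv.coe_coe,
          TensorProduct.lift.tmul]
        rw [← hC]
        induction X.coact x with
        | zero => simp
        | add x y hx hy => simp only [map_add, TensorProduct.tmul_add, hx, hy]
        | tmul q m => simp))

theorem copowerLift_tmul (b : V →ₗ[k] X.carrier →ₗ[k] N.carrier) (hL hR hC) (v : V)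
    (x : X.carrier) : toLin (copowerLift b hL hR hC) (v ⊗ₜ[k] x) = b v x :=
  TensorProduct.lift.tmul _ _

theorem copower_hom_ext {f f' : copower V X ⟶ N}
    (h : ∀ v x, toLin f (v ⊗ₜ[k] x) = toLin f' (v ⊗ₜ[k] x)) : f = f' :=
  Subtype.ext (TensorProduct.ext' h)

theorem copower_sliceLeft_coact (ω : H →ₗ[k] k) (v : V) (x : X.carrier) :
    sliceLeft (V ⊗[k] X.carrier) ω ((copower V X).coact (v ⊗ₜ[k] x)) =
      v ⊗ₜ[k] sliceLeft X.carrier ω (X.coact x) := by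
  change sliceLeft (V ⊗[k] X.carrier) ω
    (TensorProduct.leftComm k V H X.carrier (v ⊗ₜ[k] X.coact x)) = _
  induction X.coact x with
  | zero => simp
  | add x y hx hy => simp only [map_add, TensorProduct.tmul_add, hx, hy]
  | tmul q m => simp

end Copower

/-! ### The Nakayama coend computed from a free generator -/

namespace IsFree

variable {P : RelHopfBimod 𝔸} {e : P.carrier}
  {r : ∀ X : RelHopfBimod 𝔸, X.carrier →ₗ[k] (P ⟶ X)} (hP : IsFree P e r)
  {M N : RelHopfBimod 𝔸} (ψ : N.carrier ≃ₗ[k] Module.Dual k (M ⟶ P))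

include hP in
theorem comp_eq {X Y : RelHopfBimod 𝔸} (f : X ⟶ Y) (x : X.carrier) :
    r X x ≫ f = r Y (toLin f x) :=
  hP.hom_ext (by rw [toLin_comp_apply, hP.apply_gen, hP.apply_gen])

include hP in
theorem dualComp_dualComp {X Y : RelHopfBimod 𝔸} (f : X ⟶ Y) (x : X.carrier)
    (φ : Module.Dual k (M ⟶ Y)) :
    dualComp M (r X x) (dualComp M f φ) = dualComp M (r Y (toLin f x)) φ := by
  ext u
  rw [dualComp_apply, dualComp_apply, dualComp_apply, Category.assoc, hP.comp_eq]

include hP in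
theorem dualComp_gen (φ : Module.Dual k (M ⟶ P)) : dualComp M (r P e) φ = φ := by
  have h1 : r P e = 𝟙 P := hP.hom_ext (hP.apply_gen P e)
  ext u
  rw [dualComp_apply, h1, Category.comp_id]

/-- The components `Hom(M, X)^* × X → N` of the cowedge, as bilinear maps. -/
noncomputable def cowedgeBilin (r : ∀ X : RelHopfBimod 𝔸, X.carrier →ₗ[k] (P ⟶ X))
    (ψ : N.carrier ≃ₗ[k] Module.Dual k (M ⟶ P)) (X : RelHopfBimod 𝔸) :
    Module.Dual k (M ⟶ X) →ₗ[k] X.carrier →ₗ[k] N.carrier :=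
  LinearMap.mk₂ k (fun φ x => ψ.symm (dualComp M (r X x) φ))
    (fun _ _ _ => by rw [map_add, map_add])
    (fun _ _ _ => by rw [map_smul, map_smul])
    (fun φ x y => by
      rw [← map_add]
      congr 1
      ext u
      rw [LinearMap.add_apply, dualComp_apply, dualComp_apply, dualComp_apply, map_add,
        Preadditive.comp_add, map_add])
    (fun c φ x => by
      rw [← map_smul]
      congr 1
      ext u
      rw [LinearMap.smul_apply, dualComp_apply, dualComp_apply, map_smul,
        Linear.comp_smul, map_smul])

theorem apply_cowedgeBilin (X : RelHopfBimod 𝔸) (φ : Module.Dual k (M ⟶ X)) (x : X.carrier) :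
    ψ (cowedgeBilin r ψ X φ x) = dualComp M (r X x) φ :=
  ψ.apply_symm_apply _

include hP in
/-- Let `P` be free on `e`. If the actions and the coaction of `N` correspond under
`N ≃ Hom(M, P)^*` to the endomorphisms of `P` determined by those on the generator, then `N` is
the value at `M` of the Nakayama functor. -/
theorem isNakayama_iff (hL : ∀ a y, ψ (N.actL a y) = dualComp M (r P (P.actL a e)) (ψ y))
    (hR : ∀ y a, ψ (N.actR y a) = dualComp M (r P (P.actR e a)) (ψ y))
    (hC : ∀ ω y, ψ (sliceLeft N.carrier ω (N.coact y)) =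
      dualComp M (r P (sliceLeft P.carrier ω (P.coact e))) (ψ y)) (N' : RelHopfBimod 𝔸) :
    IsNakayama M N' ↔ Nonempty (N ≅ N') := by
  let ι (X : RelHopfBimod 𝔸) : copower (Module.Dual k (M ⟶ X)) X ⟶ N :=
    copowerLift (cowedgeBilin r ψ X)
      (fun φ a x => ψ.injective <| by
        rw [hL, apply_cowedgeBilin, apply_cowedgeBilin, hP.dualComp_dualComp, toLin_actL,
          hP.apply_gen])
      (fun φ x a => ψ.injective <| by
        rw [hR, apply_cowedgeBilin, apply_cowedgeBilin, hP.dualComp_dualComp, toLin_actR,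
          hP.apply_gen])
      (fun φ ω x => ψ.injective <| by
        rw [hC, apply_cowedgeBilin, apply_cowedgeBilin, hP.dualComp_dualComp,
          toLin_sliceLeft_coact, hP.apply_gen])
  have hι : ∀ X (φ : Module.Dual k (M ⟶ X)) (x : X.carrier),
      ψ (toLin (ι X) (φ ⊗ₜ[k] x)) = dualComp M (r X x) φ := fun X φ x =>
    (congrArg ψ (copowerLift_tmul _ _ _ _ φ x)).trans (apply_cowedgeBilin ψ X φ x)
  let c : Limits.Cowedge (nakayamaIntegrand M) := Limits.Cowedge.mk N ι fun X Y f =>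
    copower_hom_ext (V := Module.Dual k (M ⟶ Y)) fun φ x => ψ.injective <|
      (hι X (dualComp M f φ) x).trans <| (hP.dualComp_dualComp f x φ).trans
        (hι Y φ (toLin f x)).symm
  -- the two consequences of dinaturality
  have hs : ∀ (s : Limits.Cowedge (nakayamaIntegrand M)) {X Y : RelHopfBimod 𝔸} (f : X ⟶ Y)
      (φ : Module.Dual k (M ⟶ Y)) (x : X.carrier),
      toLin (s.π X) (dualComp M f φ ⊗ₜ[k] x) = toLin (s.π Y) (φ ⊗ₜ[k] toLin f x) := by
    intro s X Y f φ x
    exact congrArg (fun g => toLin g (φ ⊗ₜ[k] x)) (s.condition f)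
  -- Dinaturality along `r X x : P ⟶ X` rewrites `φ ⊗ x` in the component at `X` as an element of
  -- the form `φ' ⊗ e` in the component at `P`. A cowedge is thus determined by its component at `P`
  -- on the generator, which dictates the descended map.
  let d (s : Limits.Cowedge (nakayamaIntegrand M)) : N ⟶ s.pt :=
    homMk (toLin (s.π P) ∘ₗ (TensorProduct.mk k (Module.Dual k (M ⟶ P)) P.carrier).flip e ∘ₗ
      ψ.toLinearMap)
      (fun a y => by
        change toLin (s.π P) (ψ _ ⊗ₜ[k] e) = s.pt.actL a (toLin (s.π P) (ψ y ⊗ₜ[k] e))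
        rw [hL, hs, hP.apply_gen]
        exact toLin_actL (s.π P) a (ψ y ⊗ₜ[k] e))
      (fun y a => by
        change toLin (s.π P) (ψ _ ⊗ₜ[k] e) = s.pt.actR (toLin (s.π P) (ψ y ⊗ₜ[k] e)) a
        rw [hR, hs, hP.apply_gen]
        exact toLin_actR (s.π P) (ψ y ⊗ₜ[k] e) a)
      (fun ω y => by
        change toLin (s.π P) (ψ _ ⊗ₜ[k] e) =
          sliceLeft _ ω (s.pt.coact (toLin (s.π P) (ψ y ⊗ₜ[k] e)))
        rw [hC, hs, hP.apply_gen, ← copower_sliceLeft_coact]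
        exact toLin_sliceLeft_coact (s.π P) ω (ψ y ⊗ₜ[k] e))
  have hd : ∀ s y, toLin (d s) y = toLin (s.π P) (ψ y ⊗ₜ[k] e) := fun _ _ => rfl
  have hc : Limits.IsColimit c := Limits.Multicofork.IsColimit.mk c d
    (fun s (X : RelHopfBimod 𝔸) => copower_hom_ext (V := Module.Dual k (M ⟶ X)) fun φ x => by
      change toLin (d s) (toLin (ι X) (φ ⊗ₜ[k] x)) = _
      rw [hd, hι, hs, hP.apply_gen]
      rfl)
    (fun s m hm => Subtype.ext <| LinearMap.ext fun (y : N.carrier) => by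
      have h1 : toLin (ι P) (ψ y ⊗ₜ[k] e) = y := ψ.injective <| by rw [hι, hP.dualComp_gen]
      exact (congrArg (toLin m) h1.symm).trans
        ((congrArg (fun g => toLin g (ψ y ⊗ₜ[k] e)) (hm P)).trans (hd s y).symm))
  constructor
  · rintro ⟨c', ⟨hc'⟩, ⟨i⟩⟩
    exact ⟨hc.coconePointUniqueUpToIso hc' ≪≫ i⟩
  · intro hi
    exact ⟨c, ⟨hc⟩, hi⟩

end IsFree

end RelHopfBimod

end NakayamaOfGenerator

/-! ## The Nakayama functor at the unit object -/

section NakayamaOfUnit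

open HopfAlgebra LeftComoduleAlgebra

variable {k H A : Type u} [Field k] [Ring H] [HopfAlgebra k H] [Ring A] [Algebra k A]

theorem sliceRight_mul_tmul_one {M : Type u} [Ring M] [Algebra k M] (φ : M →ₗ[k] k) (y : H)
    (z : H ⊗[k] M) : sliceRight φ (z * (y ⊗ₜ[k] 1)) = sliceRight φ z * y := by
  induction z with
  | zero => simp
  | add x y hx hy => simp only [map_add, add_mul, hx, hy]
  | tmul p q => simp

namespace LeftComoduleAlgebra

variable {C : Type u} [Ring C] [Algebra k C]

theorem lTensor_sliceLeft_counit_cofree_coact (z : H ⊗[k] C) :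
    (sliceLeft C (Coalgebra.counit (R := k))).lTensor H ((cofree k H C).coact z) = z := by
  induction z with
  | zero => simp
  | add x y hx hy => simp only [map_add, hx, hy]
  | tmul q c =>
    rw [cofree_coact, LinearMap.rTensor_tmul]
    have h1 := congrArg (TensorProduct.rid k H) (Coalgebra.lTensor_counit_comul (R := k) q)
    rw [TensorProduct.rid_tmul, one_smul] at h1
    conv_rhs => rw [← h1]
    induction Coalgebra.comul (R := k) q with
    | zero => simp
    | add x y hx hy => simp only [map_add, TensorProduct.add_tmul, hx, hy]
    | tmul p q => simp [TensorProduct.smul_tmul]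

theorem sliceRight_cofree_coact (ℓ : C →ₗ[k] k) (z : H ⊗[k] C) :
    sliceRight (ℓ ∘ₗ sliceLeft C (Coalgebra.counit (R := k))) ((cofree k H C).coact z) =
      sliceRight ℓ z := by
  rw [← sliceRight_lTensor, lTensor_sliceLeft_counit_cofree_coact]

end LeftComoduleAlgebra

/-! ### Dual bases and twisted Casimir elements -/

namespace IsFrobeniusTrace

variable [Module.Finite k A] {l : A →ₗ[k] k} (hF : IsFrobeniusTrace l)
include hF

theorem exists_dual_bases : ∃ (n : ℕ) (b e : Fin n → A),
    (∀ c, ∑ i, l (c * e i) • b i = c) ∧ ∀ x, ∑ i, l (b i * x) • e i = x := by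
  let b := Module.finBasis k A
  choose e he using fun i => hF.bijective_flip.2 (b.coord i)
  have h1 : ∀ c, ∑ i, l (c * e i) • b i = c := by
    intro c
    conv_rhs => rw [← b.sum_repr c]
    exact Finset.sum_congr rfl fun i _ => congrArg (· • b i) (LinearMap.congr_fun (he i) c)
  refine ⟨_, b, e, h1, fun x => hF.eq_of_mul_left fun c => ?_⟩
  conv_rhs => rw [← h1 c]
  simp [Finset.mul_sum, Finset.sum_mul, mul_comm]

/-- The forms `l(a -)` and `l(- b)` include all coordinate forms of a basis of `A`, so their
products include all coordinates on `A ⊗ A`. -/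
theorem eq_zero_of_tensorSquareForm {w : A ⊗[k] A}
    (hw : ∀ a b, tensorSquareForm l ((a ⊗ₜ[k] 1) * w * (1 ⊗ₜ[k] b)) = 0) : w = 0 := by
  let B := Module.finBasis k A
  apply (B.tensorProduct B).repr.injective
  ext ⟨i, j⟩
  obtain ⟨a, ha⟩ := hF.2 (B.coord i)
  obtain ⟨b, hb⟩ := hF.bijective_flip.2 (B.coord j)
  have h1 : ∀ w : A ⊗[k] A, (B.tensorProduct B).repr w (i, j) =
      tensorSquareForm l ((a ⊗ₜ[k] 1) * w * (1 ⊗ₜ[k] b)) := by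
    intro w
    induction w with
    | zero => simp
    | add x y hx hy => simp only [map_add, mul_add, add_mul, Finsupp.add_apply, hx, hy]
    | tmul u v =>
      have h2 : B.repr u i = l (a * u) := (LinearMap.congr_fun ha u).symm
      have h3 : B.repr v j = l (v * b) := (LinearMap.congr_fun hb v).symm
      simp [h2, h3, mul_comm]
  rw [h1, hw, map_zero, Finsupp.zero_apply]

/-- A Casimir element twisted by an algebra endomorphism. -/
theorem exists_casimir (χ : A →ₐ[k] A) (s : A) : ∃ w : A ⊗[k] A,
    (∀ b, (b ⊗ₜ[k] 1) * w = w * (1 ⊗ₜ[k] χ b)) ∧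
      ∀ m, tensorSquareForm l ((m ⊗ₜ[k] 1) * w) = l (s * χ m) := by
  obtain ⟨n, b, e, hb, he⟩ := hF.exists_dual_bases
  -- For `s = 1` and `χ = id` this is the usual Casimir element of the dual bases. The factor `s`,
  -- placed to the left of `χ`, leaves the commutation rule intact and prescribes the resulting
  -- form.
  refine ⟨∑ i, e i ⊗ₜ[k] (s * χ (b i)), fun c => ?_, fun m => ?_⟩
  · have h1 : ∀ i, c * e i = ∑ j, l (b j * c * e i) • e j := fun i => by
      conv_lhs => rw [← he (c * e i)]
      simp only [mul_assoc]
    have h2 : ∀ j, b j * c = ∑ i, l (b j * c * e i) • b i := fun j => (hb _).symm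
    rw [Finset.mul_sum, Finset.sum_mul]
    simp only [Algebra.TensorProduct.tmul_mul_tmul, one_mul, mul_one, mul_assoc, ← map_mul]
    calc ∑ i, (c * e i) ⊗ₜ[k] (s * χ (b i))
        = ∑ i, ∑ j, l (b j * c * e i) • (e j ⊗ₜ[k] (s * χ (b i))) := by
          refine Finset.sum_congr rfl fun i _ => ?_
          conv_lhs => rw [h1 i, TensorProduct.sum_tmul]
          simp only [TensorProduct.smul_tmul']
      _ = ∑ j, ∑ i, l (b j * c * e i) • (e j ⊗ₜ[k] (s * χ (b i))) := Finset.sum_comm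
      _ = ∑ j, e j ⊗ₜ[k] (s * χ (b j * c)) := by
          refine Finset.sum_congr rfl fun j _ => ?_
          conv_rhs => rw [h2 j]
          simp only [map_sum, map_smul, Finset.mul_sum, mul_smul_comm, TensorProduct.tmul_sum,
            TensorProduct.tmul_smul]
  · conv_rhs => rw [← hb m]
    simp [Finset.mul_sum]

end IsFrobeniusTrace

namespace IsDualIntegral

variable [Module.Finite k H] [Module.Finite k A] {μ : H →ₗ[k] k} {t : H}
  (h : IsDualIntegral μ t) {𝔸 : LeftComoduleAlgebra k H A}

/-- The linear map `x ↦ (t ⊗ 1 ⊗ 1 ↦ x)`. -/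
noncomputable def freeHomLin (X : RelHopfBimod 𝔸) :
    X.carrier →ₗ[k] (RelHopfBimod.free 𝔸 h.modular.compAntipode ⟶ X) where
  toFun := h.freeHom X
  map_add' x y := by
    have h1 : X.freeLift μ (x + y) = X.freeLift μ x + X.freeLift μ y :=
      TensorProduct.ext' fun q w => by
        induction w with
        | zero => simp
        | add x y hx hy => simp only [map_add, TensorProduct.tmul_add, hx, hy]
        | tmul u v => simp
    exact Subtype.ext h1
  map_smul' c x := by
    have h1 : X.freeLift μ (c • x) = c • X.freeLift μ x :=
      TensorProduct.ext' fun q w => by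
        induction w with
        | zero => simp
        | add x y hx hy => simp only [map_add, TensorProduct.tmul_add, hx, hy]
        | tmul u v => simp
    exact Subtype.ext h1

theorem isFree (𝔸 : LeftComoduleAlgebra k H A) :
    RelHopfBimod.IsFree (RelHopfBimod.free 𝔸 h.modular.compAntipode) (h.gen A)
      h.freeHomLin where
  apply_gen X x := h.freeLift_gen X x
  hom_ext {X f f'} hff := by
    have key : ∀ (f : RelHopfBimod.free 𝔸 h.modular.compAntipode ⟶ X) (p : H ⊗[k] (A ⊗[k] A)),
        RelHopfBimod.toLin f p = X.freeLift μ (RelHopfBimod.toLin f (h.gen A)) p := fun f p =>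
      (congrArg (RelHopfBimod.toLin f) (h.freeLift_gen_gen 𝔸 p)).symm.trans
        (LinearMap.congr_fun (RelHopfBimod.toLin_comp_freeLift μ f (h.gen A)) p)
    exact Subtype.ext <| LinearMap.ext fun p => (key f p).trans <| by rw [hff]; exact (key f' p).symm

end IsDualIntegral

/-! ### Morphisms from the unit object to the free object -/

namespace RelHopfBimod

variable [Module.Finite k H] [Module.Finite k A] {𝔸 : LeftComoduleAlgebra k H A} {χ : H →ₐ[k] k}

/-- The linear map underlying a morphism from the unit object to the free object. -/
noncomputable def unitFreeLin : (unit 𝔸 ⟶ free 𝔸 χ) →ₗ[k] A →ₗ[k] H ⊗[k] (A ⊗[k] A) where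
  toFun f := toLin f
  map_add' _ _ := rfl
  map_smul' _ _ := rfl

theorem toCofree_mul_unitFreeLin (f : unit 𝔸 ⟶ free 𝔸 χ) (a b : A) :
    𝔸.toCofree Algebra.TensorProduct.includeLeft a * unitFreeLin f b =
      unitFreeLin f (a * b) :=
  (toLin_actL f a b).symm

theorem unitFreeLin_mul_toCofree (f : unit 𝔸 ⟶ free 𝔸 χ) (a b : A) :
    unitFreeLin f a * 𝔸.toCofree (Algebra.TensorProduct.includeRight.comp (𝔸.twist χ)) b =
      unitFreeLin f (a * b) :=
  (toLin_actR f a b).symm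

theorem cofree_coact_unitFreeLin (f : unit 𝔸 ⟶ free 𝔸 χ) (a : A) :
    (cofree k H (A ⊗[k] A)).coact (unitFreeLin f a) =
      (unitFreeLin f).lTensor H (𝔸.coact a) :=
  (free_coact 𝔸 χ _).symm.trans (coact_toLin f a)

theorem unitFreeLin_injective :
    Function.Injective (unitFreeLin (𝔸 := 𝔸) (χ := χ)) :=
  fun _ _ hf => Subtype.ext hf

/-- The unit of `A` is coinvariant, and the coinvariants of the cofree comodule `H ⊗ C` are `1 ⊗ C`.
-/
theorem unitFreeLin_one (f : unit 𝔸 ⟶ free 𝔸 χ) :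
    unitFreeLin f 1 =
      1 ⊗ₜ[k] sliceLeft (A ⊗[k] A) (Coalgebra.counit (R := k)) (unitFreeLin f 1) := by
  have h1 := congrArg ((sliceLeft (A ⊗[k] A) (Coalgebra.counit (R := k))).lTensor H)
    (cofree_coact_unitFreeLin f 1)
  rw [lTensor_sliceLeft_counit_cofree_coact, map_one 𝔸.coact, Algebra.TensorProduct.one_def,
    LinearMap.lTensor_tmul, LinearMap.lTensor_tmul] at h1
  exact h1

/-- The linear map `f ↦ (ε ⊗ l ⊗ l) ∘ f` on `Hom(A, P)`, where `P` is the free relative Hopf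
bimodule. -/
noncomputable def homForm (l : A →ₗ[k] k) (𝔸 : LeftComoduleAlgebra k H A) (χ : H →ₐ[k] k) :
    (unit 𝔸 ⟶ free 𝔸 χ) →ₗ[k] Module.Dual k A :=
  (counitSquareForm k H l).compRight k ∘ₗ unitFreeLin

theorem homForm_apply (l : A →ₗ[k] k) (f : unit 𝔸 ⟶ free 𝔸 χ) (a : A) :
    homForm l 𝔸 χ f a = counitSquareForm k H l (unitFreeLin f a) := rfl

/-- If `f(1) = 1 ⊗ w`, then `ε ⊗ l ⊗ l` at `f(a b)` is `l ⊗ l` at `(a ⊗ 1) w (1 ⊗ χ(b₍₋₁₎) b₍₀₎)`.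
As the twist is surjective, nondegeneracy gives `w = 0`, and `f` is determined by `f(1)`. -/
theorem homForm_injective {l : A →ₗ[k] k} (hF : IsFrobeniusTrace l)
    (hχ : Function.Surjective (𝔸.twist χ)) : Function.Injective (homForm l 𝔸 χ) := by
  rw [injective_iff_map_eq_zero]
  intro f hf
  have hw : sliceLeft (A ⊗[k] A) (Coalgebra.counit (R := k)) (unitFreeLin f 1) = 0 := by
    refine hF.eq_zero_of_tensorSquareForm fun a b => ?_
    obtain ⟨b, rfl⟩ := hχ b
    have h1 := LinearMap.congr_fun hf (a * 1 * b)
    rw [homForm_apply, ← unitFreeLin_mul_toCofree, ← toCofree_mul_unitFreeLin, counitSquareForm,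
      LinearMap.comp_apply, sliceLeft_counit_mul, sliceLeft_counit_mul,
      sliceLeft_counit_toCofree, sliceLeft_counit_toCofree] at h1
    exact h1
  apply unitFreeLin_injective
  ext a
  rw [← mul_one a, ← toCofree_mul_unitFreeLin, unitFreeLin_one, hw]
  simp

/-- The morphism from the unit object to the free object given by a twisted Casimir element. -/
noncomputable def ofCasimir (𝔸 : LeftComoduleAlgebra k H A) (χ : H →ₐ[k] k) (w : A ⊗[k] A)
    (hw : ∀ b, (b ⊗ₜ[k] 1) * w = w * (1 ⊗ₜ[k] 𝔸.twist χ b)) : unit 𝔸 ⟶ free 𝔸 χ :=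
  homMk (X := unit 𝔸) (Y := free 𝔸 χ)
    (LinearMap.mulRight k (1 ⊗ₜ[k] w : H ⊗[k] (A ⊗[k] A)) ∘ₗ
      (𝔸.toCofree Algebra.TensorProduct.includeLeft).toLinearMap)
    (fun a (x : A) => by
      change 𝔸.toCofree (Algebra.TensorProduct.includeLeft : A →ₐ[k] A ⊗[k] A) (a * x) * ((1 : H) ⊗ₜ[k] w) =
        𝔸.toCofree (Algebra.TensorProduct.includeLeft : A →ₐ[k] A ⊗[k] A) a *
          (𝔸.toCofree (Algebra.TensorProduct.includeLeft : A →ₐ[k] A ⊗[k] A) x * ((1 : H) ⊗ₜ[k] w))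
      rw [map_mul, mul_assoc])
    (fun (x : A) a => by
      change 𝔸.toCofree (Algebra.TensorProduct.includeLeft : A →ₐ[k] A ⊗[k] A) (x * a) * ((1 : H) ⊗ₜ[k] w) =
        𝔸.toCofree (Algebra.TensorProduct.includeLeft : A →ₐ[k] A ⊗[k] A) x * ((1 : H) ⊗ₜ[k] w) *
          𝔸.toCofree (Algebra.TensorProduct.includeRight.comp (𝔸.twist χ) : A →ₐ[k] A ⊗[k] A) a
      rw [map_mul, mul_assoc, mul_assoc]
      congr 1
      rw [toCofree_apply, toCofree_apply]
      induction 𝔸.coact a with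
      | zero => simp
      | add x y hx hy => simp only [map_add, mul_add, add_mul, hx, hy]
      | tmul p b => simp [hw])
    (fun ω (x : A) => by
      change 𝔸.toCofree _ (sliceLeft A ω (𝔸.coact x)) * _ = sliceLeft (H ⊗[k] (A ⊗[k] A)) ω
        ((free 𝔸 χ).coact (𝔸.toCofree _ x * _ : H ⊗[k] (A ⊗[k] A)))
      rw [free_coact, map_mul, cofree_coact_toCofree, cofree_coact, LinearMap.rTensor_tmul,
        Bialgebra.comul_one, Algebra.TensorProduct.one_def, TensorProduct.assoc_tmul,
        sliceLeft_mul_one_tmul, sliceLeft_lTensor]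
      rfl)

theorem unitFreeLin_ofCasimir (w : A ⊗[k] A) (hw) (a : A) :
    unitFreeLin (ofCasimir 𝔸 χ w hw) a =
      𝔸.toCofree Algebra.TensorProduct.includeLeft a * (1 ⊗ₜ[k] w) := rfl

/-- Writing `φ` composed with the inverse twist as `l(s -)`, the Casimir element attached to `s`
defines a morphism with form `φ`. -/
theorem homForm_surjective {l : A →ₗ[k] k} (hF : IsFrobeniusTrace l)
    (hχ : Function.Bijective (𝔸.twist χ)) : Function.Surjective (homForm l 𝔸 χ) := by
  intro φ
  let τ := (AlgEquiv.ofBijective (𝔸.twist χ) hχ).symm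
  obtain ⟨s, hs⟩ := hF.2 (φ ∘ₗ τ.toLinearMap)
  obtain ⟨w, hw, hw'⟩ := hF.exists_casimir (𝔸.twist χ) s
  refine ⟨ofCasimir 𝔸 χ w hw, LinearMap.ext fun a => ?_⟩
  rw [homForm_apply, unitFreeLin_ofCasimir, counitSquareForm, LinearMap.comp_apply,
    sliceLeft_counit_mul, sliceLeft_counit_toCofree]
  have h1 := LinearMap.congr_fun hs (𝔸.twist χ a)
  have h2 : τ (𝔸.twist χ a) = a := (AlgEquiv.ofBijective (𝔸.twist χ) hχ).symm_apply_apply a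
  simpa [hw', h2] using h1

/-- The isomorphism `A ≃ Hom(A, P)^*` given by `a ↦ (f ↦ (ε ⊗ l ⊗ l)(f(ν(a))))`. -/
noncomputable def dualHomEquiv {l : A →ₗ[k] k} (hF : IsFrobeniusTrace l)
    (hχ : Function.Bijective (𝔸.twist χ)) :
    A ≃ₗ[k] Module.Dual k (unit 𝔸 ⟶ free 𝔸 χ) :=
  -- The initial `ν` is a normalization: `a` acts on the dual of `Hom(A, P)` through multiplication
  -- by `ν(a)`, so this makes the transported left action regular.
  hF.nakayamaEquiv.toLinearEquiv ≪≫ₗ Module.evalEquiv k A ≪≫ₗ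
    (LinearEquiv.ofBijective (homForm l 𝔸 χ)
      ⟨homForm_injective hF hχ.2, homForm_surjective hF hχ⟩).dualMap

end RelHopfBimod

namespace IsDualIntegral

variable [Module.Finite k H] {μ : H →ₗ[k] k} {t : H} (h : IsDualIntegral μ t)

include h in
theorem twist_compAntipode_bijective (𝔸 : LeftComoduleAlgebra k H A) :
    Function.Bijective (𝔸.twist h.modular.compAntipode) :=
  ⟨fun a b hab => by
    rw [← 𝔸.twist_twist_compAntipode h.modular a, hab, 𝔸.twist_twist_compAntipode],
    fun a => ⟨_, 𝔸.twist_compAntipode_twist h.modular a⟩⟩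

variable [Module.Finite k A] {𝔸 : LeftComoduleAlgebra k H A} {g : GroupLike k H} {l : A →ₗ[k] k}
  (hl : IsGrouplikeCointegral 𝔸 g l) (hF : IsFrobeniusTrace l)

/-- The value of the Nakayama functor at the unit object: the space `A` with the left regular
action, the right action twisted by `ν⁻¹ τ ν⁻¹`, and the coaction twisted by `g⁻² g_H`. -/
noncomputable def nakayamaUnit : RelHopfBimod 𝔸 :=
  RelHopfBimod.ofAlgHoms 𝔸 𝔸 ((g ^ 2)⁻¹ * h.grouplike) (AlgHom.id k A)
    (h.twistedNakayama hF 𝔸) (fun _ => (LinearMap.lTensor_id_apply _ _ _).symm)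
    (h.coact_twistedNakayama hl hF)

/-- The three structures are transported along `ψ`. Left action: `ν(a) ν(y) = ν(a y)`. Right action:
`ν(y) τ(ν⁻¹(b)) = ν(y σ(b))` with `σ = ν⁻¹ τ ν⁻¹`. Coaction: `coact_nakayama` trades `S²` for
conjugation by `g`, and `g⁻¹ (g y₍₋₁₎ g⁻¹) g⁻¹ g_H = y₍₋₁₎ g⁻² g_H`. -/
theorem isNakayama_unit_iff (N : RelHopfBimod 𝔸) :
    RelHopfBimod.IsNakayama (RelHopfBimod.unit 𝔸) N ↔ Nonempty (h.nakayamaUnit hl hF ≅ N) := by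
  have hχ := h.twist_compAntipode_bijective 𝔸
  let ψ : (h.nakayamaUnit hl hF).carrier ≃ₗ[k] Module.Dual k
      (RelHopfBimod.unit 𝔸 ⟶ RelHopfBimod.free 𝔸 h.modular.compAntipode) :=
    RelHopfBimod.dualHomEquiv (A := A) (𝔸 := 𝔸) hF hχ
  refine (h.isFree 𝔸).isNakayama_iff ψ (fun a (y : A) => ?_) (fun (y : A) b => ?_)
    (fun ω (y : A) => ?_) N
  · refine LinearMap.ext fun f => ?_
    have h1 := h.toCofree_mul_tmul 𝔸 (Algebra.TensorProduct.includeLeft : A →ₐ[k] A ⊗[k] A) a 1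
    rw [mul_one] at h1
    have h2 := h.counitSquareForm_freeLift_left 𝔸 hF a
      (RelHopfBimod.unitFreeLin f (hF.nakayama y))
    rw [RelHopfBimod.toCofree_mul_unitFreeLin, ← hF.nakayama_mul] at h2
    refine h2.symm.trans ?_
    exact congrArg (fun p => counitSquareForm k H l ((RelHopfBimod.free 𝔸 _).freeLift μ p
      (RelHopfBimod.unitFreeLin f (hF.nakayama y)))) h1.symm
  · refine LinearMap.ext fun f => ?_
    have h1 := h.tmul_mul_toCofree 𝔸 (Algebra.TensorProduct.includeRight.comp
      (𝔸.twist h.modular.compAntipode) : A →ₐ[k] A ⊗[k] A) b 1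
    rw [one_mul, AlgHom.comp_apply, twist_compAntipode_twist] at h1
    have h2 := h.counitSquareForm_freeLift_right 𝔸 hF b
      (RelHopfBimod.unitFreeLin f (hF.nakayama y))
    have h3 := h.nakayama_twistedNakayama_nakayama hF (𝔸 := 𝔸) (hF.nakayamaEquiv.symm b)
    rw [← hF.nakayamaEquiv_apply (hF.nakayamaEquiv.symm b), AlgEquiv.apply_symm_apply] at h3
    rw [RelHopfBimod.unitFreeLin_mul_toCofree, ← h3, ← hF.nakayama_mul] at h2
    refine h2.symm.trans ?_
    exact congrArg (fun p => counitSquareForm k H l ((RelHopfBimod.free 𝔸 _).freeLift μ p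
      (RelHopfBimod.unitFreeLin f (hF.nakayama y)))) h1.symm
  · refine LinearMap.ext fun f => ?_
    set x := (g ^ 2)⁻¹ * h.grouplike with hx
    let φ := counitSquareForm k H l ∘ₗ RelHopfBimod.unitFreeLin f
    have h1 : sliceLeft (H ⊗[k] (A ⊗[k] A)) ω
        ((RelHopfBimod.free 𝔸 h.modular.compAntipode).coact (h.gen A)) =
        sliceLeft H ω (Coalgebra.comul (R := k) t) ⊗ₜ[k] (1 ⊗ₜ[k] 1) :=
      (congrArg _ (RelHopfBimod.free_coact 𝔸 _ (h.gen A))).trans (sliceLeft_cofree_coact _ _ _)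
    have h2 := h.counitSquareForm_freeLift_slice hl ω
      (RelHopfBimod.unitFreeLin f (hF.nakayama y))
    have h3 : antipodeSq k H (sliceRight (tensorSquareForm l)
        (RelHopfBimod.unitFreeLin f (hF.nakayama y))) =
        g.conj (sliceRight (φ ∘ₗ hF.nakayama) (𝔸.coact y)) := by
      have e := congrArg (sliceRight φ) (hl.coact_nakayama hF y)
      rw [LinearMap.rTensor, sliceRight_map, sliceRight_map, LinearMap.comp_id] at e
      rw [← e, ← sliceRight_cofree_coact, RelHopfBimod.cofree_coact_unitFreeLin,
        sliceRight_lTensor]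
      rfl
    have h4 : φ (hF.nakayama (sliceLeft A ω (𝔸.coact y * ((x : H) ⊗ₜ[k] 1)))) =
        ω (((g⁻¹ : GroupLike k H) : H) * antipodeSq k H (sliceRight (tensorSquareForm l)
          (RelHopfBimod.unitFreeLin f (hF.nakayama y))) *
          ((g⁻¹ * h.grouplike : GroupLike k H) : H)) := by
      rw [← LinearMap.comp_apply φ, ← apply_sliceRight, sliceRight_mul_tmul_one, h3,
        GroupLike.conj_apply]
      congr 1
      rw [hx, pow_two, mul_inv_rev]
      simp only [GroupLike.val_mul, mul_assoc]
      rw [← mul_assoc ((g⁻¹ : GroupLike k H) : H) (g : H), g.val_inv_mul_val, one_mul]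
    refine h4.trans (h2.symm.trans ?_)
    exact congrArg (fun p => counitSquareForm k H l ((RelHopfBimod.free 𝔸 _).freeLift μ p
      (RelHopfBimod.unitFreeLin f (hF.nakayama y)))) h1.symm

end IsDualIntegral

end NakayamaOfUnit

/-! ## Unimodularity for left coideal subalgebras -/

section Unimodularity

open HopfAlgebra LeftComoduleAlgebra

variable {k H : Type u} [Field k] [Ring H] [HopfAlgebra k H]

namespace IsLeftCoidealSubalgebra

variable {A : Subalgebra k H} (hA : IsLeftCoidealSubalgebra A)

theorem lTensor_val_coact (a : A) :
    A.val.toLinearMap.lTensor H (hA.comoduleAlgebra.coact a) = Coalgebra.comul (R := k) (a : H) :=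
  hA.incl_coaction a

theorem coact_of_val_eq_grouplike {a : A} {x : GroupLike k H} (ha : (a : H) = x) :
    hA.comoduleAlgebra.coact a = (x : H) ⊗ₜ[k] a := by
  apply incl_injective A
  refine (hA.lTensor_val_coact a).trans ?_
  rw [ha, x.2.comul_eq_tmul_self, incl_eq, LinearMap.lTensor_tmul, ← ha]
  rfl

theorem sliceRight_coact (φ : H →ₗ[k] k) (a : A) :
    sliceRight (φ ∘ₗ A.val.toLinearMap) (hA.comoduleAlgebra.coact a) =
      sliceRight φ (Coalgebra.comul (R := k) (a : H)) := by
  rw [← sliceRight_lTensor, lTensor_val_coact]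

theorem sliceRight_counit_coact (a : A) :
    sliceRight (Coalgebra.counit (R := k) ∘ₗ A.val.toLinearMap) (hA.comoduleAlgebra.coact a) =
      (a : H) := by
  rw [sliceRight_coact]
  have := Coalgebra.lTensor_counit_comul (R := k) (a : H)
  simp [sliceRight, this]

theorem coe_twist (χ : H →ₐ[k] k) (a : A) :
    (hA.comoduleAlgebra.twist χ a : H) = (regular k H).twist χ (a : H) := by
  rw [twist_apply, twist_apply, regular_coact, ← hA.lTensor_val_coact, sliceLeft_lTensor]
  rfl

theorem counit_twist (χ : H →ₐ[k] k) (a : A) :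
    Coalgebra.counit (R := k) (hA.comoduleAlgebra.twist χ a : H) = χ (a : H) := by
  rw [coe_twist, twist_apply, regular_coact, counit_sliceLeft_comul]
  rfl

/-- Left multiplication by `x` on the finite-dimensional `A` is injective, hence surjective; the
solution of `x y = 1` in `A` is the inverse. -/
theorem _root_.Subalgebra.grouplike_inv_mem [Module.Finite k H] {x : GroupLike k H}
    (hx : (x : H) ∈ A) : ((x⁻¹ : GroupLike k H) : H) ∈ A := by
  let xA : A := ⟨x, hx⟩
  have hinj : Function.Injective (LinearMap.mulLeft k xA) := by
    intro a b hab
    have h1 := congrArg (fun y : A => ((x⁻¹ : GroupLike k H) : H) * y) hab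
    simp only [LinearMap.mulLeft_apply, MulMemClass.coe_mul, xA, ← mul_assoc,
      x.val_inv_mul_val, one_mul] at h1
    exact Subtype.ext h1
  obtain ⟨y, hy⟩ := LinearMap.injective_iff_surjective.1 hinj 1
  have h2 : (x : H) * y = 1 := congrArg Subtype.val hy
  have h3 : ((x⁻¹ : GroupLike k H) : H) = y := by
    rw [← mul_one ((x⁻¹ : GroupLike k H) : H), ← h2, ← mul_assoc, x.val_inv_mul_val, one_mul]
  rw [h3]
  exact y.2

end IsLeftCoidealSubalgebra

namespace IsDualIntegral

variable [Module.Finite k H] {μ : H →ₗ[k] k} {t : H} (h : IsDualIntegral μ t)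
variable {A : Subalgebra k H} (hA : IsLeftCoidealSubalgebra A) {g : GroupLike k H}
  {l : A →ₗ[k] k} (hl : IsGrouplikeCointegral hA.comoduleAlgebra g l) (hF : IsFrobeniusTrace l)

theorem nakayamaUnit_coact_one {A : Type u} [Ring A] [Algebra k A] [Module.Finite k A]
    {𝔸 : LeftComoduleAlgebra k H A} {l : A →ₗ[k] k} (hl : IsGrouplikeCointegral 𝔸 g l)
    (hF : IsFrobeniusTrace l) :
    (h.nakayamaUnit hl hF).coact (1 : A) =
      (((g ^ 2)⁻¹ * h.grouplike : GroupLike k H) : H) ⊗ₜ[k] (1 : A) := by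
  change 𝔸.coact 1 * _ = _
  rw [map_one, one_mul]

/-- A left linear map `θ` is right multiplication by `θ(1)`. Colinearity gives `Δ(θ(1)) = x ⊗ θ(1)`,
so applying `ε` to the second leg yields `θ(1) = ε(θ(1)) x`; right linearity then becomes the
commutation rule. Conversely, right multiplication by `x` is an isomorphism with inverse right
multiplication by `x⁻¹`. -/
theorem nonempty_nakayamaUnit_iso_iff :
    Nonempty (h.nakayamaUnit hl hF ≅ RelHopfBimod.unit hA.comoduleAlgebra) ↔
      (((g ^ 2)⁻¹ * h.grouplike : GroupLike k H) : H) ∈ A ∧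
      ∀ b : A, (h.twistedNakayama hF hA.comoduleAlgebra b : H) *
        (((g ^ 2)⁻¹ * h.grouplike : GroupLike k H) : H) =
        (((g ^ 2)⁻¹ * h.grouplike : GroupLike k H) : H) * b := by
  set x := (g ^ 2)⁻¹ * h.grouplike with hx
  constructor
  · rintro ⟨i⟩
    let θ : A →ₗ[k] A := RelHopfBimod.toLin i.hom
    have hθL : ∀ a b : A, θ (a * b) = a * θ b := fun a b => RelHopfBimod.toLin_actL i.hom a b
    have hθR : ∀ b a : A, θ (b * h.twistedNakayama hF hA.comoduleAlgebra a) = θ b * a :=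
      fun b a => RelHopfBimod.toLin_actR i.hom b a
    have hθC : hA.comoduleAlgebra.coact (θ 1) = (x : H) ⊗ₜ[k] θ 1 := by
      refine (RelHopfBimod.coact_toLin i.hom (1 : A)).trans ?_
      rw [h.nakayamaUnit_coact_one hl hF]
      rfl
    set c := Coalgebra.counit (R := k) ((θ 1 : A) : H) with hc
    have hu : ((θ 1 : A) : H) = c • (x : H) := by
      rw [← hA.sliceRight_counit_coact (θ 1), hθC, sliceRight_tmul]
      rfl
    -- If `c = 0` then `θ = 0`, which for an isomorphism would give `1 = 0` in `A`; applying `ε`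
    -- excludes this.
    have hc0 : c ≠ 0 := by
      intro h0
      rw [h0, zero_smul] at hu
      have h1 : θ 1 = 0 := Subtype.ext hu
      have h2 : ∀ a : A, θ a = 0 := fun a => by rw [← mul_one a, hθL, h1, mul_zero]
      have h3 : RelHopfBimod.toLin i.inv (θ 1) = (1 : A) :=
        congrArg (fun f => RelHopfBimod.toLin f (1 : A)) i.hom_inv_id
      have h4 : (1 : A) = 0 := by
        rw [← h3, h2]
        exact map_zero _
      exact one_ne_zero (α := k) (by
        have h5 := congrArg (fun y : A => Coalgebra.counit (R := k) (y : H)) h4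
        simp at h5)
    refine ⟨?_, fun b => ?_⟩
    · have h1 : (x : H) = c⁻¹ • ((θ 1 : A) : H) := by
        rw [hu, smul_smul, inv_mul_cancel₀ hc0, one_smul]
      rw [h1]
      exact A.smul_mem (θ 1).2 _
    · have h1 := hθR 1 b
      rw [one_mul, ← mul_one (h.twistedNakayama hF hA.comoduleAlgebra b), hθL] at h1
      have h2 := congrArg (fun y : A => (y : H)) h1
      simp only [MulMemClass.coe_mul, hu, mul_smul_comm, smul_mul_assoc] at h2
      exact smul_right_injective H hc0 h2
  · rintro ⟨hxA, hσ⟩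
    let xA : A := ⟨x, hxA⟩
    let yA : A := ⟨(x⁻¹ : GroupLike k H), Subalgebra.grouplike_inv_mem hxA⟩
    have hxy : xA * yA = 1 := Subtype.ext x.val_mul_val_inv
    have hyx : yA * xA = 1 := Subtype.ext x.val_inv_mul_val
    have hσ' : ∀ b : A, h.twistedNakayama hF hA.comoduleAlgebra b * xA = xA * b :=
      fun b => Subtype.ext (hσ b)
    have hσ'' : ∀ b : A, b * yA = yA * h.twistedNakayama hF hA.comoduleAlgebra b := fun b => by
      calc b * yA = yA * (xA * b) * yA := by rw [← mul_assoc yA, hyx, one_mul]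
        _ = yA * h.twistedNakayama hF hA.comoduleAlgebra b := by
          rw [← hσ', mul_assoc, mul_assoc, hxy, mul_one]
    refine ⟨⟨RelHopfBimod.homMk (X := h.nakayamaUnit hl hF)
        (Y := RelHopfBimod.unit hA.comoduleAlgebra) (show A →ₗ[k] A from LinearMap.mulRight k xA)
        (fun a b => mul_assoc a b xA) (fun (b : A) a => ?_) (fun ω (b : A) => ?_),
      RelHopfBimod.homMk (X := RelHopfBimod.unit hA.comoduleAlgebra)
        (Y := h.nakayamaUnit hl hF) (show A →ₗ[k] A from LinearMap.mulRight k yA)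
        (fun a b => mul_assoc a b yA) (fun (b : A) a => ?_) (fun ω (b : A) => ?_), ?_, ?_⟩⟩
    · change b * h.twistedNakayama hF hA.comoduleAlgebra a * xA = b * xA * a
      rw [mul_assoc, hσ', mul_assoc]
    · change sliceLeft A ω (hA.comoduleAlgebra.coact b * ((x : H) ⊗ₜ[k] 1)) * xA =
        sliceLeft A ω (hA.comoduleAlgebra.coact (b * xA))
      rw [map_mul hA.comoduleAlgebra.coact, hA.coact_of_val_eq_grouplike (a := xA) (x := x) rfl, ← sliceLeft_mul_one_tmul,
        mul_assoc, Algebra.TensorProduct.tmul_mul_tmul, mul_one, one_mul]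
    · change b * a * yA = b * yA * h.twistedNakayama hF hA.comoduleAlgebra a
      rw [mul_assoc, hσ'', mul_assoc]
    · change sliceLeft A ω (hA.comoduleAlgebra.coact b) * yA =
        sliceLeft A ω (hA.comoduleAlgebra.coact (b * yA) * ((x : H) ⊗ₜ[k] 1))
      rw [map_mul hA.comoduleAlgebra.coact, hA.coact_of_val_eq_grouplike (a := yA) (x := x⁻¹) rfl, ← sliceLeft_mul_one_tmul,
        mul_assoc, Algebra.TensorProduct.tmul_mul_tmul, mul_one, x.val_inv_mul_val]
    · refine Subtype.ext (LinearMap.ext fun (b : A) => ?_)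
      change b * xA * yA = b
      rw [mul_assoc, hxy, mul_one]
    · refine Subtype.ext (LinearMap.ext fun (b : A) => ?_)
      change b * yA * xA = b
      rw [mul_assoc, hyx, mul_one]

-- Since `ν σ ν = τ` for `σ = ν⁻¹ τ ν⁻¹`, the commutation rule says that `F = ν ∘ Ad(x) ∘ ν` equals
-- `τ`. Applying `ε` gives one implication. For the other, `coact_nakayama` used twice gives
-- `S⁴(F(a)₍₋₁₎) ⊗ F(a)₍₀₎ = g_H a₍₋₁₎ g_H⁻¹ ⊗ F(a₍₀₎)`, so `S⁴ ∘ F` depends only on `ε ∘ F = α`.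
-- Radford's formula shows that it is `S⁴ ∘ τ`, and `S` is injective.
include hl in
theorem twistedNakayama_mul_eq_iff
    (hxA : (((g ^ 2)⁻¹ * h.grouplike : GroupLike k H) : H) ∈ A) :
    (∀ b : A, (h.twistedNakayama hF hA.comoduleAlgebra b : H) *
        (((g ^ 2)⁻¹ * h.grouplike : GroupLike k H) : H) =
        (((g ^ 2)⁻¹ * h.grouplike : GroupLike k H) : H) * b) ↔
      ∀ a : A, Coalgebra.counit (R := k) ((hF.nakayama (hF.nakayama a) : A) : H) =
        h.modular (a : H) := by
  set x := (g ^ 2)⁻¹ * h.grouplike with hx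
  let xA : A := ⟨x, hxA⟩
  let yA : A := ⟨(x⁻¹ : GroupLike k H), Subalgebra.grouplike_inv_mem hxA⟩
  have hxy : xA * yA = 1 := Subtype.ext x.val_mul_val_inv
  have hyx : yA * xA = 1 := Subtype.ext x.val_inv_mul_val
  let F : A →ₗ[k] A := hF.nakayama ∘ₗ LinearMap.mulLeft k xA ∘ₗ LinearMap.mulRight k yA ∘ₗ
    hF.nakayama
  have hFapp : ∀ a, F a = hF.nakayama (xA * (hF.nakayama a * yA)) := fun _ => rfl
  -- `ε ∘ ν` is a character, so it does not see the conjugation by `x`.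
  have hcount : ∀ a : A, Coalgebra.counit (R := k) (F a : H) =
      Coalgebra.counit (R := k) ((hF.nakayama (hF.nakayama a) : A) : H) := by
    intro a
    have h1 := congrArg (fun y : A => Coalgebra.counit (R := k) ((hF.nakayama y : A) : H)) hxy
    simp only [hF.nakayama_mul, hF.nakayama_one, MulMemClass.coe_mul, Bialgebra.counit_mul,
      OneMemClass.coe_one, Bialgebra.counit_one] at h1
    simp only [hFapp, hF.nakayama_mul, MulMemClass.coe_mul, Bialgebra.counit_mul]
    linear_combination Coalgebra.counit (R := k) ((hF.nakayama (hF.nakayama a) : A) : H) * h1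
  have hiff : (∀ b : A, (h.twistedNakayama hF hA.comoduleAlgebra b : H) * (x : H) =
      (x : H) * b) ↔ ∀ a, F a = hA.comoduleAlgebra.twist h.modular a := by
    constructor
    · intro hσ a
      have h1 : h.twistedNakayama hF hA.comoduleAlgebra (hF.nakayama a) * xA =
        xA * hF.nakayama a := Subtype.ext (hσ _)
      rw [hFapp, ← mul_assoc, ← h1, mul_assoc, hxy, mul_one, h.nakayama_twistedNakayama_nakayama]
    · intro hFτ b
      obtain ⟨a, rfl⟩ : ∃ a, hF.nakayama a = b := hF.nakayamaEquiv.surjective b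
      have h1 : xA * (hF.nakayama a * yA) =
          h.twistedNakayama hF hA.comoduleAlgebra (hF.nakayama a) :=
        hF.nakayama_injective (by
          rw [← hFapp, hFτ, h.nakayama_twistedNakayama_nakayama])
      have h2 : h.twistedNakayama hF hA.comoduleAlgebra (hF.nakayama a) * xA =
          xA * hF.nakayama a := by
        rw [← h1, mul_assoc, mul_assoc, hyx, mul_one]
      exact congrArg Subtype.val h2
  rw [hiff]
  constructor
  · intro hFτ a
    rw [← hcount, hFτ, hA.counit_twist]
  · intro hε a
    -- `S⁴(F(a)) = g_H a₍₁₎ g_H⁻¹ α(a₍₂₎)`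
    have hS : Function.Injective (antipodeSq k H ∘ antipodeSq k H) :=
      (h.antipode_bijective.1.comp h.antipode_bijective.1).comp
        (h.antipode_bijective.1.comp h.antipode_bijective.1)
    apply Subtype.ext
    apply hS
    have e1 : hA.comoduleAlgebra.coact (xA * (hF.nakayama a * yA)) =
        TensorProduct.map x.conj (LinearMap.mulLeft k xA ∘ₗ LinearMap.mulRight k yA)
          (hA.comoduleAlgebra.coact (hF.nakayama a)) := by
      rw [map_mul, map_mul, hA.coact_of_val_eq_grouplike (a := xA) (x := x) rfl,
        hA.coact_of_val_eq_grouplike (a := yA) (x := x⁻¹) rfl]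
      induction hA.comoduleAlgebra.coact (hF.nakayama a) with
      | zero => simp
      | add x y hx hy => simp only [map_add, add_mul, mul_add, hx, hy]
      | tmul p q => simp [mul_assoc]
    have e2 : (antipodeSq k H).rTensor A ((antipodeSq k H).rTensor A
        (hA.comoduleAlgebra.coact (F a))) =
        TensorProduct.map h.grouplike.conj F (hA.comoduleAlgebra.coact a) := by
      have e3 : (antipodeSq k H).rTensor A (hA.comoduleAlgebra.coact (F a)) =
          TensorProduct.map (g * x).conj
            (hF.nakayama ∘ₗ LinearMap.mulLeft k xA ∘ₗ LinearMap.mulRight k yA)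
            (hA.comoduleAlgebra.coact (hF.nakayama a)) := by
        rw [hFapp, hl.coact_nakayama hF, e1, ← LinearMap.comp_apply, ← TensorProduct.map_comp,
          ← GroupLike.conj_mul]
      have e4 : ∀ (y : GroupLike k H) (f : A →ₗ[k] A) (z : H ⊗[k] A),
          (antipodeSq k H).rTensor A (TensorProduct.map y.conj f z) =
          TensorProduct.map y.conj f ((antipodeSq k H).rTensor A z) := by
        intro y f z
        simp only [LinearMap.rTensor, ← LinearMap.comp_apply, ← TensorProduct.map_comp,
          antipodeSq_comp_conj, LinearMap.comp_id, LinearMap.id_comp]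
      -- The exponent of `g` in `x = g⁻² g_H` is cancelled by the two occurrences of `ν`, because
      -- `g_H` commutes with `g`.
      have e5 : g * x * g = h.grouplike := by
        rw [hx, mul_assoc, mul_assoc, h.grouplike_mul_comm, pow_two, mul_inv_rev]
        group
      rw [e3, e4, hl.coact_nakayama hF, ← LinearMap.comp_apply, ← TensorProduct.map_comp,
        ← GroupLike.conj_mul, e5]
      rfl
    have e6 := congrArg (sliceRight (Coalgebra.counit (R := k) ∘ₗ A.val.toLinearMap)) e2
    have e7 : (Coalgebra.counit (R := k) ∘ₗ A.val.toLinearMap) ∘ₗ F =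
        h.modular.toLinearMap ∘ₗ A.val.toLinearMap :=
      LinearMap.ext fun b => (hcount b).trans (hε b)
    rw [LinearMap.rTensor, sliceRight_map, LinearMap.comp_id, sliceRight_map, LinearMap.comp_id,
      hA.sliceRight_counit_coact, sliceRight_map, e7, hA.sliceRight_coact] at e6
    rw [hA.coe_twist]
    exact e6.trans (LinearMap.congr_fun h.antipode_pow_four_twist (a : H)).symm

end IsDualIntegral

end Unimodularity

theorem mainTheorem11 {k H : Type u} [Field k] [Ring H] [HopfAlgebra k H] [Module.Finite k H]
    (μ : H →ₗ[k] k) (hμ : IsRightCointegral μ) (hμ0 : μ ≠ 0)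
    (Λ : H) (hΛ : IsLeftIntegral k Λ) (hΛ0 : Λ ≠ 0)
    (A : Subalgebra k H) (hA : IsLeftCoidealSubalgebra A)
    (gA : GroupLike k H) (l : A →ₗ[k] k)
    (hl : IsGrouplikeCointegral hA.comoduleAlgebra gA l) (hl0 : l ≠ 0) :
    ∃ hF : IsFrobeniusTrace l,
      (RelHopfBimod.Unimodular hA.comoduleAlgebra ↔
        (((distinguishedGrouplike μ)⁻¹ * gA ^ 2 : GroupLike k H) : H) ∈ A ∧
        ∀ a : A, Coalgebra.counit (R := k) ((hF.nakayama (hF.nakayama a) : A) : H) =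
          leftModularFunction k Λ (a : H)) := by
  obtain ⟨t, h⟩ := hμ.exists_isDualIntegral hμ0
  have : Nontrivial H := by
    by_contra hH
    have := not_nontrivial_iff_subsingleton.1 hH
    exact hμ0 (LinearMap.ext fun a => by rw [Subsingleton.elim a 0, map_zero, map_zero])
  have hF : IsFrobeniusTrace l := hl.isFrobeniusTrace hA h.antipode_bijective hl0
  refine ⟨hF, ?_⟩
  rw [RelHopfBimod.Unimodular, h.isNakayama_unit_iff hl hF, h.nonempty_nakayamaUnit_iso_iff hA hl hF,
    h.distinguishedGrouplike_eq, h.leftModularFunction_eq hΛ hΛ0]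
  -- The element in the criterion is the inverse of `x = g_A⁻² g_H`, and membership in `A` is
  -- insensitive to inversion.
  have hinv : h.grouplike⁻¹ * gA ^ 2 = ((gA ^ 2)⁻¹ * h.grouplike)⁻¹ := by
    rw [mul_inv_rev, inv_inv]
  rw [hinv]
  constructor
  · rintro ⟨hx, hσ⟩
    exact ⟨Subalgebra.grouplike_inv_mem hx, (h.twistedNakayama_mul_eq_iff hA hl hF hx).1 hσ⟩
  · rintro ⟨hx, hε⟩
    have hx' := Subalgebra.grouplike_inv_mem hx
    rw [inv_inv] at hx'
    exact ⟨hx', (h.twistedNakayama_mul_eq_iff hA hl hF hx').2 hε⟩
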